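/- Let $N\ge 1$, $s\in(0,1)$, let $\Omega\subset\mathbb R^N$ be a bounded strictly convex $C^2$-domain (nonempty, open, convex, with strictly convex closure and $C^2$ boundary), and let $g:\mathbb R^N\setminus\Omega\to\mathbb R$ be continuous and bounded. For $f\in L_s(\mathbb R)=\{f\in L^1_{loc}(\mathbb R):\int_{\mathbb R}|f(r)|(1+|r|)^{-1-2s}\,dr<\infty\}$, locally bounded, "the solution $v$ of $\Delta_1^s v=0$ in $(0,1)$, $v=f$ in $\mathbb R\setminus(0,1)$" means the function $v$ that equals $f$ outside $(0,1)$, is bounded on $(0,1)$ and satisfies $\Delta^s_1v(t):=\mathrm{p.v.}\!\int_{\mathbb R}\frac{v(r)-v(t)}{|r-t|^{1+2s}}\,dr=0$ in $(0,1)$ in the viscosity sense: whenever $I\subset(0,1)$ is an open interval, $t_0\in I$, $\phi\in C^2(\mathbb R)$, and $\phi$ touches the upper (lower) semicontinuous envelope $\bar v$ of $v$ from above (below) on $I$ at $t_0$, then the function equal to $\phi$ in $I$, to $\bar v$ in $(0,1)\setminus I$ and to $f$ outside $(0,1)$ has $\Delta_1^s\ge 0$ ($\le0$) at $t_0$. Let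 $\mathcal L_s$ be the set of measurable locally bounded $u:\mathbb R^N\to\mathbb R$ such that $t\mapsto u(x+tz)$ belongs to $L_s(\mathbb R)$ for all $x\in\Omega$, $|z|=1$. A function $u\in\mathcal L_s$ is $s$-convex in $\overline\Omega$ if for all $x\ne y$ in $\overline\Omega$ such that the open segment between $x$ and $y$ is contained in $\overline\Omega$ one has $u(tx+(1-t)y)\le v(t)$ for every $t\in(0,1)$, where $v$ is the solution with exterior datum $f(t)=u(tx+(1-t)y)$. Let $H(g)$ be the set of $w\in\mathcal L_s$ that are $s$-convex in $\overline\Omega$ and satisfy $w\le g$ in $\mathbb R^N\setminus\Omega$. The $s$-convex envelope of $g$ is $u^*(x)=\sup\{w(x):w\in H(g)\}$, $x\in\mathbb R^N$. Then: 1. $u^*$ is well defined: the supremum is finite at every $x\in\mathbb R^N$, and $u^*$ itself belongs to $H(g)$ (in particular $H(g)\neq\emptyset$). 2. $u^*$ is continuous in $\overline\Omega$ and $u^*=g$ on $\partial\Omega$. 3. $u^*=g$ in $\mathbb R^N\setminus\Omega$, and $u^*$ is the unique viscosity solution of $$\Lambda_1^su(x):=\inf_{z\in\mathbb S^{N-1}}\int_{\mathbb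 R}\frac{u(x+tz)-u(x)}{|t|^{1+2s}}\,dt=0\ \text{ in }\Omega,\qquad u=g\ \text{ in }\mathbb R^N\setminus\Omega .$$ Here a bounded function $u:\mathbb R^N\to\mathbb R$ is a viscosity solution if its upper (lower) semicontinuous envelope on $\mathbb R^N$ is a viscosity subsolution (supersolution). For a bounded function $w$, $\delta>0$ and $\phi\in C^2(\mathbb R^N)$ put $$E_\delta(w,\phi,x)=-\inf_{z\in\mathbb S^{N-1}}\Big\{\mathrm{p.v.}\!\int_{-\delta}^{\delta}\frac{\phi(x+tz)-\phi(x)}{|t|^{1+2s}}\,dt+\int_{|t|\ge\delta}\frac{w(x+tz)-w(x)}{|t|^{1+2s}}\,dt\Big\}.$$ Let $u^g$ (resp. $u_g$) equal $u$ in $\Omega$, $g$ in $\mathbb R^N\setminus\overline\Omega$, and $\max\{u,g\}$ (resp. $\min\{u,g\}$) on $\partial\Omega$. A bounded upper semicontinuous $u$ is a viscosity subsolution if $u\le g$ in $\mathbb R^N\setminus\overline\Omega$ and, for all $\delta>0$ and $\phi\in C^2(\mathbb R^N)$ such that $x_0$ is a maximum point of $u-\phi$ in $B_\delta(x_0)$,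 one has $E_\delta(u^g,\phi,x_0)\le0$ if $x_0\in\Omega$ and $\min\{E_\delta(u^g,\phi,x_0),u(x_0)-g(x_0)\}\le0$ if $x_0\in\partial\Omega$. A bounded lower semicontinuous $u$ is a viscosity supersolution if $u\ge g$ in $\mathbb R^N\setminus\overline\Omega$ and, for all $\delta>0$ and $\phi\in C^2(\mathbb R^N)$ such that $x_0$ is a minimum point of $u-\phi$ in $B_\delta(x_0)$, one has $E_\delta(u_g,\phi,x_0)\ge0$ if $x_0\in\Omega$ and $\max\{E_\delta(u_g,\phi,x_0),u(x_0)-g(x_0)\}\ge0$ if $x_0\in\partial\Omega$. -/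

import Mathlib

open Set Filter Topology MeasureTheory

noncomputable section

namespace FracConvex

/-! ### Semicontinuous envelopes

For a locally bounded `w`, `inf_{r>0} sup_{B(x,r)} w` is the `limsup` of `w` along the full
neighbourhood filter `𝓝 x` (the point `x` included), and dually for the lower envelope. -/

/-- Upper semicontinuous envelope of a locally bounded function. -/
def upperEnv {X : Type*} [TopologicalSpace X] (w : X → ℝ) (x : X) : ℝ := limsup w (𝓝 x)

/-- Lower semicontinuous envelope of a locally bounded function. -/
def lowerEnv {X : Type*} [TopologicalSpace X] (w : X → ℝ) (x : X) : ℝ := liminf w (𝓝 x)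

/-! ### The one-dimensional fractional Laplacian and its Dirichlet problem on `(0, 1)` -/

/-- One-dimensional `s`-fractional Laplacian (without the normalising constant)
`p.v. ∫ (ψ r - ψ t) / |r - t| ^ (1 + 2 s) dr`. The principal value is written through symmetric
second differences, which are absolutely integrable near `0` when `ψ` is `C²` near `t`. -/
def fracLap (s : ℝ) (ψ : ℝ → ℝ) (t : ℝ) : ℝ :=
  ∫ r in Ioi (0 : ℝ), (ψ (t + r) + ψ (t - r) - 2 * ψ t) / r ^ (1 + 2 * s)

open Classical in
/-- `v` is a (bounded on `(0, 1)`) viscosity solution of `Δ₁ˢ v = 0` in `(0, 1)`,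
`v = f` in `ℝ \ (0, 1)`. Test functions touch the semicontinuous envelopes of `v` on an open
interval `(a, b) ⊆ (0, 1)`; outside that interval the operator sees the envelope of `v` in the
rest of `(0, 1)`, and the datum outside `(0, 1)`. -/
structure IsDirichletSol (s : ℝ) (f v : ℝ → ℝ) : Prop where
  bounded : ∃ M : ℝ, ∀ t ∈ Ioo (0 : ℝ) 1, |v t| ≤ M
  datum : ∀ t ∉ Ioo (0 : ℝ) 1, v t = f t
  sub : ∀ (a b t₀ : ℝ) (φ : ℝ → ℝ), Ioo a b ⊆ Ioo 0 1 → t₀ ∈ Ioo a b → ContDiff ℝ 2 φ →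
    φ t₀ = upperEnv v t₀ → (∀ t ∈ Ioo a b, upperEnv v t ≤ φ t) →
    0 ≤ fracLap s ((Ioo a b).piecewise φ ((Ioo (0 : ℝ) 1).piecewise (upperEnv v) f)) t₀
  super : ∀ (a b t₀ : ℝ) (φ : ℝ → ℝ), Ioo a b ⊆ Ioo 0 1 → t₀ ∈ Ioo a b → ContDiff ℝ 2 φ →
    φ t₀ = lowerEnv v t₀ → (∀ t ∈ Ioo a b, φ t ≤ lowerEnv v t) →
    fracLap s ((Ioo a b).piecewise φ ((Ioo (0 : ℝ) 1).piecewise (lowerEnv v) f)) t₀ ≤ 0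

/-! ### `s`-convexity and the `s`-convex envelope -/

/-- The weighted space `L_s(ℝ)`. -/
def MemLs (s : ℝ) (f : ℝ → ℝ) : Prop :=
  LocallyIntegrable f ∧ Integrable (fun r : ℝ => |f r| / (1 + |r|) ^ (1 + 2 * s))

variable {N : ℕ}

/-- The space `𝓛_s(ℝᴺ)`: measurable, locally bounded functions whose restriction to every line
meeting `Ω` belongs to `L_s(ℝ)`. -/
structure MemLineLs (s : ℝ) (Ω : Set (EuclideanSpace ℝ (Fin N)))
    (u : EuclideanSpace ℝ (Fin N) → ℝ) : Prop where
  measurable : AEStronglyMeasurable u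
  locallyBounded : ∀ R : ℝ, ∃ M : ℝ, ∀ x, ‖x‖ ≤ R → |u x| ≤ M
  lines : ∀ x ∈ Ω, ∀ z : EuclideanSpace ℝ (Fin N), ‖z‖ = 1 → MemLs s (fun t : ℝ => u (x + t • z))

/-- The segment condition of `s`-convexity in `A`: on each segment `(x, y)` contained in `A`, `u`
lies below the solution of the one-dimensional fractional Dirichlet problem whose exterior datum
is `u` on the rest of the line. -/
def SConvexOn (s : ℝ) (A : Set (EuclideanSpace ℝ (Fin N)))
    (u : EuclideanSpace ℝ (Fin N) → ℝ) : Prop :=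
  ∀ x ∈ A, ∀ y ∈ A, x ≠ y → openSegment ℝ x y ⊆ A →
    ∃ v : ℝ → ℝ, IsDirichletSol s (fun t : ℝ => u (t • x + (1 - t) • y)) v ∧
      ∀ t ∈ Ioo (0 : ℝ) 1, u (t • x + (1 - t) • y) ≤ v t

/-- The class `H(g)` of functions that are `s`-convex in the closure of `Ω` and lie below `g`
outside `Ω`. -/
def belowDatum (s : ℝ) (Ω : Set (EuclideanSpace ℝ (Fin N)))
    (g : EuclideanSpace ℝ (Fin N) → ℝ) : Set (EuclideanSpace ℝ (Fin N) → ℝ) :=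
  {w | MemLineLs s Ω w ∧ SConvexOn s (closure Ω) w ∧ ∀ x ∉ Ω, w x ≤ g x}

/-- The `s`-convex envelope of `g`: the pointwise supremum of the class `H(g)`. -/
def sConvexEnvelope (s : ℝ) (Ω : Set (EuclideanSpace ℝ (Fin N)))
    (g : EuclideanSpace ℝ (Fin N) → ℝ) (x : EuclideanSpace ℝ (Fin N)) : ℝ :=
  sSup ((fun w : EuclideanSpace ℝ (Fin N) → ℝ => w x) '' belowDatum s Ω g)

/-! ### Viscosity solutions of `Λ₁ˢ u = 0` in `Ω`, `u = g` outside `Ω` -/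

open Classical in
/-- Upper `g`-extension of `u` (for open `Ω`). -/
def upperExt (Ω : Set (EuclideanSpace ℝ (Fin N))) (g u : EuclideanSpace ℝ (Fin N) → ℝ)
    (x : EuclideanSpace ℝ (Fin N)) : ℝ :=
  if x ∈ Ω then u x else if x ∈ frontier Ω then max (u x) (g x) else g x

open Classical in
/-- Lower `g`-extension of `u` (for open `Ω`). -/
def lowerExt (Ω : Set (EuclideanSpace ℝ (Fin N))) (g u : EuclideanSpace ℝ (Fin N) → ℝ)
    (x : EuclideanSpace ℝ (Fin N)) : ℝ :=
  if x ∈ Ω then u x else if x ∈ frontier Ω then min (u x) (g x) else g x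

/-- `p.v. ∫_{-δ}^{δ} (φ (x + t z) - φ x) / |t| ^ (1 + 2 s) dt` for a `C²` function `φ`, written
through symmetric second differences. -/
def innerPart (s δ : ℝ) (φ : EuclideanSpace ℝ (Fin N) → ℝ) (x z : EuclideanSpace ℝ (Fin N)) : ℝ :=
  ∫ t in Ioo (0 : ℝ) δ, (φ (x + t • z) + φ (x - t • z) - 2 * φ x) / t ^ (1 + 2 * s)

/-- `∫_{|t| ≥ δ} (w (x + t z) - w x) / |t| ^ (1 + 2 s) dt`. -/
def outerPart (s δ : ℝ) (w : EuclideanSpace ℝ (Fin N) → ℝ) (x z : EuclideanSpace ℝ (Fin N)) : ℝ :=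
  ∫ t in {t : ℝ | δ ≤ |t|}, (w (x + t • z) - w x) / |t| ^ (1 + 2 * s)

/-- `E_δ(w, φ, x) = - inf_{z ∈ S^{N-1}} (I¹_{z,δ}(φ, x) + I²_{z,δ}(w, x))`. -/
def evalE (s δ : ℝ) (w φ : EuclideanSpace ℝ (Fin N) → ℝ) (x : EuclideanSpace ℝ (Fin N)) : ℝ :=
  -⨅ z : Metric.sphere (0 : EuclideanSpace ℝ (Fin N)) 1,
    (innerPart s δ φ x (z : EuclideanSpace ℝ (Fin N)) +
      outerPart s δ w x (z : EuclideanSpace ℝ (Fin N)))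

/-- Bounded upper semicontinuous viscosity subsolutions. -/
structure IsViscositySub (s : ℝ) (Ω : Set (EuclideanSpace ℝ (Fin N)))
    (g u : EuclideanSpace ℝ (Fin N) → ℝ) : Prop where
  bounded : ∃ M : ℝ, ∀ x, |u x| ≤ M
  usc : UpperSemicontinuous u
  exterior : ∀ x ∉ closure Ω, u x ≤ g x
  interior_test : ∀ (δ : ℝ) (φ : EuclideanSpace ℝ (Fin N) → ℝ), 0 < δ → ContDiff ℝ 2 φ →
    ∀ x₀ ∈ Ω, IsMaxOn (fun x => u x - φ x) (Metric.ball x₀ δ) x₀ →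
      evalE s δ (upperExt Ω g u) φ x₀ ≤ 0
  boundary_test : ∀ (δ : ℝ) (φ : EuclideanSpace ℝ (Fin N) → ℝ), 0 < δ → ContDiff ℝ 2 φ →
    ∀ x₀ ∈ frontier Ω, IsMaxOn (fun x => u x - φ x) (Metric.ball x₀ δ) x₀ →
      min (evalE s δ (upperExt Ω g u) φ x₀) (u x₀ - g x₀) ≤ 0

/-- Bounded lower semicontinuous viscosity supersolutions. -/
structure IsViscositySuper (s : ℝ) (Ω : Set (EuclideanSpace ℝ (Fin N)))
    (g u : EuclideanSpace ℝ (Fin N) → ℝ) : Prop where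
  bounded : ∃ M : ℝ, ∀ x, |u x| ≤ M
  lsc : LowerSemicontinuous u
  exterior : ∀ x ∉ closure Ω, g x ≤ u x
  interior_test : ∀ (δ : ℝ) (φ : EuclideanSpace ℝ (Fin N) → ℝ), 0 < δ → ContDiff ℝ 2 φ →
    ∀ x₀ ∈ Ω, IsMinOn (fun x => u x - φ x) (Metric.ball x₀ δ) x₀ →
      0 ≤ evalE s δ (lowerExt Ω g u) φ x₀
  boundary_test : ∀ (δ : ℝ) (φ : EuclideanSpace ℝ (Fin N) → ℝ), 0 < δ → ContDiff ℝ 2 φ →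
    ∀ x₀ ∈ frontier Ω, IsMinOn (fun x => u x - φ x) (Metric.ball x₀ δ) x₀ →
      0 ≤ max (evalE s δ (lowerExt Ω g u) φ x₀) (u x₀ - g x₀)

/-- Viscosity solutions of `Λ₁ˢ u = 0` in `Ω`, `u = g` outside `Ω`: bounded functions whose upper
(lower) semicontinuous envelope is a subsolution (supersolution). -/
structure IsViscositySol (s : ℝ) (Ω : Set (EuclideanSpace ℝ (Fin N)))
    (g u : EuclideanSpace ℝ (Fin N) → ℝ) : Prop where
  bounded : ∃ M : ℝ, ∀ x, |u x| ≤ M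
  sub : IsViscositySub s Ω g (upperEnv u)
  super : IsViscositySuper s Ω g (lowerEnv u)

/-! ### Domains -/

/-- The boundary of `Ω` is of class `C²`: near each boundary point, `Ω` is the strict sublevel set
of a `C²` function with nonvanishing differential. -/
def HasC2Boundary (Ω : Set (EuclideanSpace ℝ (Fin N))) : Prop :=
  ∀ x ∈ frontier Ω, ∃ (U : Set (EuclideanSpace ℝ (Fin N))) (ρ : EuclideanSpace ℝ (Fin N) → ℝ),
    IsOpen U ∧ x ∈ U ∧ ContDiffOn ℝ 2 ρ U ∧ (∀ y ∈ U, fderiv ℝ ρ y ≠ 0) ∧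
      Ω ∩ U = {y ∈ U | ρ y < 0}

/-- Bounded strictly convex `C²`-domains. Strict convexity is required of the closure: no boundary
point is interior to a segment of the closure (for an open set, Mathlib's `StrictConvex` is mere
convexity). -/
structure IsStrictlyConvexC2Domain (Ω : Set (EuclideanSpace ℝ (Fin N))) : Prop where
  isOpen : IsOpen Ω
  nonempty : Ω.Nonempty
  bounded : Bornology.IsBounded Ω
  convex : Convex ℝ Ω
  strictConvex : StrictConvex ℝ (closure Ω)
  boundary : HasC2Boundary Ω

end FracConvex

end

open FracConvex

/-! The envelope is identified with a concrete function: the Perron solution `W` of the Dirichlet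
problem for `Λ₁ˢ`, which `exists_solution` shows to be bounded and continuous. Everything follows
once `W` is known to be the greatest element of `belowDatum s Ω g` and the only viscosity solution.

The working notions are two tests. `TestSub` asks for a nonnegative operator in every direction, of
any length; `TestSuper` asks only for some unit direction with operator below each `c > 0`. Because
`TestSub` covers all directions it passes to lines, and `comparison` is stated along an affine map,
so one theorem compares two functions on `Ω` and also a function on `Ω` with a one-dimensional
solution on a chord. Its proof doubles the variables. No strict subsolution is needed: far along
every line the ordering outside the domain already contributes a fixed negative amount to the
nonlocal operator.

Boundary values come from strict convexity (`exists_steep_touching`). Slices of `Ω` next to a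
supporting hyperplane are small, so every line through a point of such a slice soon leaves `Ω` on
one side at least. If an upper semicontinuous function exceeds the datum at the boundary point, it
drops there by a fixed amount, and the singular kernel makes the operator as negative as desired in
all directions simultaneously. This contradicts the test for subsolutions and, after a change of
sign, the test for supersolutions. Comparison then makes the semicontinuous envelopes of the Perron
supremum coincide, hence continuity.

`W` is `s`-convex by comparison along each chord with the solution on `(0, 1)`, itself an instance
of `exists_solution`. Conversely, for `w` in the class, the upper envelope of `w` extended by `g` is
a generalised subsolution (`testSub_upperEnv_of_sConvexOn`): a test failing at `x₀` in direction `z`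
is transported to a short chord parallel to `z` through a nearby point where `w` almost attains the
envelope; the Dirichlet solution above `w` on that chord would contradict
`IsDirichletSol.exists_nonneg`. Comparison gives `w ≤ W`. Uniqueness is the same combination of
boundary inequality and comparison, applied to the `g`-extensions of the envelopes of a viscosity
solution. -/

noncomputable section

namespace FracConvex

/-! ### The kernel measure `t ^ (-(1 + 2 s)) dt` on `(0, ∞)` -/

/-- The measure `t ^ (-(1 + 2 s)) dt` on the positive half-line. -/
def kap (s : ℝ) : Measure ℝ :=
  (volume.restrict (Ioi (0 : ℝ))).withDensity (fun t => ENNReal.ofReal (t ^ (-(1 + 2 * s))))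

lemma measurable_kap_density (s : ℝ) :
    Measurable (fun t : ℝ => ENNReal.ofReal (t ^ (-(1 + 2 * s)))) := by fun_prop

lemma kap_absolutelyContinuous (s : ℝ) : kap s ≪ volume.restrict (Ioi (0 : ℝ)) :=
  withDensity_absolutelyContinuous _ _

lemma ae_kap_pos (s : ℝ) : ∀ᵐ t ∂kap s, 0 < t :=
  (kap_absolutelyContinuous s).ae_le (ae_restrict_mem measurableSet_Ioi)

lemma integral_kap (s : ℝ) (F : ℝ → ℝ) :
    ∫ t, F t ∂kap s = ∫ t in Ioi (0 : ℝ), F t / t ^ (1 + 2 * s) := by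
  rw [kap, integral_withDensity_eq_integral_toReal_smul (measurable_kap_density s)
    (Eventually.of_forall fun _ => ENNReal.ofReal_lt_top)]
  refine setIntegral_congr_fun measurableSet_Ioi fun t (ht : 0 < t) => ?_
  simp only [smul_eq_mul]
  rw [ENNReal.toReal_ofReal (by positivity), Real.rpow_neg ht.le]
  field_simp

lemma integrable_kap_iff (s : ℝ) (F : ℝ → ℝ) :
    Integrable F (kap s) ↔ IntegrableOn (fun t => F t / t ^ (1 + 2 * s)) (Ioi (0 : ℝ)) := by
  rw [kap, integrable_withDensity_iff_integrable_smul' (measurable_kap_density s)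
    (Eventually.of_forall fun _ => ENNReal.ofReal_lt_top)]
  refine integrableOn_congr_fun (fun t (ht : 0 < t) => ?_) measurableSet_Ioi
  simp only [smul_eq_mul]
  rw [ENNReal.toReal_ofReal (by positivity), Real.rpow_neg ht.le]
  field_simp

lemma setIntegral_div_eq_kap {A : Set ℝ} (hA : MeasurableSet A) (hA0 : A ⊆ Ioi 0) (s : ℝ)
    (F : ℝ → ℝ) :
    ∫ t in A, F t / t ^ (1 + 2 * s) = ∫ t, A.indicator F t ∂kap s := by
  rw [integral_kap, ← integral_indicator hA, ← integral_indicator measurableSet_Ioi]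
  congr 1
  ext t
  by_cases h : t ∈ A
  · simp [h, hA0 h]
  · simp [h, indicator]

/-- The kernel is homogeneous, so a dilation of the line only produces a positive factor. This makes
the sign of a directional operator independent of the length of the direction. -/
lemma integral_kap_comp_mul (s : ℝ) {c : ℝ} (hc : 0 < c) (F : ℝ → ℝ) :
    ∫ t, F (c * t) ∂kap s = c ^ (2 * s) * ∫ t, F t ∂kap s := by
  rw [integral_kap, integral_kap]
  have h := integral_comp_mul_left_Ioi (fun u => F u / u ^ (1 + 2 * s)) 0 hc
  rw [mul_zero, smul_eq_mul] at h
  have h2 : ∀ t ∈ Ioi (0 : ℝ), F (c * t) / t ^ (1 + 2 * s)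
      = c ^ (1 + 2 * s) * (F (c * t) / (c * t) ^ (1 + 2 * s)) := by
    intro t (ht : 0 < t)
    rw [Real.mul_rpow hc.le ht.le]
    field_simp
  rw [setIntegral_congr_fun measurableSet_Ioi h2, integral_const_mul, h, ← mul_assoc,
    Real.rpow_add hc, Real.rpow_one]
  field_simp

lemma integrableOn_kap_Ici {s a : ℝ} (hs : 0 < s) (ha : 0 < a) :
    Integrable ((Ici a).indicator fun _ => (1 : ℝ)) (kap s) ∧
    ∫ t, (Ici a).indicator (fun _ => (1 : ℝ)) t ∂kap s = a ^ (-(2 * s)) / (2 * s) := by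
  have hsub : Ici a ⊆ Ioi (0 : ℝ) := fun t ht => lt_of_lt_of_le ha ht
  constructor
  · rw [integrable_kap_iff]
    have h1 : IntegrableOn (fun t : ℝ => t ^ (-(1 + 2 * s))) (Ici a) := by
      rw [integrableOn_Ici_iff_integrableOn_Ioi]
      exact integrableOn_Ioi_rpow_of_lt (by linarith) ha
    have h2 := ((integrable_indicator_iff measurableSet_Ici).2 h1).integrableOn (s := Ioi (0:ℝ))
    refine h2.congr_fun (fun t (ht : 0 < t) => ?_) measurableSet_Ioi
    by_cases h : t ∈ Ici a
    · simp only [indicator_of_mem h]; rw [Real.rpow_neg ht.le, one_div]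
    · simp [indicator_of_notMem h]
  · rw [← setIntegral_div_eq_kap measurableSet_Ici hsub, integral_Ici_eq_integral_Ioi]
    rw [setIntegral_congr_fun (g := fun t : ℝ => t ^ (-(1 + 2 * s))) measurableSet_Ioi]
    · rw [integral_Ioi_rpow_of_lt (by linarith) ha]
      rw [show -(1 + 2 * s) + 1 = -(2 * s) by ring, neg_div_neg_eq]
    · intro t (ht : a < t)
      simp only
      rw [Real.rpow_neg (ha.trans ht).le, one_div]

lemma integrableOn_kap_Iio {s T : ℝ} (hs : s < 1) (hT : 0 < T) :
    Integrable ((Iio T).indicator fun t => t ^ 2) (kap s) ∧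
    ∫ t, (Iio T).indicator (fun t => t ^ 2) t ∂kap s = T ^ (2 - 2 * s) / (2 - 2 * s) := by
  have key : ∀ t : ℝ, 0 < t → (Iio T).indicator (fun t => t ^ 2) t / t ^ (1 + 2 * s)
      = (Ioo 0 T).indicator (fun t => t ^ (1 - 2 * s)) t := by
    intro t ht
    by_cases h : t < T
    · rw [indicator_of_mem (show t ∈ Iio T from h), indicator_of_mem (show t ∈ Ioo 0 T from ⟨ht, h⟩),
        ← Real.rpow_natCast, ← Real.rpow_sub ht]
      congr 1; push_cast; ring
    · rw [indicator_of_notMem (show t ∉ Iio T from h),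
        indicator_of_notMem (show t ∉ Ioo 0 T from fun h' => h h'.2), zero_div]
  have hI : IntegrableOn (fun t : ℝ => t ^ (1 - 2 * s)) (Ioo 0 T) := by
    rw [← integrableOn_Ioc_iff_integrableOn_Ioo,
      ← intervalIntegrable_iff_integrableOn_Ioc_of_le hT.le]
    exact intervalIntegral.intervalIntegrable_rpow' (by linarith)
  constructor
  · rw [integrable_kap_iff]
    refine IntegrableOn.congr_fun ?_ (fun t (ht : 0 < t) => (key t ht).symm) measurableSet_Ioi
    exact ((integrable_indicator_iff measurableSet_Ioo).2 hI).integrableOn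
  · rw [integral_kap, setIntegral_congr_fun measurableSet_Ioi key,
      setIntegral_indicator measurableSet_Ioo,
      inter_eq_right.2 (Ioo_subset_Ioi_self), ← integral_Ioc_eq_integral_Ioo,
      ← intervalIntegral.integral_of_le hT.le, integral_rpow (Or.inl (by linarith)),
      Real.zero_rpow (by linarith), sub_zero]
    rw [show 1 - 2 * s + 1 = 2 - 2 * s by ring]

/-- The dominating profile `t ^ 2` on `t < δ`, `1` on `t ≥ δ`. -/
def dom (δ t : ℝ) : ℝ := if t < δ then t ^ 2 else 1

lemma integrable_dom {s δ : ℝ} (hs₀ : 0 < s) (hs₁ : s < 1) (hδ : 0 < δ) :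
    Integrable (dom δ) (kap s) := by
  refine ((integrableOn_kap_Iio hs₁ hδ).1.add (integrableOn_kap_Ici hs₀ hδ).1).congr ?_
  refine Eventually.of_forall fun t => ?_
  by_cases h : t < δ
  · simp [dom, h]
  · simp [dom, h, not_lt.1 h]

lemma integrable_of_dom {s δ C : ℝ} (hs₀ : 0 < s) (hs₁ : s < 1) (hδ : 0 < δ) {F : ℝ → ℝ}
    (hF : AEStronglyMeasurable F (kap s)) (h : ∀ t, 0 < t → |F t| ≤ C * dom δ t) :
    Integrable F (kap s) := by
  refine ((integrable_dom hs₀ hs₁ hδ).const_mul C).mono' hF ?_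
  filter_upwards [ae_kap_pos s] with t ht using h t ht

lemma integral_kap_mono {s : ℝ} {F G : ℝ → ℝ} (hF : Integrable F (kap s))
    (hG : Integrable G (kap s)) (h : ∀ t, 0 < t → F t ≤ G t) :
    ∫ t, F t ∂kap s ≤ ∫ t, G t ∂kap s := by
  refine integral_mono_ae hF hG ?_
  filter_upwards [ae_kap_pos s] with t ht using h t ht

/-- A form of the reverse Fatou lemma: upper semicontinuity of integrals under domination. -/
lemma eventually_integral_lt {α : Type*} {l : Filter α} [l.IsCountablyGenerated]
    {μ : Measure ℝ} {F : α → ℝ → ℝ} {F₀ H : ℝ → ℝ} (hH : Integrable H μ)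
    (hF : ∀ᶠ p in l, AEStronglyMeasurable (F p) μ) (hF₀ : AEStronglyMeasurable F₀ μ)
    (hb : ∀ᶠ p in l, ∀ᵐ t ∂μ, |F p t| ≤ H t) (hb₀ : ∀ᵐ t ∂μ, |F₀ t| ≤ H t)
    (hlim : ∀ᵐ t ∂μ, ∀ ε > 0, ∀ᶠ p in l, F p t < F₀ t + ε) {b : ℝ} (hb' : ∫ t, F₀ t ∂μ < b) :
    ∀ᶠ p in l, ∫ t, F p t ∂μ < b := by
  -- Passing to the maximum with `F₀` turns one-sided convergence into convergence, and dominated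
  -- convergence applies.
  have hlim' : Tendsto (fun p => ∫ t, max (F p t) (F₀ t) ∂μ) l (𝓝 (∫ t, F₀ t ∂μ)) := by
    refine tendsto_integral_filter_of_dominated_convergence H ?_ ?_ hH ?_
    · filter_upwards [hF] with p hp using hp.sup hF₀
    · filter_upwards [hb] with p hp
      filter_upwards [hp, hb₀] with t h1 h2
      rw [abs_le] at h1 h2
      rw [Real.norm_eq_abs, abs_le]
      exact ⟨h1.1.trans (le_max_left _ _), max_le h1.2 h2.2⟩
    · filter_upwards [hlim] with t ht
      rw [Metric.tendsto_nhds]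
      intro ε hε
      filter_upwards [ht ε hε] with p hp
      rw [Real.dist_eq, abs_lt]
      exact ⟨by linarith [le_max_right (F p t) (F₀ t)],
        by linarith [max_lt hp (show F₀ t < F₀ t + ε by linarith)]⟩
  filter_upwards [hlim'.eventually (gt_mem_nhds hb'), hF, hb] with p h1 h2 h3
  refine lt_of_le_of_lt (integral_mono_ae (hH.mono' h2 h3) (hH.mono' (h2.sup hF₀) ?_)
    (Eventually.of_forall fun t => le_max_left _ _)) h1
  filter_upwards [h3, hb₀] with t h4 h5
  rw [abs_le] at h4 h5
  rw [Real.norm_eq_abs, abs_le]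
  exact ⟨h4.1.trans (le_max_left _ _), max_le h4.2 h5.2⟩

/-! ### Directional fractional operators and their semicontinuity -/

section Operator

variable {E : Type*} [NormedAddCommGroup E] [InnerProductSpace ℝ E]

/-- Symmetric second difference of `w` at `x` with increment `t • z`. -/
def sd (w : E → ℝ) (x z : E) (t : ℝ) : ℝ := w (x + t • z) + w (x - t • z) - 2 * w x

/-- Integrand of `opa`. -/
def opaFun (δ : ℝ) (φ u : E → ℝ) (x z : E) (a t : ℝ) : ℝ :=
  if t < δ then sd φ x z t else u (x + t • z) + u (x - t • z) - 2 * a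

/-- The one-dimensional fractional Laplacian in direction `z`, evaluated on `φ` at distances less
than `δ` and on `u` at distances at least `δ`, where the central value of `u` is taken to
be `a`. -/
def opa (s δ : ℝ) (φ u : E → ℝ) (x z : E) (a : ℝ) : ℝ := ∫ t, opaFun δ φ u x z a t ∂kap s

/-- Bounded functions that are measurable along every line. -/
structure LineBounded (u : E → ℝ) : Prop where
  bounded : ∃ M : ℝ, ∀ x, |u x| ≤ M
  meas : ∀ x z : E, Measurable fun t : ℝ => u (x + t • z)

lemma LineBounded.neg {u : E → ℝ} (hu : LineBounded u) : LineBounded (-u) where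
  bounded := by
    obtain ⟨M, hM⟩ := hu.bounded
    exact ⟨M, fun x => by simpa using hM x⟩
  meas x z := (hu.meas x z).neg

lemma LineBounded.meas' {u : E → ℝ} (hu : LineBounded u) (x z : E) :
    Measurable fun t : ℝ => u (x - t • z) := by
  simpa [sub_eq_add_neg] using hu.meas x (-z)

lemma _root_.UpperSemicontinuous.lineBounded {u : E → ℝ} (hu : UpperSemicontinuous u)
    (hb : ∃ M : ℝ, ∀ x, |u x| ≤ M) : LineBounded u where
  bounded := hb
  meas x z := by
    have : UpperSemicontinuous fun t : ℝ => u (x + t • z) :=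
      hu.comp (g := fun t : ℝ => x + t • z) (by fun_prop)
    exact this.measurable

lemma _root_.LowerSemicontinuous.lineBounded {u : E → ℝ} (hu : LowerSemicontinuous u)
    (hb : ∃ M : ℝ, ∀ x, |u x| ≤ M) : LineBounded u where
  bounded := hb
  meas x z := by
    have : LowerSemicontinuous fun t : ℝ => u (x + t • z) :=
      hu.comp (g := fun t : ℝ => x + t • z) (by fun_prop)
    exact this.measurable

lemma _root_.LowerSemicontinuous.neg_upper {α : Type*} [TopologicalSpace α] {u : α → ℝ}
    (hu : LowerSemicontinuous u) : UpperSemicontinuous (-u) := by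
  intro x y hy
  filter_upwards [hu x (-y) (by simp only [Pi.neg_apply] at hy; linarith)] with z hz
  simp only [Pi.neg_apply]; linarith

lemma _root_.UpperSemicontinuous.neg_lower {α : Type*} [TopologicalSpace α] {u : α → ℝ}
    (hu : UpperSemicontinuous u) : LowerSemicontinuous (-u) := by
  intro x y hy
  filter_upwards [hu x (-y) (by simp only [Pi.neg_apply] at hy; linarith)] with z hz
  simp only [Pi.neg_apply]; linarith

lemma sd_smul (w : E → ℝ) (x z : E) (c t : ℝ) : sd w x (c • z) t = sd w x z (c * t) := by
  simp only [sd, smul_smul, mul_comm t c]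

lemma sd_neg_dir (w : E → ℝ) (x z : E) (t : ℝ) : sd w x (-z) t = sd w x z t := by
  simp only [sd, smul_neg, ← sub_eq_add_neg, sub_neg_eq_add]; ring

lemma opaFun_neg (δ : ℝ) (φ u : E → ℝ) (x z : E) (a t : ℝ) :
    opaFun δ (-φ) (-u) x z (-a) t = -opaFun δ φ u x z a t := by
  unfold opaFun; split_ifs <;> simp [sd] <;> ring

/-- With this identity, estimates for upper semicontinuous functions touched from above also serve
lower semicontinuous functions touched from below. -/
lemma opa_neg (s δ : ℝ) (φ u : E → ℝ) (x z : E) (a : ℝ) :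
    opa s δ (-φ) (-u) x z (-a) = -opa s δ φ u x z a := by
  simp only [opa, opaFun_neg, integral_neg]

lemma opa_neg_dir (s δ : ℝ) (φ u : E → ℝ) (x z : E) (a : ℝ) :
    opa s δ φ u x (-z) a = opa s δ φ u x z a := by
  unfold opa opaFun
  congr 1; ext t
  rw [sd_neg_dir]
  split_ifs
  · rfl
  · rw [smul_neg, ← sub_eq_add_neg, sub_neg_eq_add]; ring

lemma opa_smul {s c : ℝ} (hc : 0 < c) (δ : ℝ) (φ u : E → ℝ) (x z : E) (a : ℝ) :
    opa s δ φ u x (c • z) a = c ^ (2 * s) * opa s (c * δ) φ u x z a := by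
  rw [opa, opa, ← integral_kap_comp_mul s hc]
  congr 1; ext t
  unfold opaFun
  rw [sd_smul]
  simp only [smul_smul, mul_comm _ c, mul_lt_mul_iff_right₀ hc]

lemma opa_zero_dir {s δ : ℝ} (φ u : E → ℝ) (x : E) : opa s δ φ u x 0 (u x) = 0 := by
  have : ∀ t, opaFun δ φ u x 0 (u x) t = 0 := by
    intro t; unfold opaFun sd; split_ifs <;> simp <;> ring
  simp [opa, this]

lemma opa_add_const (s δ b : ℝ) (φ u : E → ℝ) (x z : E) (a : ℝ) :
    opa s δ (fun y => φ y + b) u x z a = opa s δ φ u x z a := by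
  unfold opa opaFun sd
  congr 1; ext t
  split_ifs <;> ring

variable [FiniteDimensional ℝ E]

/-- The derivative of `τ ↦ φ (x + τ • h) + φ (x - τ • h)` is a difference of differentials at points
`2 τ ‖h‖` apart, controlled by a Lipschitz constant of `fderiv ℝ φ` on the ball of radius `2 * R`.
Quadratic decay is what the kernel needs near `0` when `s < 1`. -/
lemma exists_bound_second_difference {φ : E → ℝ} (hφ : ContDiff ℝ 2 φ) (R : ℝ) :
    ∃ C : ℝ, 0 ≤ C ∧ ∀ x h : E, ‖x‖ ≤ R → ‖h‖ ≤ R →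
      |φ (x + h) + φ (x - h) - 2 * φ x| ≤ C * ‖h‖ ^ 2 := by
  have hd : ContDiff ℝ 1 (fderiv ℝ φ) := hφ.fderiv_right (by norm_num)
  obtain ⟨K, hK⟩ := (hd.locallyLipschitz.locallyLipschitzOn (s := Metric.closedBall 0 (2 * R))
    ).exists_lipschitzOnWith_of_compact (isCompact_closedBall _ _)
  refine ⟨2 * K, by positivity, fun x h hx hh => ?_⟩
  have hdiff : Differentiable ℝ φ := hφ.differentiable (by norm_num)
  have hder : ∀ τ : ℝ, HasDerivAt (fun τ : ℝ => φ (x + τ • h) + φ (x - τ • h))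
      ((fderiv ℝ φ (x + τ • h) - fderiv ℝ φ (x - τ • h)) h) τ := by
    intro τ
    have h1 : HasDerivAt (fun τ : ℝ => x + τ • h) h τ := by
      simpa using ((hasDerivAt_id τ).smul_const h).const_add x
    have h2 : HasDerivAt (fun τ : ℝ => x - τ • h) (-h) τ := by
      simpa using ((hasDerivAt_id τ).smul_const h).const_sub x
    have h3 := (hdiff (x + τ • h)).hasFDerivAt.comp_hasDerivAt τ h1
    have h4 := (hdiff (x - τ • h)).hasFDerivAt.comp_hasDerivAt τ h2
    refine HasDerivAt.congr_deriv (h3.add h4) ?_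
    simp [sub_eq_add_neg]
  have hbd : ∀ τ ∈ Ico (0 : ℝ) 1,
      ‖(fderiv ℝ φ (x + τ • h) - fderiv ℝ φ (x - τ • h)) h‖ ≤ 2 * K * ‖h‖ ^ 2 := by
    intro τ hτ
    have hτh : ‖τ • h‖ ≤ ‖h‖ := by
      rw [norm_smul, Real.norm_eq_abs, abs_of_nonneg hτ.1]
      exact mul_le_of_le_one_left (norm_nonneg _) hτ.2.le
    have hm1 : x + τ • h ∈ Metric.closedBall (0 : E) (2 * R) := by
      rw [mem_closedBall_zero_iff]; linarith [norm_add_le x (τ • h)]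
    have hm2 : x - τ • h ∈ Metric.closedBall (0 : E) (2 * R) := by
      rw [mem_closedBall_zero_iff]; linarith [norm_sub_le x (τ • h)]
    have hl := hK.dist_le_mul _ hm1 _ hm2
    rw [dist_eq_norm, dist_eq_norm, show x + τ • h - (x - τ • h) = (2 : ℝ) • (τ • h) by
      rw [two_smul]; abel, norm_smul, Real.norm_ofNat] at hl
    calc _ ≤ ‖fderiv ℝ φ (x + τ • h) - fderiv ℝ φ (x - τ • h)‖ * ‖h‖ :=
          ContinuousLinearMap.le_opNorm _ _
      _ ≤ (K * (2 * ‖h‖)) * ‖h‖ := by gcongr; exact hl.trans (by gcongr)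
      _ = _ := by ring
  have := norm_image_sub_le_of_norm_deriv_le_segment_01'
    (fun τ _ => (hder τ).hasDerivWithinAt) hbd
  rw [Real.norm_eq_abs] at this
  simpa [two_mul] using this

/-- Locally uniform domination of the integrand of `opa`. -/
lemma exists_bound_opaFun {φ : E → ℝ} (hφ : ContDiff ℝ 2 φ) {u : E → ℝ}
    (hu : LineBounded u) (R δ : ℝ) :
    ∃ C : ℝ, ∀ (x z : E) (a t : ℝ), ‖x‖ ≤ R → ‖z‖ ≤ R → |a| ≤ R → 0 < t →
      |opaFun δ φ u x z a t| ≤ C * dom δ t := by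
  obtain ⟨M, hM⟩ := hu.bounded
  obtain ⟨C, hC0, hC⟩ := exists_bound_second_difference hφ (max R (|δ| * R))
  refine ⟨C * R ^ 2 + 2 * (M + R), fun x z a t hx hz ha ht => ?_⟩
  have hM0 : 0 ≤ M := (abs_nonneg _).trans (hM x)
  have hR0 : 0 ≤ R := (norm_nonneg _).trans hx
  unfold opaFun dom
  split_ifs with htd
  · have h1 : ‖t • z‖ = t * ‖z‖ := by rw [norm_smul, Real.norm_eq_abs, abs_of_pos ht]
    have h2 : ‖t • z‖ ≤ |δ| * R := by
      rw [h1]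
      have : t ≤ |δ| := htd.le.trans (le_abs_self _)
      gcongr
    have := hC x (t • z) (hx.trans (le_max_left _ _)) (h2.trans (le_max_right _ _))
    unfold sd
    refine this.trans ?_
    rw [h1, mul_pow]
    have : ‖z‖ ^ 2 ≤ R ^ 2 := by gcongr
    have h3 : 0 ≤ 2 * (M + R) * t ^ 2 := by positivity
    nlinarith [mul_le_mul_of_nonneg_left this (by positivity : 0 ≤ C * t ^ 2)]
  · have h1 := abs_le.1 (hM (x + t • z))
    have h2 := abs_le.1 (hM (x - t • z))
    have h3 := abs_le.1 ha
    have h4 : 0 ≤ C * R ^ 2 := by positivity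
    rw [abs_le]
    constructor <;> linarith

omit [FiniteDimensional ℝ E] in
lemma measurable_opaFun {φ : E → ℝ} (hφ : Continuous φ) {u : E → ℝ}
    (hu : LineBounded u) (δ : ℝ) (x z : E) (a : ℝ) : Measurable (opaFun δ φ u x z a) := by
  unfold opaFun
  refine Measurable.ite measurableSet_Iio ?_ ?_
  · unfold sd
    exact Continuous.measurable (by fun_prop)
  · exact ((hu.meas x z).add (hu.meas' x z)).sub_const _

lemma integrable_opaFun {s : ℝ} (hs₀ : 0 < s) (hs₁ : s < 1) {δ : ℝ} (hδ : 0 < δ) {φ : E → ℝ}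
    (hφ : ContDiff ℝ 2 φ) {u : E → ℝ} (hu : LineBounded u) (x z : E) (a : ℝ) :
    Integrable (opaFun δ φ u x z a) (kap s) := by
  obtain ⟨C, hC⟩ := exists_bound_opaFun hφ hu (max (max ‖x‖ ‖z‖) |a|) δ
  exact integrable_of_dom hs₀ hs₁ hδ
    (measurable_opaFun hφ.continuous hu δ x z a).aestronglyMeasurable
    fun t ht => hC x z a t (by simp) (by simp) (by simp) ht

lemma opa_mono {s : ℝ} (hs₀ : 0 < s) (hs₁ : s < 1) {δ δ' : ℝ} (hδ : 0 < δ) (hδ' : 0 < δ')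
    {φ ψ u v : E → ℝ} (hφ : ContDiff ℝ 2 φ) (hψ : ContDiff ℝ 2 ψ) (hu : LineBounded u)
    (hv : LineBounded v) {x y z w : E} {a b : ℝ}
    (h : ∀ t, 0 < t → opaFun δ φ u x z a t ≤ opaFun δ' ψ v y w b t) :
    opa s δ φ u x z a ≤ opa s δ' ψ v y w b :=
  integral_kap_mono (integrable_opaFun hs₀ hs₁ hδ hφ hu x z a)
    (integrable_opaFun hs₀ hs₁ hδ' hψ hv y w b) h

/-- Shrinking the region where the touching function is used lowers the operator. -/
lemma opa_le_opa_of_le {s : ℝ} (hs₀ : 0 < s) (hs₁ : s < 1) {δ δ' r : ℝ} (hδ' : 0 < δ')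
    (hδδ' : δ' ≤ δ) {φ u : E → ℝ} (hφ : ContDiff ℝ 2 φ) (hu : LineBounded u) {x z : E}
    (hx : φ x = u x) (hr : δ * ‖z‖ ≤ r) (hle : ∀ y ∈ Metric.ball x r, u y ≤ φ y) :
    opa s δ' φ u x z (u x) ≤ opa s δ φ u x z (u x) := by
  refine opa_mono hs₀ hs₁ hδ' (hδ'.trans_le hδδ') hφ hφ hu hu fun t ht => ?_
  unfold opaFun sd
  by_cases h1 : t < δ'
  · rw [if_pos h1, if_pos (h1.trans_le hδδ')]
  · rw [if_neg h1]
    split_ifs with h2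
    · rcases eq_or_ne z 0 with rfl | hz
      · simp [hx]
      · have hlt : ‖t • z‖ < r := by
          rw [norm_smul, Real.norm_eq_abs, abs_of_pos ht]
          exact (mul_lt_mul_of_pos_right h2 (norm_pos_iff.2 hz)).trans_le hr
        have e1 := hle (x + t • z) (by simpa [Metric.mem_ball, dist_eq_norm] using hlt)
        have e2 := hle (x - t • z) (by simpa [Metric.mem_ball, dist_eq_norm] using hlt)
        rw [hx]; linarith
    · exact le_rfl

/-- `opa` is upper semicontinuous in `(x, z, a)` when `u` is. -/
lemma eventually_opa_lt {s : ℝ} (hs₀ : 0 < s) (hs₁ : s < 1) {δ : ℝ} (hδ : 0 < δ) {φ u : E → ℝ}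
    (hφ : ContDiff ℝ 2 φ) (hu : UpperSemicontinuous u) (hb : ∃ M : ℝ, ∀ x, |u x| ≤ M)
    {x z : E} {a b : ℝ} (h : opa s δ φ u x z a < b) :
    ∀ᶠ p : E × E × ℝ in 𝓝 (x, z, a), opa s δ φ u p.1 p.2.1 p.2.2 < b := by
  have hL := hu.lineBounded hb
  set R := max (max ‖x‖ ‖z‖) |a| + 1 with hR
  obtain ⟨C, hC⟩ := exists_bound_opaFun hφ hL R δ
  have hx : ‖x‖ < R := by
    have h1 := le_max_left ‖x‖ ‖z‖
    have h2 := le_max_left (max ‖x‖ ‖z‖) |a|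
    rw [hR]; linarith
  have hz : ‖z‖ < R := by
    have h1 := le_max_right ‖x‖ ‖z‖
    have h2 := le_max_left (max ‖x‖ ‖z‖) |a|
    rw [hR]; linarith
  have ha : |a| < R := by rw [hR]; have := le_max_right (max ‖x‖ ‖z‖) |a|; linarith
  have hcont : Tendsto (fun p : E × E × ℝ => p) (𝓝 (x, z, a)) (𝓝 (x, z, a)) := tendsto_id
  refine eventually_integral_lt (H := fun t => C * dom δ t)
    ((integrable_dom hs₀ hs₁ hδ).const_mul C) (Eventually.of_forall fun p =>
      (measurable_opaFun hφ.continuous hL δ _ _ _).aestronglyMeasurable)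
    (measurable_opaFun hφ.continuous hL δ x z a).aestronglyMeasurable ?_ ?_ ?_ h
  · have e1 : ∀ᶠ p : E × E × ℝ in 𝓝 (x, z, a), ‖p.1‖ < R :=
      (Continuous.tendsto (f := fun p : E × E × ℝ => ‖p.1‖) (by fun_prop) _).eventually
        (gt_mem_nhds hx)
    have e2 : ∀ᶠ p : E × E × ℝ in 𝓝 (x, z, a), ‖p.2.1‖ < R :=
      (Continuous.tendsto (f := fun p : E × E × ℝ => ‖p.2.1‖) (by fun_prop) _).eventually
        (gt_mem_nhds hz)
    have e3 : ∀ᶠ p : E × E × ℝ in 𝓝 (x, z, a), |p.2.2| < R :=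
      (Continuous.tendsto (f := fun p : E × E × ℝ => |p.2.2|) (by fun_prop) _).eventually
        (gt_mem_nhds ha)
    filter_upwards [e1, e2, e3] with p h1 h2 h3
    filter_upwards [ae_kap_pos s] with t ht
    exact hC _ _ _ t h1.le h2.le h3.le ht
  · filter_upwards [ae_kap_pos s] with t ht using hC _ _ _ t hx.le hz.le ha.le ht
  · refine Eventually.of_forall fun t ε hε => ?_
    unfold opaFun
    have hφc := hφ.continuous
    split_ifs with ht
    · unfold sd
      exact (Continuous.tendsto (f := fun p : E × E × ℝ =>
        φ (p.1 + t • p.2.1) + φ (p.1 - t • p.2.1) - 2 * φ p.1) (by fun_prop) _).eventually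
        (gt_mem_nhds (by simp only; linarith))
    · have e1 : ∀ᶠ p : E × E × ℝ in 𝓝 (x, z, a), u (p.1 + t • p.2.1) < u (x + t • z) + ε / 4 :=
        (Continuous.tendsto (f := fun p : E × E × ℝ => p.1 + t • p.2.1) (by fun_prop)
          (x, z, a)).eventually (hu _ _ (by simp only; linarith))
      have e2 : ∀ᶠ p : E × E × ℝ in 𝓝 (x, z, a), u (p.1 - t • p.2.1) < u (x - t • z) + ε / 4 :=
        (Continuous.tendsto (f := fun p : E × E × ℝ => p.1 - t • p.2.1) (by fun_prop)
          (x, z, a)).eventually (hu _ _ (by simp only; linarith))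
      have e3 : ∀ᶠ p : E × E × ℝ in 𝓝 (x, z, a), a - ε / 4 < p.2.2 :=
        (Continuous.tendsto (f := fun p : E × E × ℝ => p.2.2) (by fun_prop)
          (x, z, a)).eventually (lt_mem_nhds (by simp only; linarith))
      filter_upwards [e1, e2, e3] with p h1 h2 h3
      linarith

/-! ### Viscosity tests -/

/-- `u` passes the subsolution test, in every direction, at the points of `X`. -/
def TestSub (s : ℝ) (X : Set E) (u : E → ℝ) : Prop :=
  ∀ x₀ ∈ X, ∀ (φ : E → ℝ) (r : ℝ), ContDiff ℝ 2 φ → φ x₀ = u x₀ →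
    (∀ x ∈ Metric.ball x₀ r, u x ≤ φ x) → ∀ (z : E) (δ : ℝ), 0 < δ → δ * ‖z‖ ≤ r →
      0 ≤ opa s δ φ u x₀ z (u x₀)

/-- `v` passes the supersolution test, for the infimum over directions, at the points of `X`. -/
def TestSuper (s : ℝ) (X : Set E) (v : E → ℝ) : Prop :=
  ∀ x₀ ∈ X, ∀ (φ : E → ℝ) (r : ℝ), ContDiff ℝ 2 φ → φ x₀ = v x₀ →
    (∀ x ∈ Metric.ball x₀ r, φ x ≤ v x) → ∀ δ : ℝ, 0 < δ → δ ≤ r → ∀ c : ℝ, 0 < c →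
      ∃ z : E, ‖z‖ = 1 ∧ opa s δ φ v x₀ z (v x₀) < c

-- The zero direction gives operator `0`, and any other direction is rescaled to a unit one; the
-- product `δ * ‖z‖` is invariant under this rescaling.
omit [FiniteDimensional ℝ E] in
lemma testSub_of_unit {s : ℝ} {X : Set E} {u : E → ℝ}
    (h : ∀ x₀ ∈ X, ∀ (φ : E → ℝ) (r : ℝ), ContDiff ℝ 2 φ → φ x₀ = u x₀ →
      (∀ x ∈ Metric.ball x₀ r, u x ≤ φ x) → ∀ (z : E) (δ : ℝ), 0 < δ → ‖z‖ = 1 → δ ≤ r →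
      0 ≤ opa s δ φ u x₀ z (u x₀)) : TestSub s X u := by
  intro x₀ hx₀ φ r hφ h0 hle z δ hδ hr
  rcases eq_or_ne z 0 with rfl | hz
  · rw [opa_zero_dir]
  · have hn : 0 < ‖z‖ := norm_pos_iff.2 hz
    have hz' : z = ‖z‖ • (‖z‖⁻¹ • z) := by rw [smul_smul, mul_inv_cancel₀ hn.ne', one_smul]
    rw [hz', opa_smul hn]
    refine mul_nonneg (by positivity) (h x₀ hx₀ φ r hφ h0 hle _ _ (by positivity) ?_ ?_)
    · rw [norm_smul, norm_inv, norm_norm, inv_mul_cancel₀ hn.ne']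
    · rwa [mul_comm]

omit [FiniteDimensional ℝ E] in
lemma TestSub.mono {s : ℝ} {X Y : Set E} {u : E → ℝ} (h : TestSub s X u) (hYX : Y ⊆ X) :
    TestSub s Y u := fun x hx => h x (hYX hx)

omit [FiniteDimensional ℝ E] in
lemma TestSuper.mono {s : ℝ} {X Y : Set E} {u : E → ℝ} (h : TestSuper s X u) (hYX : Y ⊆ X) :
    TestSuper s Y u := fun x hx => h x (hYX hx)

end Operator

/-! ### Semicontinuous envelopes -/

section Envelope

variable {X : Type*} [TopologicalSpace X] {w : X → ℝ} {x : X} {M c : ℝ}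

/-- No boundedness is needed: on `ℝ` the infimum is by definition the negated supremum of the
negated set, so default values match as well. -/
lemma lowerEnv_eq_neg (w : X → ℝ) : lowerEnv w = -upperEnv (-w) := by
  ext x
  simp only [lowerEnv, upperEnv, Pi.neg_apply, limsup_eq, liminf_eq]
  rw [Real.sInf_def, neg_neg]
  congr 1
  ext a
  simp

lemma eventually_lt_of_upperEnv_lt (hb : ∀ᶠ y in 𝓝 x, |w y| ≤ M) (h : upperEnv w x < c) :
    ∀ᶠ y in 𝓝 x, w y < c :=
  eventually_lt_of_limsup_lt h ⟨M, hb.mono fun _ hy => (abs_le.1 hy).2⟩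

lemma frequently_lt_of_lt_upperEnv (hb : ∀ᶠ y in 𝓝 x, |w y| ≤ M) (h : c < upperEnv w x) :
    ∃ᶠ y in 𝓝 x, c < w y := by
  refine frequently_lt_of_lt_limsup ?_ h
  have : IsBoundedUnder (· ≥ ·) (𝓝 x) w := ⟨-M, hb.mono fun _ hy => (abs_le.1 hy).1⟩
  exact this.isCoboundedUnder_le

lemma upperEnv_le (hb : ∀ᶠ y in 𝓝 x, |w y| ≤ M) (h : ∀ᶠ y in 𝓝 x, w y ≤ c) :
    upperEnv w x ≤ c := by
  by_contra! hc
  obtain ⟨y, h1, h2⟩ := ((frequently_lt_of_lt_upperEnv hb hc).and_eventually h).exists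
  exact absurd h1 (not_lt.2 h2)

lemma le_upperEnv (hb : ∀ᶠ y in 𝓝 x, |w y| ≤ M) : w x ≤ upperEnv w x := by
  by_contra! h
  exact lt_irrefl _ (eventually_lt_of_upperEnv_lt hb h).self_of_nhds

lemma upperEnv_upperSemicontinuousAt (hb : ∀ᶠ y in 𝓝 x, |w y| ≤ M) :
    UpperSemicontinuousAt (upperEnv w) x := by
  intro c hc
  obtain ⟨c', h1, h2⟩ := exists_between hc
  filter_upwards [(eventually_lt_of_upperEnv_lt hb h1).eventually_nhds, hb.eventually_nhds]
    with y hy hby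
  exact (upperEnv_le hby (hy.mono fun _ h => h.le)).trans_lt h2

lemma upperEnv_upperSemicontinuous (hb : ∀ y, |w y| ≤ M) : UpperSemicontinuous (upperEnv w) :=
  fun _ => upperEnv_upperSemicontinuousAt (Eventually.of_forall hb)

lemma abs_upperEnv_le (hb : ∀ᶠ y in 𝓝 x, |w y| ≤ M) : |upperEnv w x| ≤ M := by
  rw [abs_le]
  exact ⟨(abs_le.1 hb.self_of_nhds).1.trans (le_upperEnv hb),
    upperEnv_le hb (hb.mono fun _ h => (abs_le.1 h).2)⟩

omit [TopologicalSpace X] in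
lemma abs_neg_apply_le {w : X → ℝ} (hb : ∀ y, |w y| ≤ M) : ∀ y, |(-w) y| ≤ M :=
  fun y => by simpa using hb y

lemma lowerEnv_le (hb : ∀ y, |w y| ≤ M) (x : X) : lowerEnv w x ≤ w x := by
  rw [lowerEnv_eq_neg]
  have := le_upperEnv (x := x) (Eventually.of_forall (abs_neg_apply_le hb))
  simp only [Pi.neg_apply] at this ⊢
  linarith

lemma lowerEnv_lowerSemicontinuous (hb : ∀ y, |w y| ≤ M) : LowerSemicontinuous (lowerEnv w) := by
  rw [lowerEnv_eq_neg]
  exact (upperEnv_upperSemicontinuous (abs_neg_apply_le hb)).neg_lower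

lemma abs_lowerEnv_le (hb : ∀ y, |w y| ≤ M) (x : X) : |lowerEnv w x| ≤ M := by
  rw [lowerEnv_eq_neg, Pi.neg_apply, abs_neg]
  exact abs_upperEnv_le (Eventually.of_forall (abs_neg_apply_le hb))

lemma le_lowerEnv (hb : ∀ y, |w y| ≤ M) (h : ∀ᶠ y in 𝓝 x, c ≤ w y) : c ≤ lowerEnv w x := by
  rw [lowerEnv_eq_neg, Pi.neg_apply]
  have : upperEnv (-w) x ≤ -c := upperEnv_le (Eventually.of_forall (abs_neg_apply_le hb))
    (h.mono fun y hy => by simpa using hy)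
  linarith

lemma upperEnv_of_continuousAt (h : ContinuousAt w x) : upperEnv w x = w x :=
  Tendsto.limsup_eq h

lemma lowerEnv_of_continuousAt (h : ContinuousAt w x) : lowerEnv w x = w x :=
  Tendsto.liminf_eq h

end Envelope

/-! ### Strict touching by quadratic perturbation -/

section Touching

variable {E : Type*} [NormedAddCommGroup E] [InnerProductSpace ℝ E]

/-- The parallelogram law: the result depends neither on the base point nor on the centre, so a
quadratic penalty shifts the operator by an explicit constant. -/
lemma sd_norm_sq (c x z : E) (t : ℝ) :
    sd (fun y => ‖y - c‖ ^ 2) x z t = 2 * t ^ 2 * ‖z‖ ^ 2 := by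
  unfold sd
  have h := parallelogram_law_with_norm ℝ (x - c) (t • z)
  rw [norm_smul, Real.norm_eq_abs] at h
  rw [mul_pow, sq_abs] at h
  simp only
  rw [show x + t • z - c = x - c + t • z by abel, show x - t • z - c = x - c - t • z by abel]
  linarith

lemma contDiff_norm_sub_sq (c : E) : ContDiff ℝ 2 (fun y : E => ‖y - c‖ ^ 2) :=
  (contDiff_id.sub contDiff_const).norm_sq ℝ

variable [FiniteDimensional ℝ E]

lemma opa_add_sq {s : ℝ} (hs₀ : 0 < s) (hs₁ : s < 1) {δ : ℝ} (hδ : 0 < δ) {φ u : E → ℝ}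
    (hφ : ContDiff ℝ 2 φ) (hu : LineBounded u) (c x z : E) (a γ : ℝ) :
    opa s δ (fun y => φ y + γ * ‖y - c‖ ^ 2) u x z a
      = opa s δ φ u x z a + γ * (2 * ‖z‖ ^ 2 * (δ ^ (2 - 2 * s) / (2 - 2 * s))) := by
  obtain ⟨h1, h2⟩ := integrableOn_kap_Iio hs₁ hδ
  unfold opa
  rw [← h2, ← integral_const_mul, ← integral_const_mul, ← integral_add
    (integrable_opaFun hs₀ hs₁ hδ hφ hu x z a) ((h1.const_mul _).const_mul _)]
  congr 1; ext t
  unfold opaFun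
  by_cases h : t < δ
  · have h3 := sd_norm_sq c x z t
    rw [if_pos h, if_pos h, indicator_of_mem (show t ∈ Iio δ from h)]
    unfold sd at h3 ⊢
    linear_combination γ * h3
  · rw [if_neg h, if_neg h, indicator_of_notMem (show t ∉ Iio δ from h)]
    ring

lemma opa_antitone {s : ℝ} (hs₀ : 0 < s) (hs₁ : s < 1) {δ : ℝ} (hδ : 0 < δ) {φ u : E → ℝ}
    (hφ : ContDiff ℝ 2 φ) (hu : LineBounded u) (x z : E) {a b : ℝ} (hab : a ≤ b) :
    opa s δ φ u x z b ≤ opa s δ φ u x z a :=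
  opa_mono hs₀ hs₁ hδ hδ hφ hφ hu hu fun t _ => by
    unfold opaFun; split_ifs <;> linarith

lemma exists_rpow_mul_lt {s δ b : ℝ} (hb : 0 < b) (A : ℝ) :
    ∃ γ : ℝ, 0 < γ ∧ γ * (A * (δ ^ (2 - 2 * s) / (2 - 2 * s))) < b := by
  obtain ⟨γ, hγ, h⟩ := exists_pos_mul_lt hb (A * (δ ^ (2 - 2 * s) / (2 - 2 * s)))
  exact ⟨γ, hγ, by rwa [mul_comm]⟩

/-- The subsolution test can be checked with strict touching, under the assumption that the
operator is negative near the touching point. -/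
lemma testSub_of_strict {s : ℝ} (hs₀ : 0 < s) (hs₁ : s < 1) {X : Set E} {U : E → ℝ}
    (hU : UpperSemicontinuous U) (hb : ∃ M : ℝ, ∀ x, |U x| ≤ M)
    (h : ∀ x₀ ∈ X, ∀ (φ : E → ℝ) (z : E) (r γ δ ρ : ℝ), ContDiff ℝ 2 φ → φ x₀ = U x₀ → 0 < γ →
      (∀ x ∈ Metric.ball x₀ r, U x ≤ φ x - γ * ‖x - x₀‖ ^ 2) → 0 < δ → ‖z‖ = 1 → 2 * δ ≤ r →
      0 < ρ → (∀ x ∈ Metric.ball x₀ ρ, ∀ a, U x₀ - ρ < a → opa s δ φ U x z a < 0) → False) :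
    TestSub s X U := by
  refine testSub_of_unit fun x₀ hx₀ φ r hφ h0 hle z δ hδ hz hr => ?_
  by_contra! hneg
  have hL := hU.lineBounded hb
  -- Halving `δ` yields the clause `2 * δ ≤ r`: points near `x₀` then carry a full `δ`-ball inside
  -- the touching region.
  have h1 : opa s (δ / 2) φ U x₀ z (U x₀) < 0 :=
    (opa_le_opa_of_le hs₀ hs₁ (half_pos hδ) (half_le_self hδ.le) hφ hL h0
      (by rwa [hz, mul_one]) hle).trans_lt hneg
  obtain ⟨γ, hγ, hγ'⟩ := exists_rpow_mul_lt (s := s) (δ := δ / 2) (neg_pos.2 h1) (2 * ‖z‖ ^ 2)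
  have hφ' : ContDiff ℝ 2 (fun y => φ y + γ * ‖y - x₀‖ ^ 2) :=
    hφ.add (contDiff_const.mul (contDiff_norm_sub_sq x₀))
  have h2 : opa s (δ / 2) (fun y => φ y + γ * ‖y - x₀‖ ^ 2) U x₀ z (U x₀) < 0 := by
    rw [opa_add_sq hs₀ hs₁ (half_pos hδ) hφ hL]; linarith
  have h3 := eventually_opa_lt hs₀ hs₁ (half_pos hδ) hφ' hU hb h2
  obtain ⟨ρ, hρ, hball⟩ := Metric.eventually_nhds_iff_ball.1 h3
  refine h x₀ hx₀ _ z r γ (δ / 2) (ρ / 2) hφ' (by simp [h0]) hγ ?_ (half_pos hδ) hz (by linarith)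
    (half_pos hρ) ?_
  · intro x hx; have := hle x hx; simpa using this
  · intro x hx a ha
    refine (opa_antitone hs₀ hs₁ (half_pos hδ) hφ' hL x z ha.le).trans_lt
      (hball (x, z, U x₀ - ρ / 2) ?_)
    rw [Metric.mem_ball] at hx ⊢
    rw [Prod.dist_eq, Prod.dist_eq, dist_self, Real.dist_eq]
    refine max_lt (by linarith) (max_lt hρ ?_)
    rw [show U x₀ - ρ / 2 - U x₀ = -(ρ / 2) by ring, abs_neg, abs_of_pos (half_pos hρ)]
    linarith

end Touching

/-! ### Barriers at the boundary of a strictly convex domain -/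

section Boundary

lemma exists_forall_le_rpow_neg {s : ℝ} (hs₀ : 0 < s) (Y : ℝ) :
    ∃ τ : ℝ, 0 < τ ∧ ∀ T, 0 < T → T ≤ τ → Y ≤ T ^ (-(2 * s)) := by
  have h := (tendsto_rpow_neg_nhdsGT_zero (by linarith : -(2 * s) < 0)).eventually_ge_atTop Y
  obtain ⟨τ, hτ, hsub⟩ := (mem_nhdsGT_iff_exists_Ioc_subset).1 h
  exact ⟨τ, hτ, fun T h0 h1 => hsub ⟨h0, h1⟩⟩

/-- The majorant is `A t²` on `t < S`, minus `B` on `t ≥ T`, plus `B + D` on `t ≥ R`, the last term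
undoing the second on the tail. It serves the boundary barrier, with `S = T`, and the comparison
theorem, where `[S, T)` is a neutral zone. -/
lemma integral_le_of_profile {s : ℝ} (hs₀ : 0 < s) (hs₁ : s < 1) {F : ℝ → ℝ}
    (hF : Integrable F (kap s)) {A B D S T R : ℝ} (hS : 0 < S) (hST : S ≤ T) (hTR : T ≤ R)
    (h1 : ∀ t, 0 < t → t < S → F t ≤ A * t ^ 2) (h0 : ∀ t, S ≤ t → t < T → F t ≤ 0)
    (h2 : ∀ t, T ≤ t → t < R → F t ≤ -B) (h3 : ∀ t, R ≤ t → F t ≤ D) :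
    ∫ t, F t ∂kap s ≤ A * (S ^ (2 - 2 * s) / (2 - 2 * s)) - B * (T ^ (-(2 * s)) / (2 * s))
      + (B + D) * (R ^ (-(2 * s)) / (2 * s)) := by
  obtain ⟨i1, e1⟩ := integrableOn_kap_Iio hs₁ hS
  obtain ⟨i2, e2⟩ := integrableOn_kap_Ici hs₀ (hS.trans_le hST)
  obtain ⟨i3, e3⟩ := integrableOn_kap_Ici hs₀ ((hS.trans_le hST).trans_le hTR)
  rw [← e1, ← e2, ← e3, ← integral_const_mul, ← integral_const_mul, ← integral_const_mul,
    ← integral_sub (i1.const_mul _) (i2.const_mul _)]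
  have hadd := integral_add ((i1.const_mul A).sub (i2.const_mul B)) (i3.const_mul (B + D))
  simp only [Pi.sub_apply] at hadd
  rw [← hadd]
  refine integral_kap_mono hF (((i1.const_mul _).sub (i2.const_mul _)).add (i3.const_mul _))
    fun t ht => ?_
  simp only [indicator, mem_Iio, mem_Ici]
  rcases lt_or_ge t T with hlt | hge
  · rw [if_neg (not_le.2 hlt), if_neg (not_le.2 (hlt.trans_le hTR))]
    rcases lt_or_ge t S with hlt' | hge'
    · have := h1 t ht hlt'
      rw [if_pos hlt']; linarith
    · have := h0 t hge' hlt
      rw [if_neg (not_lt.2 hge')]; linarith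
  · rw [if_neg (not_lt.2 (hST.trans hge)), if_pos hge]
    rcases lt_or_ge t R with hlt' | hge'
    · have := h2 t hge hlt'
      rw [if_neg (not_le.2 hlt')]; linarith
    · have := h3 t hge'
      rw [if_pos hge']; linarith

variable {E : Type*} [NormedAddCommGroup E] [InnerProductSpace ℝ E]

lemma strictConvex_openSegment_subset {Ω : Set E} (hΩo : IsOpen Ω) (hΩc : Convex ℝ Ω)
    (hΩn : Ω.Nonempty) (hΩs : StrictConvex ℝ (closure Ω)) {x y : E} (hx : x ∈ closure Ω)
    (hy : y ∈ closure Ω) (hxy : x ≠ y) : openSegment ℝ x y ⊆ Ω := by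
  have hint : interior (closure Ω) = Ω := by
    rw [hΩc.interior_closure_eq_interior_of_nonempty_interior (by rwa [hΩo.interior_eq]),
      hΩo.interior_eq]
  rw [← hint]
  exact hΩs.openSegment_subset hx hy hxy

/-- Hahn–Banach gives a weak inequality on the closure. A second contact point would place a
midpoint in `Ω` by strict convexity, where the inequality is strict. Dividing by `‖f‖ + 1` bounds
the norm without a case distinction. -/
lemma exists_supporting {Ω : Set E} (hΩo : IsOpen Ω) (hΩc : Convex ℝ Ω) (hΩn : Ω.Nonempty)
    (hΩs : StrictConvex ℝ (closure Ω)) {x₀ : E} (hx₀ : x₀ ∈ frontier Ω) :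
    ∃ ℓ : E →L[ℝ] ℝ, ‖ℓ‖ ≤ 1 ∧ ∀ x ∈ closure Ω, x ≠ x₀ → ℓ x₀ < ℓ x := by
  rw [hΩo.frontier_eq] at hx₀
  obtain ⟨f, hf⟩ := geometric_hahn_banach_open_point hΩc hΩo hx₀.2
  have hfc : ∀ x ∈ closure Ω, f x ≤ f x₀ := fun x hx =>
    closure_minimal (fun a ha => (hf a ha).le) (isClosed_le f.continuous continuous_const) hx
  refine ⟨-((‖f‖ + 1)⁻¹ • f), ?_, fun x hx hne => ?_⟩
  · rw [norm_neg, norm_smul, norm_inv, Real.norm_eq_abs, abs_of_pos (by positivity),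
      inv_mul_le_one₀ (by positivity)]
    linarith
  · have hlt : f x < f x₀ := by
      refine lt_of_le_of_ne (hfc x hx) fun heq => ?_
      have hmid := strictConvex_openSegment_subset hΩo hΩc hΩn hΩs hx hx₀.1 hne
        (⟨1 / 2, 1 / 2, by norm_num, by norm_num, by norm_num, rfl⟩ :
          (1 / 2 : ℝ) • x + (1 / 2 : ℝ) • x₀ ∈ openSegment ℝ x x₀)
      have := hf _ hmid
      rw [map_add, map_smul, map_smul, heq, smul_eq_mul] at this
      linarith
    simp only [neg_apply, smul_apply, smul_eq_mul]
    have : 0 < (‖f‖ + 1)⁻¹ := by positivity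
    nlinarith

variable [FiniteDimensional ℝ E]

/-- Compactness: on the part of `closure Ω` away from `x₀` the functional has a minimum above `ℓ
x₀`, and half of that gap is a valid width. -/
lemma exists_small_slice {Ω : Set E} (hΩb : Bornology.IsBounded Ω) {x₀ : E} {ℓ : E →L[ℝ] ℝ}
    (hℓ : ∀ x ∈ closure Ω, x ≠ x₀ → ℓ x₀ < ℓ x) {τ : ℝ} (hτ : 0 < τ) :
    ∃ ε : ℝ, 0 < ε ∧ ∀ x ∈ closure Ω, ℓ x - ℓ x₀ ≤ ε → ‖x - x₀‖ < τ := by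
  have hK : IsCompact (closure Ω \ Metric.ball x₀ τ) :=
    hΩb.isCompact_closure.diff Metric.isOpen_ball
  rcases (closure Ω \ Metric.ball x₀ τ).eq_empty_or_nonempty with he | hne
  · refine ⟨1, one_pos, fun x hx _ => ?_⟩
    by_contra h
    have : x ∈ closure Ω \ Metric.ball x₀ τ := ⟨hx, by rwa [mem_ball_iff_norm]⟩
    rw [he] at this
    exact this
  · obtain ⟨y, hy, hmin⟩ := hK.exists_isMinOn hne ℓ.continuous.continuousOn
    have hyx : y ≠ x₀ := by
      rintro rfl; exact hy.2 (Metric.mem_ball_self hτ)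
    have hpos := hℓ y hy.1 hyx
    refine ⟨(ℓ y - ℓ x₀) / 2, by linarith, fun x hx hle => ?_⟩
    by_contra h
    have : ℓ y ≤ ℓ x := hmin (⟨hx, by rwa [mem_ball_iff_norm]⟩ : x ∈ closure Ω \ _)
    linarith

set_option maxHeartbeats 1000000 in
/-- If an upper semicontinuous function exceeds the exterior datum at a boundary point of a
strictly convex domain, it can be touched nearby from above by a function for which all directional
operators are very negative. -/
lemma exists_steep_touching {s : ℝ} (hs₀ : 0 < s) (hs₁ : s < 1) {Ω : Set E} (hΩo : IsOpen Ω)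
    (hΩc : Convex ℝ Ω) (hΩn : Ω.Nonempty) (hΩb : Bornology.IsBounded Ω)
    (hΩs : StrictConvex ℝ (closure Ω)) {g U : E → ℝ} (hg : ContinuousOn g Ωᶜ)
    (hU : UpperSemicontinuous U) (hb : ∃ M : ℝ, ∀ x, |U x| ≤ M)
    (hext : ∀ x ∉ closure Ω, U x ≤ g x) {x₀ : E} (hx₀ : x₀ ∈ frontier Ω) (hgt : g x₀ < U x₀) :
    ∃ x₁, (x₁ ∈ Ω ∨ x₁ ∈ frontier Ω ∧ g x₁ < U x₁) ∧ ∃ (φ : E → ℝ) (r δ : ℝ),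
      ContDiff ℝ 2 φ ∧ φ x₁ = U x₁ ∧ (∀ x ∈ Metric.ball x₁ r, U x ≤ φ x) ∧ 0 < δ ∧ δ ≤ r ∧
      ∀ z : E, ‖z‖ = 1 → opa s δ φ U x₁ z (U x₁) ≤ -1 := by
  have hL := hU.lineBounded hb
  obtain ⟨M, hM⟩ := hb
  have hM0 : 0 ≤ M := (abs_nonneg _).trans (hM x₀)
  obtain ⟨ℓ, hℓ1, hℓ⟩ := exists_supporting hΩo hΩc hΩn hΩs hx₀
  have hℓ0 : ∀ x ∈ closure Ω, ℓ x₀ ≤ ℓ x := fun x hx => by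
    rcases eq_or_ne x x₀ with rfl | h
    · exact le_rfl
    · exact (hℓ x hx h).le
  have hx₀' : x₀ ∈ Ωᶜ := by rw [hΩo.frontier_eq] at hx₀; exact hx₀.2
  set η := U x₀ - g x₀ with hη
  have hη0 : 0 < η := by linarith
  -- `σ` is the height of the parabolic ridge. The first bound limits upward oscillation to `η / 4`,
  -- leaving second differences at most `-η / 2` past the exit point; the second makes the ridge
  -- cost at most half of what this drop gains.
  set σ := min (η / 2) (η * (1 - s) / (32 * s)) with hσ
  have h1s : 0 < 1 - s := by linarith
  have hσ0 : 0 < σ := lt_min (by linarith) (by positivity)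
  have hσ1 : σ ≤ η / 2 := min_le_left _ _
  have hσ2 : 8 * σ / (2 - 2 * s) ≤ η / (8 * s) := by
    have : σ ≤ η * (1 - s) / (32 * s) := min_le_right _ _
    rw [div_le_iff₀ (by linarith)]
    calc 8 * σ ≤ 8 * (η * (1 - s) / (32 * s)) := by linarith
      _ = η / (8 * s) * (2 - 2 * s) := by field_simp; ring
  -- localisation near `x₀`
  obtain ⟨ρ, hρ, hρU, hρg⟩ : ∃ ρ : ℝ, 0 < ρ ∧ (∀ x, ‖x - x₀‖ ≤ ρ → U x < U x₀ + σ / 2) ∧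
      ∀ x, ‖x - x₀‖ ≤ ρ → x ∈ Ωᶜ → g x < g x₀ + η / 4 := by
    have e1 : ∀ᶠ x in 𝓝 x₀, U x < U x₀ + σ / 2 := hU x₀ _ (by linarith)
    have e2 : ∀ᶠ x in 𝓝 x₀, x ∈ Ωᶜ → g x < g x₀ + η / 4 :=
      eventually_nhdsWithin_iff.1 ((hg x₀ hx₀').eventually (gt_mem_nhds (by linarith)))
    obtain ⟨ρ, hρ, h⟩ := Metric.eventually_nhds_iff.1 (e1.and e2)
    refine ⟨ρ / 2, half_pos hρ, fun x hx => (h ?_).1, fun x hx => (h ?_).2⟩ <;>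
    · rw [dist_eq_norm]; linarith
  have hρΩ : ∀ x, ‖x - x₀‖ ≤ ρ → x ∉ closure Ω → U x ≤ U x₀ - 3 * η / 4 := fun x hx hxΩ => by
    have := hρg x hx fun h => hxΩ (subset_closure h)
    have := hext x hxΩ
    linarith
  set R := ρ / 2 with hR
  have hR0 : 0 < R := half_pos hρ
  -- `K` bounds the tail beyond `R` and does not depend on the slice. The slice size `τ` is chosen
  -- afterwards, so that the kernel mass beyond any `T ≤ τ` outweighs `K + 1`.
  set K := (η / 2 + 4 * M) * (R ^ (-(2 * s)) / (2 * s)) with hK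
  obtain ⟨τ₀, hτ₀, hτ₀'⟩ := exists_forall_le_rpow_neg hs₀ ((K + 1) * (8 * s) / η)
  set τ := min τ₀ R with hτ
  have hτ0 : 0 < τ := lt_min hτ₀ hR0
  obtain ⟨ε₀, hε₀, hε₀'⟩ := exists_small_slice hΩb hℓ (half_pos hτ0)
  set ε := min ε₀ (τ / 2) with hε
  have hε0 : 0 < ε := lt_min hε₀ (half_pos hτ0)
  have hslice : ∀ x ∈ closure Ω, ℓ x - ℓ x₀ ≤ ε → ‖x - x₀‖ < τ / 2 := fun x hx h =>
    hε₀' x hx (h.trans (min_le_left _ _))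
  have hετ : 2 * ε ≤ τ := by have := min_le_right ε₀ (τ / 2); linarith
  -- the touching point
  have hcontq : Continuous fun x => σ * ((ℓ x - ℓ x₀) / ε) ^ 2 := by fun_prop
  have husc : UpperSemicontinuous fun x => U x + -(σ * ((ℓ x - ℓ x₀) / ε) ^ 2) :=
    hU.add hcontq.neg.upperSemicontinuous
  obtain ⟨x₁, hx₁, hmax⟩ := UpperSemicontinuousOn.exists_isMaxOn
    (s := Metric.closedBall x₀ ρ) ⟨x₀, Metric.mem_closedBall_self hρ.le⟩
    (isCompact_closedBall _ _) (husc.upperSemicontinuousOn _)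
  have hx₁ρ : ‖x₁ - x₀‖ ≤ ρ := by rwa [Metric.mem_closedBall, dist_eq_norm] at hx₁
  set q₁ := ((ℓ x₁ - ℓ x₀) / ε) ^ 2 with hq₁
  have hq0 : 0 ≤ q₁ := sq_nonneg _
  have hval : U x₀ + σ * q₁ ≤ U x₁ := by
    have := hmax (Metric.mem_closedBall_self hρ.le)
    simp only [mem_ofPred_eq, sub_self, zero_div] at this
    have e : σ * (0 : ℝ) ^ 2 = 0 := by ring
    rw [e] at this
    linarith
  have hσq : 0 ≤ σ * q₁ := by positivity
  -- The penalty vanishes at `x₀`, so the maximiser can afford only the oscillation `σ / 2`; this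
  -- confines it to the slice of width `ε`.
  have hq1 : q₁ < 1 := by
    have := hρU x₁ hx₁ρ
    by_contra! h
    nlinarith
  have hlam : ℓ x₁ - ℓ x₀ < ε := by
    have h := (sq_lt_one_iff_abs_lt_one _).1 hq1
    have := (abs_lt.1 h).2
    rwa [div_lt_one hε0] at this
  have hx₁cl : x₁ ∈ closure Ω := by
    by_contra h
    have := hρΩ x₁ hx₁ρ h
    linarith
  have hx₁near : ‖x₁ - x₀‖ < τ / 2 := hslice x₁ hx₁cl hlam.le
  have hτR : τ ≤ R := min_le_right _ _
  have hnear : ∀ x, ‖x - x₁‖ ≤ R → ‖x - x₀‖ ≤ ρ := fun x hx => by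
    have := norm_add_le (x - x₁) (x₁ - x₀)
    rw [sub_add_sub_cancel] at this
    linarith
  refine ⟨x₁, ?_, fun x => U x₁ - σ * q₁ + σ * ((ℓ x - ℓ x₀) / ε) ^ 2, R, 2 * ε, ?_, ?_, ?_,
    by linarith, hετ.trans hτR, ?_⟩
  · by_cases h : x₁ ∈ Ω
    · exact Or.inl h
    · refine Or.inr ⟨by rw [hΩo.frontier_eq]; exact ⟨hx₁cl, h⟩, ?_⟩
      have := hρg x₁ hx₁ρ h
      linarith
  · have : ContDiff ℝ 2 fun x => ℓ x := ℓ.contDiff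
    fun_prop
  · simp only [hq₁]; ring
  · intro x hx
    have hx' : ‖x - x₁‖ ≤ R := by
      rw [Metric.mem_ball, dist_eq_norm] at hx; exact hx.le
    have := hmax (show x ∈ Metric.closedBall x₀ ρ by
      rw [Metric.mem_closedBall, dist_eq_norm]; exact hnear x hx')
    simp only [mem_ofPred_eq] at this
    linarith
  · -- the estimate in a given direction
    have main : ∀ z : E, ‖z‖ = 1 → 0 ≤ ℓ z →
        opa s (2 * ε) (fun x => U x₁ - σ * q₁ + σ * ((ℓ x - ℓ x₀) / ε) ^ 2) U x₁ z (U x₁)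
          ≤ -1 := by
      intro z hz hb0
      set φ : E → ℝ := fun x => U x₁ - σ * q₁ + σ * ((ℓ x - ℓ x₀) / ε) ^ 2 with hφ
      have hφC : ContDiff ℝ 2 φ := by
        have : ContDiff ℝ 2 fun x => ℓ x := ℓ.contDiff
        fun_prop
      have hφ1 : φ x₁ = U x₁ := by simp only [hφ, hq₁]; ring
      have hUφ : ∀ x, ‖x - x₁‖ ≤ R → U x ≤ φ x := fun x hx => by
        have := hmax (show x ∈ Metric.closedBall x₀ ρ by
          rw [Metric.mem_closedBall, dist_eq_norm]; exact hnear x hx)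
        simp only [mem_ofPred_eq] at this
        simp only [hφ]; linarith
      have hsd : ∀ t, sd φ x₁ z t = 2 * σ * (ℓ z / ε) ^ 2 * t ^ 2 := fun t => by
        simp only [sd, hφ, map_add, map_sub, map_smul, smul_eq_mul]; ring
      have hb1 : ℓ z ≤ 1 := by
        have h := ℓ.le_opNorm z
        rw [hz, mul_one] at h
        exact (le_abs_self _).trans (h.trans hℓ1)
      -- In direction `-z` the line has left the closure by time `2 ε / ℓ z`, since `ℓ` falls below
      -- `ℓ x₀`, and in any case by time `τ`, since the slice is small. `T` is the smaller of the
      -- two times.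
      set β := max (ℓ z) (2 * ε / τ) with hβ
      have hβ0 : 0 < β := lt_max_of_lt_right (by positivity)
      have hβ1 : β ≤ 1 := max_le hb1 (by rwa [div_le_one hτ0])
      set T := 2 * ε / β with hT
      have hTβ : T * β = 2 * ε := by rw [hT]; field_simp
      have hT0 : 0 < T := by positivity
      have hT2 : 2 * ε ≤ T := by rw [← hTβ]; exact mul_le_of_le_one_right hT0.le hβ1
      have hTτ : T ≤ τ := by
        rw [hT, div_le_iff₀ hβ0]
        have : 2 * ε / τ ≤ β := le_max_right _ _
        rw [div_le_iff₀ hτ0] at this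
        linarith
      have hbT : ℓ z * T ≤ 2 * ε := by
        rw [← hTβ, mul_comm]; exact mul_le_mul_of_nonneg_left (le_max_left _ _) hT0.le
      have hnorm : ∀ t, 0 < t → ‖x₁ + t • z - x₁‖ = t ∧ ‖x₁ - t • z - x₁‖ = t := fun t ht => by
        constructor
        · rw [add_sub_cancel_left, norm_smul, hz, mul_one, Real.norm_eq_abs, abs_of_pos ht]
        · rw [sub_sub_cancel_left, norm_neg, norm_smul, hz, mul_one, Real.norm_eq_abs,
            abs_of_pos ht]
      have hexit : ∀ t, T ≤ t → x₁ - t • z ∉ closure Ω := fun t ht hmem => by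
        have ht0 : 0 < t := hT0.trans_le ht
        have h1 := hℓ0 _ hmem
        have e : ℓ (x₁ - t • z) = ℓ x₁ - t * ℓ z := by rw [map_sub, map_smul, smul_eq_mul]
        have h2 : ‖x₁ - t • z - x₀‖ < τ / 2 := hslice _ hmem (by
          rw [e]; have := mul_nonneg ht0.le hb0; linarith)
        have h3 : t < τ := by
          have := norm_sub_le (x₁ - t • z - x₀) (x₁ - x₀)
          rw [sub_sub_sub_cancel_right, (hnorm t ht0).2] at this
          linarith
        have h4 : t * ℓ z < 2 * ε := by rw [e] at h1; linarith
        have h5 : t * (2 * ε / τ) < 2 * ε := by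
          rw [← mul_div_assoc, div_lt_iff₀ hτ0, mul_comm]
          exact mul_lt_mul_of_pos_left h3 (by linarith)
        have h6 : t * β < 2 * ε := by
          rcases max_choice (ℓ z) (2 * ε / τ) with h | h <;> rw [hβ, h] <;> assumption
        have h7 : T * β ≤ t * β := mul_le_mul_of_nonneg_right ht hβ0.le
        linarith
      have hpr := integral_le_of_profile hs₀ hs₁ (F := opaFun (2 * ε) φ U x₁ z (U x₁))
        (integrable_opaFun hs₀ hs₁ (by linarith) hφC hL x₁ z (U x₁))
        (A := 2 * σ * (ℓ z / ε) ^ 2) (B := η / 2) (D := 4 * M) hT0 le_rfl (hTτ.trans hτR) ?_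
        (fun t h h' => absurd h (not_le.2 h')) ?_ ?_
      · refine hpr.trans ?_
        have e1 : T ^ (2 - 2 * s) = T ^ 2 * T ^ (-(2 * s)) := by
          rw [sub_eq_add_neg, Real.rpow_add hT0, Real.rpow_ofNat]
        set P := T ^ (-(2 * s)) with hP
        have hP0 : 0 < P := by positivity
        -- The bound `ℓ z * T ≤ 2 * ε` eliminates `ε`: the ridge costs a multiple of `T ^ (-(2 *
        -- s))`, the same power of `T` as the gain.
        have h1 : 2 * σ * (ℓ z / ε) ^ 2 * (T ^ (2 - 2 * s) / (2 - 2 * s)) ≤ η / (8 * s) * P := by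
          have : (ℓ z / ε * T) ^ 2 ≤ 4 := by
            have h0 : 0 ≤ ℓ z / ε * T := by positivity
            have h2 : ℓ z / ε * T ≤ 2 := by
              rw [div_mul_eq_mul_div, div_le_iff₀ hε0]; exact hbT
            nlinarith
          calc _ = (ℓ z / ε * T) ^ 2 * (2 * σ / (2 - 2 * s) * P) := by rw [e1]; ring
            _ ≤ 4 * (2 * σ / (2 - 2 * s) * P) := by
                refine mul_le_mul_of_nonneg_right this ?_
                have : 0 < 2 - 2 * s := by linarith
                positivity
            _ = 8 * σ / (2 - 2 * s) * P := by ring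
            _ ≤ _ := by gcongr
        have h2 : (K + 1) * (8 * s) / η ≤ P := hτ₀' T hT0 (hTτ.trans (min_le_left _ _))
        have h3 : K + 1 ≤ η / (8 * s) * P := by
          calc K + 1 = η / (8 * s) * ((K + 1) * (8 * s) / η) := by field_simp
            _ ≤ _ := by gcongr
        have h4 : η / 2 * (P / (2 * s)) = 2 * (η / (8 * s) * P) := by field_simp; ring
        linarith
      · intro t ht htT
        unfold opaFun
        split_ifs with h
        · exact (hsd t).le
        · rw [← hsd]
          have hn := hnorm t ht
          have h1 := hUφ (x₁ + t • z) (by rw [hn.1]; linarith)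
          have h2 := hUφ (x₁ - t • z) (by rw [hn.2]; linarith)
          unfold sd; rw [hφ1]; linarith
      · intro t htT htR
        have ht0 : 0 < t := hT0.trans_le htT
        have hn := hnorm t ht0
        unfold opaFun
        rw [if_neg (not_lt.2 (hT2.trans htT))]
        have h1 := hρU (x₁ + t • z) (hnear _ (by rw [hn.1]; exact htR.le))
        have h2 := hρΩ (x₁ - t • z) (hnear _ (by rw [hn.2]; exact htR.le)) (hexit t htT)
        linarith
      · intro t htR
        unfold opaFun
        rw [if_neg (not_lt.2 ((hετ.trans hτR).trans htR))]
        have h1 := abs_le.1 (hM (x₁ + t • z))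
        have h2 := abs_le.1 (hM (x₁ - t • z))
        have h3 := abs_le.1 (hM x₁)
        linarith
    intro z hz
    rcases le_total 0 (ℓ z) with h | h
    · exact main z hz h
    · rw [← opa_neg_dir]
      exact main (-z) (by rwa [norm_neg]) (by rw [map_neg]; linarith)

end Boundary

/-! ### Boundary inequalities and the comparison principle -/

section Comparison

variable {E : Type*} [NormedAddCommGroup E] [InnerProductSpace ℝ E] [FiniteDimensional ℝ E]

/-- Bounded open convex sets with strictly convex closure. -/
structure IsStrictDomain (Ω : Set E) : Prop where
  isOpen : IsOpen Ω
  nonempty : Ω.Nonempty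
  bounded : Bornology.IsBounded Ω
  convex : Convex ℝ Ω
  strictConvex : StrictConvex ℝ (closure Ω)

/-- Subsolutions in the generalised sense lie below the datum on the boundary. -/
lemma TestSub.le_datum [Nontrivial E] {s : ℝ} (hs₀ : 0 < s) (hs₁ : s < 1) {Ω : Set E}
    (hΩ : IsStrictDomain Ω) {g U : E → ℝ} (hg : ContinuousOn g Ωᶜ) (hU : UpperSemicontinuous U)
    (hb : ∃ M : ℝ, ∀ x, |U x| ≤ M) (hext : ∀ x ∉ closure Ω, U x ≤ g x)
    (h : TestSub s {x | x ∈ Ω ∨ x ∈ frontier Ω ∧ g x < U x} U) : ∀ x ∈ frontier Ω, U x ≤ g x := by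
  intro x hx
  by_contra! hgt
  obtain ⟨x₁, hx₁, φ, r, δ, hφ, h0, hle, hδ, hr, hop⟩ := exists_steep_touching hs₀ hs₁ hΩ.isOpen
    hΩ.convex hΩ.nonempty hΩ.bounded hΩ.strictConvex hg hU hb hext hx hgt
  obtain ⟨z, hz⟩ := exists_norm_eq E zero_le_one
  have := h x₁ hx₁ φ r hφ h0 hle z δ hδ (by rwa [hz, mul_one])
  linarith [hop z hz]

/-- Supersolutions in the generalised sense lie above the datum on the boundary. -/
lemma TestSuper.datum_le {s : ℝ} (hs₀ : 0 < s) (hs₁ : s < 1) {Ω : Set E}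
    (hΩ : IsStrictDomain Ω) {g V : E → ℝ} (hg : ContinuousOn g Ωᶜ) (hV : LowerSemicontinuous V)
    (hb : ∃ M : ℝ, ∀ x, |V x| ≤ M) (hext : ∀ x ∉ closure Ω, g x ≤ V x)
    (h : TestSuper s {x | x ∈ Ω ∨ x ∈ frontier Ω ∧ V x < g x} V) :
    ∀ x ∈ frontier Ω, g x ≤ V x := by
  intro x hx
  by_contra! hgt
  obtain ⟨x₁, hx₁, φ, r, δ, hφ, h0, hle, hδ, hr, hop⟩ := exists_steep_touching hs₀ hs₁ hΩ.isOpen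
    hΩ.convex hΩ.nonempty hΩ.bounded hΩ.strictConvex (g := -g) (U := -V) hg.neg hV.neg_upper
    (by simpa using hb) (by simpa using hext) hx (by simpa using hgt)
  obtain ⟨z, hz, hlt⟩ := h x₁ (by simpa using hx₁) (-φ) r hφ.neg (by simp [h0])
    (fun y hy => by have := hle y hy; simp only [Pi.neg_apply] at this ⊢; linarith) δ hδ hr 1
    one_pos
  have h1 := hop z hz
  have h2 := opa_neg s δ (-φ) V x₁ z (V x₁)
  rw [neg_neg] at h2
  simp only [Pi.neg_apply] at h1
  linarith

lemma exists_small_inner {s : ℝ} (hs₁ : s < 1) (A : ℝ) {b δ₀ : ℝ} (hb : 0 < b) (hδ₀ : 0 < δ₀) :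
    ∃ δ : ℝ, 0 < δ ∧ δ ≤ δ₀ ∧ A * (δ ^ (2 - 2 * s) / (2 - 2 * s)) < b := by
  have hp : 0 < 2 - 2 * s := by linarith
  have hc : Tendsto (fun δ : ℝ => A * (δ ^ (2 - 2 * s) / (2 - 2 * s))) (𝓝 0) (𝓝 0) := by
    have h := (Real.continuousAt_rpow_const 0 (2 - 2 * s) (Or.inr hp.le)).tendsto
    rw [Real.zero_rpow hp.ne'] at h
    simpa using (h.div_const (2 - 2 * s)).const_mul A
  obtain ⟨ε, hε, h⟩ := Metric.eventually_nhds_iff.1 (hc.eventually (gt_mem_nhds hb))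
  refine ⟨min δ₀ (ε / 2), lt_min hδ₀ (half_pos hε), min_le_left _ _, h ?_⟩
  rw [dist_zero_right, Real.norm_eq_abs, abs_of_pos (lt_min hδ₀ (half_pos hε))]
  exact (min_le_right _ _).trans_lt (half_lt_self hε)

lemma exists_small_tail {s : ℝ} (hs₀ : 0 < s) (A R₀ : ℝ) {b : ℝ} (hb : 0 < b) :
    ∃ R : ℝ, R₀ ≤ R ∧ A * (R ^ (-(2 * s)) / (2 * s)) < b := by
  have hc : Tendsto (fun R : ℝ => A * (R ^ (-(2 * s)) / (2 * s))) atTop (𝓝 0) := by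
    simpa using ((tendsto_rpow_neg_atTop (by linarith : 0 < 2 * s)).div_const (2 * s)).const_mul A
  obtain ⟨R, h1, h2⟩ := ((eventually_ge_atTop R₀).and (hc.eventually (gt_mem_nhds hb))).exists
  exact ⟨R, h1, h2⟩

variable {E' : Type*} [NormedAddCommGroup E'] [InnerProductSpace ℝ E'] [FiniteDimensional ℝ E']

set_option maxHeartbeats 1000000 in
/-- Comparison of a subsolution on `E` with a supersolution on `E'` along an affine map. -/
theorem comparison {s : ℝ} (hs₀ : 0 < s) (hs₁ : s < 1) {Ω : Set E} {Ω' : Set E'}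
    (hΩo : IsOpen Ω) (hΩo' : IsOpen Ω') (hΩb' : Bornology.IsBounded Ω') {u : E → ℝ} {v : E' → ℝ}
    (hu : UpperSemicontinuous u) (hub : ∃ M : ℝ, ∀ x, |u x| ≤ M)
    (hv : LowerSemicontinuous v) (hvb : ∃ M : ℝ, ∀ x, |v x| ≤ M) (p : E) (L : E' →L[ℝ] E)
    (hA : ∀ x ∈ Ω', p + L x ∈ Ω) (hus : TestSub s Ω u) (hvs : TestSuper s Ω' v)
    (hle : ∀ x ∉ Ω', u (p + L x) ≤ v x) : ∀ x, u (p + L x) ≤ v x := by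
  intro x'
  by_contra! hlt
  have huL := hu.lineBounded hub
  have hvL := hv.lineBounded hvb
  obtain ⟨M, hM0, huM, hvM⟩ : ∃ M : ℝ, 0 ≤ M ∧ (∀ x, |u x| ≤ M) ∧ ∀ x, |v x| ≤ M := by
    obtain ⟨M₁, h1⟩ := hub
    obtain ⟨M₂, h2⟩ := hvb
    exact ⟨max M₁ M₂, ((abs_nonneg _).trans (h1 p)).trans (le_max_left _ _),
      fun x => (h1 x).trans (le_max_left _ _), fun x => (h2 x).trans (le_max_right _ _)⟩
  set θ := u (p + L x') - v x' with hθ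
  have hθ0 : 0 < θ := by linarith
  have hx' : x' ∈ Ω' := by
    by_contra h
    exact absurd (hle x' h) (not_le.2 hlt)
  obtain ⟨R₀, hR₀, hR₀'⟩ : ∃ R₀ : ℝ, 0 < R₀ ∧ ∀ x ∈ Ω', ‖x‖ ≤ R₀ := by
    obtain ⟨R, hR⟩ := hΩb'.exists_norm_le
    exact ⟨max R 1, lt_max_of_lt_right one_pos, fun x hx => (hR x hx).trans (le_max_left _ _)⟩
  set R₁ := 3 * R₀ with hR₁
  have hR₁0 : 0 < R₁ := by linarith
  -- Beyond `R₁` lines through `Ω'` have left it and the integrand is at most `-θ`. The maximum is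
  -- taken over a compact set, so this is known only up to `R₂`; past that the crude bound `8 * M`
  -- is used. `G` is the net gain.
  obtain ⟨R₂, hR₂, hR₂'⟩ := exists_small_tail hs₀ (θ + 8 * M) R₁
    (b := θ * (R₁ ^ (-(2 * s)) / (2 * s))) (by positivity)
  have hR₂0 : 0 < R₂ := hR₁0.trans_le hR₂
  set G := θ * (R₁ ^ (-(2 * s)) / (2 * s)) - (θ + 8 * M) * (R₂ ^ (-(2 * s)) / (2 * s)) with hG
  have hG0 : 0 < G := by linarith
  set K' := Metric.closedBall (0 : E') (R₀ + R₂ + 2) with hK'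
  have hK'c : IsCompact K' := isCompact_closedBall _ _
  set R₃ := ‖p‖ + ‖L‖ * (R₀ + R₂ + 2) + 3 with hR₃
  set K := Metric.closedBall (0 : E) R₃ with hK
  -- points with nearly matching arguments
  obtain ⟨ρ, hρ0, hρ1, hρ⟩ : ∃ ρ : ℝ, 0 < ρ ∧ ρ ≤ 1 ∧ ∀ w : E, ‖w‖ < ρ → ∀ x ∈ K',
      (p + L x + w ∈ Ω ∧ x ∈ Ω') ∨ u (p + L x + w) - v x < θ / 2 := by
    have key : ∀ᶠ w in 𝓝 (0 : E), ∀ x ∈ K',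
        (p + L x + w ∈ Ω ∧ x ∈ Ω') ∨ u (p + L x + w) - v x < θ / 2 := by
      refine hK'c.eventually_forall_of_forall_eventually fun x hx => ?_
      have hc : Tendsto (fun q : E × E' => p + L q.2 + q.1) (𝓝 (0, x)) (𝓝 (p + L x)) := by
        have : Continuous fun q : E × E' => p + L q.2 + q.1 := by fun_prop
        simpa using this.tendsto (0, x)
      have hc2 : Tendsto (fun q : E × E' => q.2) (𝓝 (0, x)) (𝓝 x) := by
        simpa using continuous_snd.tendsto ((0 : E), x)
      by_cases hxΩ : x ∈ Ω'
      · filter_upwards [hc.eventually (hΩo.mem_nhds (hA x hxΩ)),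
          hc2.eventually (hΩo'.mem_nhds hxΩ)] with q h1 h2 using Or.inl ⟨h1, h2⟩
      · filter_upwards [hc.eventually (hu (p + L x) (u (p + L x) + θ / 4) (by linarith)),
          hc2.eventually (hv x (v x - θ / 4) (by linarith))] with q h1 h2
        have := hle x hxΩ
        exact Or.inr (by linarith)
    obtain ⟨ρ, hρ, h⟩ := Metric.eventually_nhds_iff.1 key
    refine ⟨min ρ 1, lt_min hρ one_pos, min_le_right _ _, fun w hw => h ?_⟩
    rw [dist_zero_right]
    exact hw.trans_le (min_le_left _ _)
  -- One fixed penalisation is enough: this value forces the two components of the maximiser to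
  -- match up to `ρ`, and no limit in `n` is taken.
  set n := (2 * M + 1) / ρ ^ 2 with hn
  have hn0 : 0 < n := by positivity
  -- the maximum point of the doubled function
  have husc : UpperSemicontinuous fun q : E × E' =>
      u q.1 + -v q.2 + -(n * ‖q.1 - (p + L q.2)‖ ^ 2) := by
    have h1 : UpperSemicontinuous fun q : E × E' => u q.1 :=
      hu.comp (g := fun q : E × E' => q.1) continuous_fst
    have h2 : UpperSemicontinuous fun q : E × E' => (-v) q.2 :=
      hv.neg_upper.comp (g := fun q : E × E' => q.2) continuous_snd
    have h3 : Continuous fun q : E × E' => -(n * ‖q.1 - (p + L q.2)‖ ^ 2) := by fun_prop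
    exact (h1.add h2).add h3.upperSemicontinuous
  have hAK : ∀ x ∈ K', ‖p + L x‖ ≤ R₃ - 3 := fun x hx => by
    rw [hK', mem_closedBall_zero_iff] at hx
    have h1 := norm_add_le p (L x)
    have h2 : ‖L x‖ ≤ ‖L‖ * (R₀ + R₂ + 2) := (L.le_opNorm x).trans (by gcongr)
    linarith
  have hx'K : x' ∈ K' := by
    rw [hK', mem_closedBall_zero_iff]; have := hR₀' x' hx'; linarith
  have hq' : (p + L x', x') ∈ K ×ˢ K' := by
    refine ⟨?_, hx'K⟩
    rw [hK, mem_closedBall_zero_iff]; have := hAK x' hx'K; linarith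
  obtain ⟨⟨y, x⟩, ⟨hyK, hxK⟩, hmax⟩ := UpperSemicontinuousOn.exists_isMaxOn
    (s := K ×ˢ K') ⟨_, hq'⟩ ((isCompact_closedBall _ _).prod hK'c) (husc.upperSemicontinuousOn _)
  simp only at hyK hxK
  have hval : θ + n * ‖y - (p + L x)‖ ^ 2 ≤ u y - v x := by
    have := hmax hq'
    simp only [mem_ofPred_eq, sub_self, norm_zero] at this
    have e : n * (0 : ℝ) ^ 2 = 0 := by ring
    rw [e] at this
    linarith
  have hw : ‖y - (p + L x)‖ < ρ := by
    by_contra! h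
    have h1 : ρ ^ 2 ≤ ‖y - (p + L x)‖ ^ 2 := by gcongr
    have h2 : n * ρ ^ 2 = 2 * M + 1 := by rw [hn]; field_simp
    have h3 := mul_le_mul_of_nonneg_left h1 hn0.le
    linarith [(abs_le.1 (huM y)).2, (abs_le.1 (hvM x)).1]
  have hyeq : p + L x + (y - (p + L x)) = y := by abel
  have hnn : 0 ≤ n * ‖y - (p + L x)‖ ^ 2 := by positivity
  obtain ⟨hyΩ, hxΩ⟩ : y ∈ Ω ∧ x ∈ Ω' := by
    have := hρ _ hw x hxK
    rw [hyeq] at this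
    rcases this with h | h
    · exact h
    · linarith
  have hx0 := hR₀' x hxΩ
  have hynorm : ‖y‖ ≤ ‖p‖ + ‖L‖ * R₀ + 1 := by
    have h1 := norm_add_le (p + L x) (y - (p + L x))
    rw [hyeq] at h1
    have h2 := norm_add_le p (L x)
    have h3 : ‖L x‖ ≤ ‖L‖ * R₀ := (L.le_opNorm x).trans (by gcongr)
    linarith
  set φu : E → ℝ := fun y' => u y - n * ‖y - (p + L x)‖ ^ 2 + n * ‖y' - (p + L x)‖ ^ 2 with hφu
  set φv : E' → ℝ := fun x'' => v x + n * ‖y - (p + L x)‖ ^ 2 - n * ‖y - (p + L x'')‖ ^ 2 with hφv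
  have hφuC : ContDiff ℝ 2 φu := contDiff_const.add (contDiff_const.mul (contDiff_norm_sub_sq _))
  have hφvC : ContDiff ℝ 2 φv := by
    have : ContDiff ℝ 2 fun x'' : E' => y - (p + L x'') :=
      contDiff_const.sub (contDiff_const.add L.contDiff)
    exact contDiff_const.sub (contDiff_const.mul (this.norm_sq ℝ))
  have hφu0 : φu y = u y := by simp [hφu]
  have hφv0 : φv x = v x := by simp [hφv]
  have hφule : ∀ y' ∈ Metric.ball y 1, u y' ≤ φu y' := fun y' hy' => by
    have hy'K : y' ∈ K := by
      rw [hK, mem_closedBall_zero_iff]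
      rw [Metric.mem_ball, dist_eq_norm] at hy'
      have := norm_add_le (y' - y) y
      rw [sub_add_cancel] at this
      have : 0 ≤ ‖L‖ * (R₂ + 2) := by positivity
      linarith
    have := hmax (show (y', x) ∈ K ×ˢ K' from ⟨hy'K, hxK⟩)
    simp only [mem_ofPred_eq] at this
    simp only [hφu]; linarith
  have hφvle : ∀ x'' ∈ Metric.ball x 1, φv x'' ≤ v x'' := fun x'' hx'' => by
    have hx''K : x'' ∈ K' := by
      rw [hK', mem_closedBall_zero_iff]
      rw [Metric.mem_ball, dist_eq_norm] at hx''
      have := norm_add_le (x'' - x) x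
      rw [sub_add_cancel] at this
      linarith
    have := hmax (show (y, x'') ∈ K ×ˢ K' from ⟨hyK, hx''K⟩)
    simp only [mem_ofPred_eq] at this
    simp only [hφv]; linarith
  -- At short distances the two test functions together contribute at most `4 n ‖L‖² t²`. Half of
  -- `G` absorbs this; the other half absorbs the error in the supersolution test.
  obtain ⟨δ, hδ0, hδ1, hδ⟩ := exists_small_inner hs₁ (4 * n * ‖L‖ ^ 2) (b := G / 2)
    (δ₀ := min R₁ (1 / (‖L‖ + 1))) (by linarith) (lt_min hR₁0 (by positivity))
  have hδ2 : δ * (‖L‖ + 1) ≤ 1 := by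
    rw [← le_div_iff₀ (by positivity)]; exact hδ1.trans (min_le_right _ _)
  have hδR₁ : δ ≤ R₁ := hδ1.trans (min_le_left _ _)
  have hδL : 0 ≤ δ * ‖L‖ := by positivity
  -- The supersolution selects the direction `z`; the subsolution is then tested along `L z`, which
  -- may have any length and may vanish.
  obtain ⟨z, hz, hzlt⟩ := hvs x hxΩ φv 1 hφvC hφv0 hφvle δ hδ0 (by linarith) (G / 2) (by linarith)
  have hLz : ‖L z‖ ≤ ‖L‖ := by simpa [hz] using L.le_opNorm z
  have hu0 := hus y hyΩ φu 1 hφuC hφu0 hφule (L z) δ hδ0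
    ((mul_le_mul_of_nonneg_left hLz hδ0.le).trans (by linarith))
  have hiu := integrable_opaFun hs₀ hs₁ hδ0 hφuC huL y (L z) (u y)
  have hiv := integrable_opaFun hs₀ hs₁ hδ0 hφvC hvL x z (v x)
  -- comparison of both functions along parallel lines
  have hpair : ∀ t : ℝ, |t| < R₂ → u (y + t • L z) - v (x + t • z) ≤ u y - v x := fun t ht => by
    have hn1 : ‖t • L z‖ ≤ R₂ * ‖L‖ := by
      rw [norm_smul, Real.norm_eq_abs]; gcongr
    have hn2 : ‖t • z‖ ≤ R₂ := by rw [norm_smul, Real.norm_eq_abs, hz, mul_one]; exact ht.le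
    have := hmax (show (y + t • L z, x + t • z) ∈ K ×ˢ K' from ⟨by
      rw [hK, mem_closedBall_zero_iff]
      have := norm_add_le y (t • L z)
      have : 0 ≤ ‖L‖ * 2 := by positivity
      linarith, by
      rw [hK', mem_closedBall_zero_iff]
      have := norm_add_le x (t • z)
      linarith⟩)
    simp only [mem_ofPred_eq, map_add, map_smul] at this
    rw [show y + t • L z - (p + (L x + t • L z)) = y - (p + L x) by abel] at this
    linarith
  have hfar : ∀ t : ℝ, R₁ ≤ |t| → |t| < R₂ → u (y + t • L z) - v (x + t • z) < θ / 2 :=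
    fun t ht1 ht2 => by
    have hn2 : ‖t • z‖ = |t| := by rw [norm_smul, Real.norm_eq_abs, hz, mul_one]
    have hxt : x + t • z ∈ K' := by
      rw [hK', mem_closedBall_zero_iff]
      have := norm_add_le x (t • z)
      linarith
    have hnot : x + t • z ∉ Ω' := fun h => by
      have h1 := hR₀' _ h
      have h2 := norm_sub_le (x + t • z) x
      rw [add_sub_cancel_left] at h2
      linarith
    have := hρ _ hw (x + t • z) hxt
    rw [show p + L (x + t • z) + (y - (p + L x)) = y + t • L z by
      rw [map_add, map_smul]; abel] at this
    exact this.resolve_left fun h => hnot h.2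
  have hprof := integral_le_of_profile hs₀ hs₁ (hiu.sub hiv) (A := 4 * n * ‖L‖ ^ 2) (B := θ)
    (D := 8 * M) hδ0 hδR₁ hR₂ ?_ ?_ ?_ ?_
  · simp only [Pi.sub_apply] at hprof
    rw [integral_sub hiu hiv] at hprof
    unfold opa at hu0 hzlt
    linarith
  · intro t ht htδ
    have e1 := sd_norm_sq (p + L x) y (L z) t
    have e2 := sd_norm_sq y (p + L x) (L z) t
    simp only [Pi.sub_apply]
    unfold opaFun
    rw [if_pos htδ, if_pos htδ]
    have e3 : sd φu y (L z) t - sd φv x z t = 4 * n * ‖L z‖ ^ 2 * t ^ 2 := by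
      simp only [sd] at e1 e2 ⊢
      simp only [hφu, hφv, map_add, map_sub, map_smul]
      rw [norm_sub_rev (p + L x) y, norm_sub_rev (p + L x + _) y,
        norm_sub_rev (p + L x - _) y] at e2
      rw [show p + (L x + t • L z) = p + L x + t • L z by abel,
        show p + (L x - t • L z) = p + L x - t • L z by abel]
      linear_combination n * e1 + n * e2
    rw [e3]
    gcongr
  · intro t htδ htR
    have ht0 : 0 < t := hδ0.trans_le htδ
    simp only [Pi.sub_apply]
    unfold opaFun
    rw [if_neg (not_lt.2 htδ), if_neg (not_lt.2 htδ)]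
    have h1 := hpair t (by rw [abs_of_pos ht0]; linarith)
    have h2 := hpair (-t) (by rw [abs_neg, abs_of_pos ht0]; linarith)
    simp only [neg_smul, ← sub_eq_add_neg] at h2
    linarith
  · intro t htR htR'
    have ht0 : 0 < t := hR₁0.trans_le htR
    have htδ := hδR₁.trans htR
    simp only [Pi.sub_apply]
    unfold opaFun
    rw [if_neg (not_lt.2 htδ), if_neg (not_lt.2 htδ)]
    have h1 := hfar t (by rwa [abs_of_pos ht0]) (by rwa [abs_of_pos ht0])
    have h2 := hfar (-t) (by rwa [abs_neg, abs_of_pos ht0]) (by rwa [abs_neg, abs_of_pos ht0])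
    simp only [neg_smul, ← sub_eq_add_neg] at h2
    linarith
  · intro t htR
    have htδ := (hδR₁.trans hR₂).trans htR
    simp only [Pi.sub_apply]
    unfold opaFun
    rw [if_neg (not_lt.2 htδ), if_neg (not_lt.2 htδ)]
    linarith [abs_le.1 (huM (y + t • L z)), abs_le.1 (huM (y - t • L z)), abs_le.1 (huM y),
      abs_le.1 (hvM (x + t • z)), abs_le.1 (hvM (x - t • z)), abs_le.1 (hvM x)]

end Comparison

/-! ### Perron's method -/

section Perron

variable {E : Type*} [NormedAddCommGroup E] [InnerProductSpace ℝ E]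

/-- Bounded upper semicontinuous subsolutions that agree with the datum off `Ω`. -/
def perronClass (s : ℝ) (Ω : Set E) (g : E → ℝ) (M : ℝ) : Set (E → ℝ) :=
  {u | UpperSemicontinuous u ∧ (∀ x, |u x| ≤ M) ∧ (∀ x ∉ Ω, u x = g x) ∧ TestSub s Ω u}

/-- The Perron solution. -/
def perronSol (s : ℝ) (Ω : Set E) (g : E → ℝ) (M : ℝ) (x : E) : ℝ :=
  sSup ((fun u : E → ℝ => u x) '' perronClass s Ω g M)

lemma norm_add_smul_sub {x z : E} (hz : ‖z‖ = 1) {t : ℝ} (ht : 0 < t) :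
    ‖x + t • z - x‖ = t ∧ ‖x - t • z - x‖ = t := by
  constructor
  · rw [add_sub_cancel_left, norm_smul, hz, mul_one, Real.norm_eq_abs, abs_of_pos ht]
  · rw [sub_sub_cancel_left, norm_neg, norm_smul, hz, mul_one, Real.norm_eq_abs, abs_of_pos ht]

lemma add_smul_mem_ball {x z : E} (hz : ‖z‖ = 1) {t r : ℝ} (ht : 0 < t) (hr : t < r) :
    x + t • z ∈ Metric.ball x r ∧ x - t • z ∈ Metric.ball x r := by
  simp only [mem_ball_iff_norm, norm_add_smul_sub hz ht, hr, and_self]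

/-- The value `-M` is a global minimum, so second differences centred in `Ω` are nonnegative, also
for functions touching from above. -/
lemma perronClass_nonempty (s : ℝ) {Ω : Set E} (hΩ : IsOpen Ω) {g : E → ℝ}
    (hg : ContinuousOn g Ωᶜ) {M : ℝ} (hM : ∀ x ∈ Ωᶜ, |g x| ≤ M) (hM0 : 0 ≤ M) :
    (perronClass s Ω g M).Nonempty := by
  classical
  set u : E → ℝ := fun x => if x ∈ Ω then -M else g x with hu
  have hge : ∀ x, -M ≤ u x := fun x => by
    simp only [hu]; split_ifs with h
    · exact le_rfl
    · exact (abs_le.1 (hM x h)).1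
  refine ⟨u, fun x c hc => ?_, fun x => ?_, fun x hx => if_neg hx, testSub_of_unit ?_⟩
  · simp only [hu] at hc
    split_ifs at hc with hx
    · filter_upwards [hΩ.mem_nhds hx] with y hy
      simp only [hu, if_pos hy]; exact hc
    · filter_upwards [eventually_nhdsWithin_iff.1 ((hg x hx).eventually (gt_mem_nhds hc))]
        with y hy
      simp only [hu]; split_ifs with h
      · exact ((abs_le.1 (hM x hx)).1).trans_lt hc
      · exact hy h
  · rw [abs_le]
    refine ⟨hge x, ?_⟩
    simp only [hu]; split_ifs with h
    · linarith
    · exact (abs_le.1 (hM x h)).2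
  · intro x₀ hx₀ φ r hφ h0 hle z δ hδ hz hr
    have hux : u x₀ = -M := if_pos hx₀
    refine integral_nonneg_of_ae ?_
    filter_upwards [ae_kap_pos s] with t ht
    unfold opaFun
    simp only [Pi.zero_apply]
    split_ifs with htδ
    · obtain ⟨h1, h2⟩ := add_smul_mem_ball (x := x₀) hz ht (htδ.trans_le hr)
      unfold sd
      linarith [hle _ h1, hle _ h2, hge (x₀ + t • z), hge (x₀ - t • z)]
    · linarith [hge (x₀ + t • z), hge (x₀ - t • z)]

lemma bddAbove_perronClass (s : ℝ) (Ω : Set E) (g : E → ℝ) (M : ℝ) (x : E) :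
    BddAbove ((fun u : E → ℝ => u x) '' perronClass s Ω g M) := by
  refine ⟨M, ?_⟩
  rintro _ ⟨u, hu, rfl⟩
  exact (abs_le.1 (hu.2.1 x)).2

lemma le_perronSol {s : ℝ} {Ω : Set E} {g : E → ℝ} {M : ℝ} {u : E → ℝ}
    (hu : u ∈ perronClass s Ω g M) (x : E) : u x ≤ perronSol s Ω g M x :=
  le_csSup (bddAbove_perronClass s Ω g M x) ⟨u, hu, rfl⟩

lemma exists_lt_of_lt_perronSol {s : ℝ} {Ω : Set E} {g : E → ℝ} {M : ℝ}
    (hne : (perronClass s Ω g M).Nonempty) {x : E} {c : ℝ} (h : c < perronSol s Ω g M x) :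
    ∃ u ∈ perronClass s Ω g M, c < u x := by
  obtain ⟨_, ⟨u, hu, rfl⟩, hlt⟩ := exists_lt_of_lt_csSup (hne.image _) h
  exact ⟨u, hu, hlt⟩

lemma abs_perronSol_le {s : ℝ} {Ω : Set E} {g : E → ℝ} {M : ℝ}
    (hne : (perronClass s Ω g M).Nonempty) (x : E) : |perronSol s Ω g M x| ≤ M := by
  obtain ⟨u, hu⟩ := hne
  rw [abs_le]
  refine ⟨((abs_le.1 (hu.2.1 x)).1).trans (le_perronSol hu x), csSup_le ⟨_, u, hu, rfl⟩ ?_⟩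
  rintro _ ⟨v, hv, rfl⟩
  exact (abs_le.1 (hv.2.1 x)).2

lemma perronSol_eq {s : ℝ} {Ω : Set E} {g : E → ℝ} {M : ℝ}
    (hne : (perronClass s Ω g M).Nonempty) {x : E} (hx : x ∉ Ω) : perronSol s Ω g M x = g x := by
  have : (fun u : E → ℝ => u x) '' perronClass s Ω g M = {g x} := by
    ext a
    constructor
    · rintro ⟨u, hu, rfl⟩; exact hu.2.2.1 x hx
    · rintro rfl
      obtain ⟨u, hu⟩ := hne
      exact ⟨u, hu, hu.2.2.1 x hx⟩
  rw [perronSol, this, csSup_singleton]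

variable [FiniteDimensional ℝ E]

omit [InnerProductSpace ℝ E] [FiniteDimensional ℝ E] in
/-- At points of `Ω`, and at points of the complement where `g < a`, all nearby points are in
`Ω` or have values of `g` well below `a`. -/
lemma exists_gap {Ω : Set E} (hΩ : IsOpen Ω) {g : E → ℝ} (hg : ContinuousOn g Ωᶜ) {x₀ : E} {a : ℝ}
    (hx₀ : x₀ ∈ Ω ∨ x₀ ∈ frontier Ω ∧ g x₀ < a) :
    ∃ η : ℝ, 0 < η ∧ ∀ᶠ x in 𝓝 x₀, x ∉ Ω → g x < a - η := by
  rcases hx₀ with h | ⟨h, hlt⟩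
  · exact ⟨1, one_pos, by filter_upwards [hΩ.mem_nhds h] with x hx hx' using absurd hx hx'⟩
  · rw [hΩ.frontier_eq] at h
    refine ⟨(a - g x₀) / 2, by linarith, ?_⟩
    exact eventually_nhdsWithin_iff.1 ((hg x₀ h.2).eventually (gt_mem_nhds (by linarith)))

/-- Stability under suprema: a member nearly attaining the supremum is touched near `x₀` by a
translate of `φ`, at a point where the operator is still negative. The gap between `g` and the
envelope forces that point into `Ω`, which is why boundary points where the datum is exceeded are
covered. -/
lemma testSub_upperEnv_perronSol {s : ℝ} (hs₀ : 0 < s) (hs₁ : s < 1) {Ω : Set E} (hΩ : IsOpen Ω)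
    {g : E → ℝ} (hg : ContinuousOn g Ωᶜ) {M : ℝ} (hne : (perronClass s Ω g M).Nonempty) :
    TestSub s {x | x ∈ Ω ∨ x ∈ frontier Ω ∧ g x < upperEnv (perronSol s Ω g M) x}
      (upperEnv (perronSol s Ω g M)) := by
  set W := perronSol s Ω g M with hW
  have hWb : ∀ x, |W x| ≤ M := abs_perronSol_le hne
  set U := upperEnv W with hUdef
  have hUusc : UpperSemicontinuous U := upperEnv_upperSemicontinuous hWb
  have hUb : ∃ M : ℝ, ∀ x, |U x| ≤ M :=
    ⟨M, fun x => abs_upperEnv_le (Eventually.of_forall hWb)⟩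
  have hWU : ∀ x, W x ≤ U x := fun x => le_upperEnv (Eventually.of_forall hWb)
  refine testSub_of_strict hs₀ hs₁ hUusc hUb
    fun x₀ hx₀ φ z r γ δ ρ hφ h0 hγ hle hδ hz hr hρ hneg => ?_
  obtain ⟨η, hη, hgap⟩ := exists_gap hΩ hg hx₀
  set κ := min (ρ / 2) (η / 2) with hκ
  have hκ0 : 0 < κ := lt_min (half_pos hρ) (half_pos hη)
  have hκ1 : κ ≤ ρ / 2 := min_le_left _ _
  have hκ2 : κ ≤ η / 2 := min_le_right _ _
  have hφx : ∀ᶠ x in 𝓝 x₀, φ x₀ - κ < φ x :=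
    hφ.continuous.continuousAt.eventually (lt_mem_nhds (by linarith))
  obtain ⟨ρ', hρ', hball⟩ := Metric.eventually_nhds_iff_ball.1 (hgap.and hφx)
  set ρ₁ := min (min ρ ρ') (δ / 2) with hρ₁
  have hρ₁0 : 0 < ρ₁ := lt_min (lt_min hρ hρ') (half_pos hδ)
  set e := min κ (γ * ρ₁ ^ 2) with he
  have he0 : 0 < e := lt_min hκ0 (by positivity)
  have hfreq := frequently_lt_of_lt_upperEnv (x := x₀) (c := U x₀ - e / 4)
    (Eventually.of_forall hWb) (by linarith)
  have hev : ∀ᶠ x in 𝓝 x₀, φ x < φ x₀ + e / 4 ∧ x ∈ Metric.closedBall x₀ (3 * δ / 2) :=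
    (hφ.continuous.continuousAt.eventually (gt_mem_nhds (by linarith))).and
      (Metric.closedBall_mem_nhds x₀ (by positivity))
  obtain ⟨x₁, hx₁, hx₁φ, hx₁b⟩ := (hfreq.and_eventually hev).exists
  obtain ⟨u, hu, hux₁⟩ := exists_lt_of_lt_perronSol hne
    (show W x₁ - e / 4 < W x₁ by linarith)
  obtain ⟨huusc, hub, hug, huT⟩ := id hu
  have huU : ∀ x, u x ≤ U x := fun x => (le_perronSol hu x).trans (hWU x)
  -- The maximiser turns out to lie within `δ / 2` of `x₀`, so radius `3 * δ / 2` leaves a `δ`-ball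
  -- around it; `2 * δ ≤ r` keeps the region inside the touching ball.
  obtain ⟨y, hyb, hmax⟩ := UpperSemicontinuousOn.exists_isMaxOn
    (f := fun x => u x + -φ x) (s := Metric.closedBall x₀ (3 * δ / 2)) ⟨x₁, hx₁b⟩
    (isCompact_closedBall _ _)
    ((huusc.add hφ.continuous.neg.upperSemicontinuous).upperSemicontinuousOn _)
  have hy1 := hmax hx₁b
  simp only [mem_ofPred_eq] at hy1
  have hyr : y ∈ Metric.ball x₀ r := by
    rw [Metric.mem_closedBall] at hyb; rw [Metric.mem_ball]; linarith
  have hy2 := hle y hyr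
  have hy3 := huU y
  have hynear : ‖y - x₀‖ < ρ₁ := by
    have h1 : γ * ‖y - x₀‖ ^ 2 < γ * ρ₁ ^ 2 := by
      have := min_le_right κ (γ * ρ₁ ^ 2)
      linarith
    exact lt_of_pow_lt_pow_left₀ 2 hρ₁0.le (lt_of_mul_lt_mul_left h1 hγ.le)
  have hyρ : ‖y - x₀‖ < ρ := hynear.trans_le ((min_le_left _ _).trans (min_le_left _ _))
  have hyρ' : ‖y - x₀‖ < ρ' := hynear.trans_le ((min_le_left _ _).trans (min_le_right _ _))
  have hyδ : ‖y - x₀‖ < δ / 2 := hynear.trans_le (min_le_right _ _)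
  obtain ⟨hyg, hyφ⟩ := hball y (mem_ball_iff_norm.2 hyρ')
  have hyu : U x₀ - 2 * κ < u y := by
    have := min_le_left κ (γ * ρ₁ ^ 2)
    linarith
  have hyΩ : y ∈ Ω := by
    by_contra h
    have := hyg h
    rw [← hug y h] at this
    linarith
  have htest := huT y hyΩ (fun x => φ x + (u y - φ y)) δ (hφ.add contDiff_const) (by ring)
    (fun x hx => by
      have : x ∈ Metric.closedBall x₀ (3 * δ / 2) := by
        rw [mem_ball_iff_norm] at hx
        rw [mem_closedBall_iff_norm]
        have := norm_add_le (x - y) (y - x₀)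
        rw [sub_add_sub_cancel] at this
        linarith
      have := hmax this
      simp only [mem_ofPred_eq] at this
      linarith) z δ hδ (by rw [hz, mul_one])
  rw [opa_add_const] at htest
  -- The central value stays `u y` while `u` is raised to `U` elsewhere. Monotonicity needs this,
  -- hence the separate central value in `opa`.
  have hcmp : opa s δ φ u y z (u y) ≤ opa s δ φ U y z (u y) :=
    opa_mono hs₀ hs₁ hδ hδ hφ hφ (huusc.lineBounded ⟨M, hub⟩) (hUusc.lineBounded hUb)
      fun t _ => by
        unfold opaFun
        split_ifs
        · exact le_rfl
        · linarith [huU (y + t • z), huU (y - t • z)]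
  have := hneg y (mem_ball_iff_norm.2 hyρ) (u y) (by linarith)
  linarith

/-- Shrinking the region where the function touching from below is used raises the operator. -/
lemma opa_le_opa_of_ge {s : ℝ} (hs₀ : 0 < s) (hs₁ : s < 1) {δ δ' r : ℝ} (hδ' : 0 < δ')
    (hδδ' : δ' ≤ δ) {φ u : E → ℝ} (hφ : ContDiff ℝ 2 φ) (hu : LineBounded u) {x z : E}
    (hx : φ x = u x) (hr : δ * ‖z‖ ≤ r) (hle : ∀ y ∈ Metric.ball x r, φ y ≤ u y) :
    opa s δ φ u x z (u x) ≤ opa s δ' φ u x z (u x) := by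
  have := opa_le_opa_of_le hs₀ hs₁ hδ' hδδ' hφ.neg hu.neg (x := x) (z := z) (by simp [hx]) hr
    (fun y hy => by simpa using hle y hy)
  have e : (-u) x = -u x := rfl
  rw [e, show (fun x => -φ x) = -φ from rfl, opa_neg, opa_neg] at this
  linarith

/-- Perron's bump: if the test fails, every directional operator of `φ` at `x₀` is at least some `c
> 0`. Then `W` can be replaced near `x₀` by its maximum with `φ - γ ‖· - x₀‖² + κ` without leaving
the class, against maximality. -/
lemma testSuper_lowerEnv_of_maximal [Nontrivial E] {s : ℝ} (hs₀ : 0 < s) (hs₁ : s < 1) {Ω : Set E}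
    (hΩ : IsOpen Ω) {g : E → ℝ} (hg : ContinuousOn g Ωᶜ) {M : ℝ} {W : E → ℝ}
    (hW : W ∈ perronClass s Ω g M) (hmaxl : ∀ u ∈ perronClass s Ω g M, ∀ x, u x ≤ W x) :
    TestSuper s {x | x ∈ Ω ∨ x ∈ frontier Ω ∧ lowerEnv W x < g x} (lowerEnv W) := by
  classical
  obtain ⟨hWusc, hWb, hWg, hWT⟩ := id hW
  set V := lowerEnv W with hV
  have hVlsc : LowerSemicontinuous V := lowerEnv_lowerSemicontinuous hWb
  have hVb : ∀ x, |V x| ≤ M := abs_lowerEnv_le hWb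
  have hVL := hVlsc.lineBounded ⟨M, hVb⟩
  have hWL := hWusc.lineBounded ⟨M, hWb⟩
  have hVW : ∀ x, V x ≤ W x := lowerEnv_le hWb
  intro x₀ hx₀ φ r hφ h0 hle δ hδ hδr c hc
  by_contra! hcon
  -- The bump must respect the bound `M`. If `V x₀` equalled `M`, it would be a global maximum and
  -- the operators could not be positive.
  have hVM : V x₀ < M := by
    by_contra! h
    obtain ⟨z, hz⟩ := exists_norm_eq E zero_le_one
    have h1 := hcon z hz
    have h2 : opa s δ φ V x₀ z (V x₀) ≤ 0 := by
      refine integral_nonpos_of_ae ?_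
      filter_upwards [ae_kap_pos s] with t ht
      unfold opaFun
      simp only [Pi.zero_apply]
      have e1 := (abs_le.1 (hVb (x₀ + t • z))).2
      have e2 := (abs_le.1 (hVb (x₀ - t • z))).2
      split_ifs with htδ
      · obtain ⟨h3, h4⟩ := add_smul_mem_ball (x := x₀) hz ht (htδ.trans_le hδr)
        unfold sd
        linarith [hle _ h3, hle _ h4]
      · linarith
    linarith
  obtain ⟨γ, hγ, hγ'⟩ := exists_rpow_mul_lt (s := s) (δ := δ) hc 2
  set φ' : E → ℝ := fun y => φ y + -γ * ‖y - x₀‖ ^ 2 with hφ'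
  have hφ'C : ContDiff ℝ 2 φ' := hφ.add (contDiff_const.mul (contDiff_norm_sub_sq x₀))
  have hφ'0 : φ' x₀ = V x₀ := by simp [hφ', h0]
  have hφ'φ : ∀ y, φ' y ≤ φ y := fun y => by
    have : 0 ≤ γ * ‖y - x₀‖ ^ 2 := by positivity
    simp only [hφ']; linarith
  have hpos : ∀ z : E, ‖z‖ = 1 → 0 < opa s δ φ' V x₀ z (V x₀) := fun z hz => by
    rw [hφ', opa_add_sq hs₀ hs₁ hδ hφ hVL, hz]
    have := hcon z hz
    linarith
  obtain ⟨r', κ₁, hr'0, hr'δ, hκ₁, hr'⟩ : ∃ r' κ₁ : ℝ, 0 < r' ∧ r' ≤ δ ∧ 0 < κ₁ ∧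
      ∀ x ∈ Metric.ball x₀ r', φ x + κ₁ ≤ M ∧ (x ∉ Ω → φ x + κ₁ ≤ g x) := by
    obtain ⟨η, hη, hgap⟩ := exists_gap hΩ hg.neg (a := -V x₀)
      (hx₀.imp id fun h => ⟨h.1, neg_lt_neg h.2⟩)
    set κ₁ := min (η / 2) ((M - V x₀) / 2) with hκ₁
    have hk1 : κ₁ ≤ η / 2 := min_le_left _ _
    have hk2 : κ₁ ≤ (M - V x₀) / 2 := min_le_right _ _
    have hk0 : 0 < κ₁ := lt_min (by linarith) (by linarith)
    have hφx : ∀ᶠ x in 𝓝 x₀, φ x < φ x₀ + κ₁ :=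
      hφ.continuous.continuousAt.eventually (gt_mem_nhds (by linarith))
    obtain ⟨ε, hε, hball⟩ := Metric.eventually_nhds_iff_ball.1 (hgap.and hφx)
    refine ⟨min ε δ, κ₁, lt_min hε hδ, min_le_right _ _, hk0, fun x hx => ?_⟩
    obtain ⟨h1, h2⟩ := hball x (Metric.ball_subset_ball (min_le_left _ _) hx)
    refine ⟨by linarith, fun hxΩ => ?_⟩
    have := h1 hxΩ
    rw [Pi.neg_apply] at this
    linarith
  have hr2 : 0 < r' / 2 := half_pos hr'0
  have hpos' : ∀ z : E, ‖z‖ = 1 → 0 < opa s (r' / 2) φ' V x₀ z (V x₀) := fun z hz =>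
    (hpos z hz).trans_le (opa_le_opa_of_ge hs₀ hs₁ hr2 (by linarith) hφ'C hVL hφ'0
      (by rwa [hz, mul_one]) fun y hy => (hφ'φ y).trans (hle y hy))
  obtain ⟨ρ, hρ, hρpos⟩ : ∃ ρ : ℝ, 0 < ρ ∧ ∀ x a, ‖x - x₀‖ < ρ → a < V x₀ + ρ →
      ∀ z : E, ‖z‖ = 1 → 0 < opa s (r' / 2) φ' V x z a := by
    -- Compactness of the unit sphere makes the neighbourhood independent of the direction.
    have key : ∀ᶠ q : E × ℝ in 𝓝 (x₀, V x₀), ∀ z ∈ Metric.sphere (0 : E) 1,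
        0 < opa s (r' / 2) φ' V q.1 z q.2 := by
      refine (isCompact_sphere (0 : E) 1).eventually_forall_of_forall_eventually fun z hz => ?_
      have hz' : ‖z‖ = 1 := by simpa using hz
      have h1 : opa s (r' / 2) (-φ') (-V) x₀ z (-V x₀) < 0 := by
        rw [opa_neg]; linarith [hpos' z hz']
      have h2 := eventually_opa_lt hs₀ hs₁ hr2 hφ'C.neg hVlsc.neg_upper
        ⟨M, abs_neg_apply_le hVb⟩ h1
      have hc : Tendsto (fun q : (E × ℝ) × E => ((q.1.1, q.2, -q.1.2) : E × E × ℝ))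
          (𝓝 ((x₀, V x₀), z)) (𝓝 (x₀, z, -V x₀)) := by
        have : Continuous fun q : (E × ℝ) × E => ((q.1.1, q.2, -q.1.2) : E × E × ℝ) := by
          fun_prop
        exact this.tendsto ((x₀, V x₀), z)
      filter_upwards [hc.eventually h2] with q hq
      have e := opa_neg s (r' / 2) φ' V q.1.1 q.2 q.1.2
      change opa s (r' / 2) (-φ') (-V) q.1.1 q.2 (-q.1.2) < 0 at hq
      linarith
    obtain ⟨ρ, hρ, h⟩ := Metric.eventually_nhds_iff.1 key
    refine ⟨ρ / 2, half_pos hρ, fun x a hx ha z hz => ?_⟩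
    have h1 := h (y := (x, V x₀ + ρ / 2)) (by
      rw [Prod.dist_eq, dist_eq_norm, Real.dist_eq, add_sub_cancel_left,
        abs_of_pos (half_pos hρ)]
      exact max_lt (by linarith) (by linarith)) z (by simpa using hz)
    exact h1.trans_le (opa_antitone hs₀ hs₁ hr2 hφ'C hVL x z ha.le)
  obtain ⟨ρ₁, hρ₁, hρ₁ρ, hρ₁φ⟩ : ∃ ρ₁ : ℝ, 0 < ρ₁ ∧ ρ₁ ≤ ρ ∧
      ∀ x, ‖x - x₀‖ < ρ₁ → φ x < V x₀ + ρ / 2 := by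
    have : ∀ᶠ x in 𝓝 x₀, φ x < V x₀ + ρ / 2 :=
      hφ.continuous.continuousAt.eventually (gt_mem_nhds (by linarith))
    obtain ⟨ε, hε, hball⟩ := Metric.eventually_nhds_iff_ball.1 this
    exact ⟨min ε ρ, lt_min hε hρ, min_le_right _ _, fun x hx =>
      hball x (mem_ball_iff_norm.2 (hx.trans_le (min_le_left _ _)))⟩
  set m := min (r' / 2) ρ₁ with hm
  have hm0 : 0 < m := lt_min hr2 hρ₁
  -- Since `φ ≤ V ≤ W` near `x₀`, the condition `κ ≤ γ * m ^ 2` confines the set where the bump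
  -- exceeds `W` to distance less than `m`. The other bounds keep the bump below `M`, below `g` off
  -- `Ω`, and in the range where the operator is positive.
  set κ := min (min κ₁ (ρ / 2)) (γ * m ^ 2) with hκ
  have hκ0 : 0 < κ := lt_min (lt_min hκ₁ (half_pos hρ)) (by positivity)
  have hκ1 : κ ≤ κ₁ := (min_le_left _ _).trans (min_le_left _ _)
  have hκ2 : κ ≤ ρ / 2 := (min_le_left _ _).trans (min_le_right _ _)
  have hκ3 : κ ≤ γ * m ^ 2 := min_le_right _ _
  set P : E → ℝ := fun y => φ' y + κ with hP
  have hPC : Continuous P := hφ'C.continuous.add continuous_const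
  have hPnear : ∀ y ∈ Metric.ball x₀ r', W y < P y → ‖y - x₀‖ < m := fun y hy hlt => by
    have h1 : φ y ≤ W y := (hle y (Metric.ball_subset_ball (hr'δ.trans hδr) hy)).trans (hVW y)
    simp only [hP, hφ'] at hlt
    have h2 : γ * ‖y - x₀‖ ^ 2 < γ * m ^ 2 := by linarith
    exact lt_of_pow_lt_pow_left₀ 2 hm0.le (lt_of_mul_lt_mul_left h2 hγ.le)
  set W' : E → ℝ := fun y => if y ∈ Metric.ball x₀ r' then max (W y) (P y) else W y with hW'
  have hWW' : ∀ y, W y ≤ W' y := fun y => by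
    simp only [hW']; split_ifs
    · exact le_max_left _ _
    · exact le_rfl
  have hPW' : ∀ y ∈ Metric.ball x₀ r', P y ≤ W' y := fun y hy => by
    simp only [hW', if_pos hy]; exact le_max_right _ _
  have hW'cases : ∀ y, W' y = W y ∨ (W' y = P y ∧ y ∈ Metric.ball x₀ r' ∧ W y < P y) := fun y => by
    by_cases hy : y ∈ Metric.ball x₀ r'
    · rcases le_or_gt (P y) (W y) with h | h
      · left; simp only [hW', if_pos hy, max_eq_left h]
      · right; exact ⟨by simp only [hW', if_pos hy, max_eq_right h.le], hy, h⟩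
    · left; simp only [hW', if_neg hy]
  have hPM : ∀ y ∈ Metric.ball x₀ r', P y ≤ M ∧ (y ∉ Ω → P y ≤ g y) := fun y hy => by
    obtain ⟨h1, h2⟩ := hr' y hy
    have h3 := hφ'φ y
    exact ⟨by simp only [hP]; linarith, fun h => by have := h2 h; simp only [hP]; linarith⟩
  have hW'b : ∀ y, |W' y| ≤ M := fun y => by
    rw [abs_le]
    refine ⟨(abs_le.1 (hWb y)).1.trans (hWW' y), ?_⟩
    rcases hW'cases y with h | ⟨h, hy, -⟩ <;> rw [h]
    · exact (abs_le.1 (hWb y)).2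
    · exact (hPM y hy).1
  have hW'usc : UpperSemicontinuous W' := by
    intro y b hb
    by_cases hy : y ∈ Metric.ball x₀ r'
    · have h1 : UpperSemicontinuous fun y => max (W y) (P y) := hWusc.sup hPC.upperSemicontinuous
      simp only [hW', if_pos hy] at hb
      filter_upwards [h1 y b hb, Metric.isOpen_ball.mem_nhds hy] with x hx hx'
      simp only [hW', if_pos hx']; exact hx
    · simp only [hW', if_neg hy] at hb
      have hfar : ∀ᶠ x in 𝓝 y, m < ‖x - x₀‖ := by
        have hc : Continuous fun x : E => ‖x - x₀‖ := by fun_prop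
        refine hc.continuousAt.eventually (lt_mem_nhds ?_)
        rw [mem_ball_iff_norm, not_lt] at hy
        have := min_le_left (r' / 2) ρ₁
        linarith
      filter_upwards [hWusc y b hb, hfar] with x hx hx'
      rcases hW'cases x with h | ⟨h, hxb, hlt⟩
      · rwa [h]
      · exact absurd (hPnear x hxb hlt) (not_lt.2 hx'.le)
  have hW'L := hW'usc.lineBounded ⟨M, hW'b⟩
  have hW'g : ∀ y ∉ Ω, W' y = g y := fun y hy => by
    rcases hW'cases y with h | ⟨h, hyb, hlt⟩
    · rw [h, hWg y hy]
    · rw [hWg y hy] at hlt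
      exact absurd hlt (not_lt.2 ((hPM y hyb).2 hy))
  have hW'T : TestSub s Ω W' := by
    refine testSub_of_unit fun y hy ψ r₁ hψ hψ0 hψle z δ₁ hδ₁ hz hδ₁r => ?_
    rcases hW'cases y with h | ⟨h, hyb, hlt⟩
    · have h1 := hWT y hy ψ r₁ hψ (hψ0.trans h) (fun x hx => (hWW' x).trans (hψle x hx)) z δ₁ hδ₁
        (by rwa [hz, mul_one])
      rw [h]
      refine h1.trans (opa_mono hs₀ hs₁ hδ₁ hδ₁ hψ hψ hWL hW'L fun t _ => ?_)
      unfold opaFun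
      split_ifs
      · exact le_rfl
      · linarith [hWW' (y + t • z), hWW' (y - t • z)]
    · have hym := hPnear y hyb hlt
      have hyr : ‖y - x₀‖ < r' / 2 := hym.trans_le (min_le_left _ _)
      have hyρ : ‖y - x₀‖ < ρ₁ := hym.trans_le (min_le_right _ _)
      have hPy : P y < V x₀ + ρ := by
        have h1 := hρ₁φ y hyρ
        have h2 := hφ'φ y
        simp only [hP]; linarith
      -- Where `W'` equals the bump, the operator built from `φ'` at short range and `V` at long
      -- range is positive; both lie below what `W'` and `ψ` provide, with the same central value.
      refine (hρpos y (P y) (hyρ.trans_le hρ₁ρ) hPy z hz).le.trans ?_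
      rw [h]
      refine opa_mono hs₀ hs₁ hr2 hδ₁ hφ'C hψ hVL hW'L fun t ht => ?_
      obtain ⟨n1, n2⟩ := norm_add_smul_sub (x := y) hz ht
      have hin : t < r' / 2 → P (y + t • z) ≤ W' (y + t • z) ∧ P (y - t • z) ≤ W' (y - t • z) :=
        fun htr => by
          refine ⟨hPW' _ ?_, hPW' _ ?_⟩ <;> rw [mem_ball_iff_norm]
          · have := norm_add_le (y + t • z - y) (y - x₀)
            rw [sub_add_sub_cancel] at this; linarith
          · have := norm_add_le (y - t • z - y) (y - x₀)
            rw [sub_add_sub_cancel] at this; linarith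
      have hψin : t < δ₁ → W' (y + t • z) ≤ ψ (y + t • z) ∧ W' (y - t • z) ≤ ψ (y - t • z) :=
        fun htd => by
          obtain ⟨h3, h4⟩ := add_smul_mem_ball (x := y) hz ht (htd.trans_le hδ₁r)
          exact ⟨hψle _ h3, hψle _ h4⟩
      have hv1 := (hVW (y + t • z)).trans (hWW' _)
      have hv2 := (hVW (y - t • z)).trans (hWW' _)
      have hPe : ∀ x, P x = φ' x + κ := fun x => rfl
      rw [h] at hψ0
      unfold opaFun sd
      split_ifs with h1 h2 h2
      · linarith [hin h1, hψin h2, hPe (y + t • z), hPe (y - t • z), hPe y]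
      · linarith [hin h1, hPe (y + t • z), hPe (y - t • z), hPe y]
      · linarith [hψin h2]
      · linarith
  have hfin := hmaxl W' ⟨hW'usc, hW'b, hW'g, hW'T⟩
  have hPx₀ : P x₀ = V x₀ + κ := by simp only [hP, hφ'0]
  have : V x₀ + κ / 2 ≤ V x₀ := by
    refine le_lowerEnv hWb ?_
    filter_upwards [
      hPC.continuousAt.eventually (lt_mem_nhds (show V x₀ + κ / 2 < P x₀ by linarith)),
      Metric.ball_mem_nhds x₀ hr'0] with y h1 h2
    exact h1.le.trans ((hPW' y h2).trans (hfin y))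
  linarith

/-- Existence of a continuous solution of the Dirichlet problem in a strictly convex domain. -/
theorem exists_solution [Nontrivial E] {s : ℝ} (hs₀ : 0 < s) (hs₁ : s < 1) {Ω : Set E}
    (hΩ : IsStrictDomain Ω) {g : E → ℝ} (hg : ContinuousOn g Ωᶜ)
    (hgb : ∃ M : ℝ, ∀ x ∈ Ωᶜ, |g x| ≤ M) :
    ∃ W : E → ℝ, Continuous W ∧ (∃ M : ℝ, ∀ x, |W x| ≤ M) ∧ (∀ x ∉ Ω, W x = g x) ∧
      TestSub s Ω W ∧ TestSuper s Ω W := by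
  obtain ⟨M, hM0, hM⟩ : ∃ M : ℝ, 0 ≤ M ∧ ∀ x ∈ Ωᶜ, |g x| ≤ M := by
    obtain ⟨M, hM⟩ := hgb
    exact ⟨max M 0, le_max_right _ _, fun x hx => (hM x hx).trans (le_max_left _ _)⟩
  have hne := perronClass_nonempty s hΩ.isOpen hg hM hM0
  set W := perronSol s Ω g M with hW
  have hWb : ∀ x, |W x| ≤ M := abs_perronSol_le hne
  have hWg : ∀ x ∉ Ω, W x = g x := fun x hx => perronSol_eq hne hx
  have hUusc : UpperSemicontinuous (upperEnv W) := upperEnv_upperSemicontinuous hWb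
  have hUb : ∀ x, |upperEnv W x| ≤ M := fun x => abs_upperEnv_le (Eventually.of_forall hWb)
  have hcont : ∀ x ∉ closure Ω, ContinuousAt W x := fun x hx => by
    have hx' : (closure Ω)ᶜ ∈ 𝓝 x := isClosed_closure.isOpen_compl.mem_nhds hx
    have hsub : (closure Ω)ᶜ ⊆ Ωᶜ := compl_subset_compl.2 subset_closure
    have h1 : ContinuousAt g x := hg.continuousAt (mem_of_superset hx' hsub)
    refine h1.congr ?_
    filter_upwards [hx'] with y hy using (hWg y (hsub hy)).symm
  have hWU : ∀ x, W x ≤ upperEnv W x := fun x => le_upperEnv (Eventually.of_forall hWb)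
  have hUT := testSub_upperEnv_perronSol hs₀ hs₁ hΩ.isOpen hg hne
  have hUcl : ∀ x ∉ closure Ω, upperEnv W x = g x := fun x hx => by
    rw [upperEnv_of_continuousAt (hcont x hx), hWg x fun h => hx (subset_closure h)]
  have hUfr := hUT.le_datum hs₀ hs₁ hΩ hg hUusc ⟨M, hUb⟩ fun x hx => (hUcl x hx).le
  -- The boundary inequality shows that the upper envelope still takes the values `g` off `Ω`. It
  -- therefore belongs to the class and coincides with the supremum.
  have hUclass : upperEnv W ∈ perronClass s Ω g M := by
    refine ⟨hUusc, hUb, fun x hx => ?_, hUT.mono fun x hx => Or.inl hx⟩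
    by_cases h : x ∈ closure Ω
    · refine le_antisymm (hUfr x ?_) ((hWg x hx).symm.le.trans (hWU x))
      rw [hΩ.isOpen.frontier_eq]; exact ⟨h, hx⟩
    · exact hUcl x h
  have hUW : upperEnv W = W := funext fun x => le_antisymm (le_perronSol hUclass x) (hWU x)
  rw [hUW] at hUclass
  obtain ⟨hWusc, -, -, hWT⟩ := id hUclass
  have hVT := testSuper_lowerEnv_of_maximal hs₀ hs₁ hΩ.isOpen hg hUclass
    fun u hu x => le_perronSol hu x
  have hVlsc : LowerSemicontinuous (lowerEnv W) := lowerEnv_lowerSemicontinuous hWb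
  have hVb : ∀ x, |lowerEnv W x| ≤ M := abs_lowerEnv_le hWb
  have hVcl : ∀ x ∉ closure Ω, lowerEnv W x = g x := fun x hx => by
    rw [lowerEnv_of_continuousAt (hcont x hx), hWg x fun h => hx (subset_closure h)]
  have hVfr := hVT.datum_le hs₀ hs₁ hΩ hg hVlsc ⟨M, hVb⟩ fun x hx => (hVcl x hx).ge
  -- With the identity map, comparison bounds `W` by its own lower envelope, which is continuity.
  have hcmp := comparison hs₀ hs₁ hΩ.isOpen hΩ.isOpen hΩ.bounded hWusc ⟨M, hWb⟩ hVlsc ⟨M, hVb⟩ 0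
    (ContinuousLinearMap.id ℝ E) (by simp) hWT (hVT.mono fun x hx => Or.inl hx) (fun x hx => by
      simp only [zero_add, ContinuousLinearMap.id_apply]
      rw [hWg x hx]
      by_cases h : x ∈ closure Ω
      · exact hVfr x (by rw [hΩ.isOpen.frontier_eq]; exact ⟨h, hx⟩)
      · exact (hVcl x h).ge)
  simp only [zero_add, ContinuousLinearMap.id_apply] at hcmp
  have hVW : lowerEnv W = W := funext fun x => le_antisymm (lowerEnv_le hWb x) (hcmp x)
  rw [hVW] at hVlsc hVT
  exact ⟨W, continuous_iff_lower_upperSemicontinuous.2 ⟨hVlsc, hWusc⟩, ⟨M, hWb⟩, hWg, hWT,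
    hVT.mono fun x hx => Or.inl hx⟩

end Perron

/-! ### The one-dimensional Dirichlet problem -/

section OneDim

lemma fracLap_eq_integral (s : ℝ) (ψ : ℝ → ℝ) (t₀ : ℝ) :
    fracLap s ψ t₀ = ∫ t, sd ψ t₀ 1 t ∂kap s := by
  rw [integral_kap]; simp [fracLap, sd]

lemma fracLap_eq_opa {s r t₀ : ℝ} {φ ψ : ℝ → ℝ} (hr : 0 < r)
    (h : ∀ t ∈ Ioo (t₀ - r) (t₀ + r), ψ t = φ t) :
    fracLap s ψ t₀ = opa s r φ ψ t₀ 1 (φ t₀) := by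
  rw [fracLap_eq_integral, opa]
  refine integral_congr_ae ?_
  filter_upwards [ae_kap_pos s] with t ht
  have h0 := h t₀ ⟨by linarith, by linarith⟩
  unfold opaFun sd
  simp only [smul_eq_mul, mul_one]
  split_ifs with htr
  · rw [h (t₀ + t) ⟨by linarith, by linarith⟩, h (t₀ - t) ⟨by linarith, by linarith⟩, h0]
  · rw [h0]

lemma _root_.Measurable.lineBounded {ψ : ℝ → ℝ} (hψ : Measurable ψ)
    (hb : ∃ M : ℝ, ∀ x, |ψ x| ≤ M) : LineBounded ψ where
  bounded := hb
  meas x z := hψ.comp (by fun_prop)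

lemma exists_bound_piecewise_Ioo {φ v : ℝ → ℝ} (hφ : Continuous φ) {a b M : ℝ}
    (hv : ∀ t, |v t| ≤ M) [∀ t, Decidable (t ∈ Ioo a b)] :
    ∃ M : ℝ, ∀ t, |(Ioo a b).piecewise φ v t| ≤ M := by
  obtain ⟨C, hC⟩ := (isCompact_Icc (a := a) (b := b)).exists_bound_of_continuousOn hφ.continuousOn
  refine ⟨max C M, fun t => ?_⟩
  by_cases ht : t ∈ Ioo a b
  · rw [piecewise_eq_of_mem _ _ _ ht]
    exact (hC t (Ioo_subset_Icc_self ht)).trans (le_max_left _ _)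
  · rw [piecewise_eq_of_notMem _ _ _ ht]
    exact (hv t).trans (le_max_right _ _)

/-- A continuous solution in the sense of directional tests solves the Dirichlet problem. -/
lemma isDirichletSol_of_test {s : ℝ} (hs₀ : 0 < s) (hs₁ : s < 1) {f v : ℝ → ℝ} (hv : Continuous v)
    (hvb : ∃ M : ℝ, ∀ t, |v t| ≤ M) (hvf : ∀ t ∉ Ioo (0 : ℝ) 1, v t = f t)
    (hsub : TestSub s (Ioo 0 1) v) (hsup : TestSuper s (Ioo 0 1) v) : IsDirichletSol s f v := by
  classical
  have hU : upperEnv v = v := funext fun t => upperEnv_of_continuousAt hv.continuousAt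
  have hL : lowerEnv v = v := funext fun t => lowerEnv_of_continuousAt hv.continuousAt
  have hpw : (Ioo (0 : ℝ) 1).piecewise v f = v := by
    ext t
    by_cases ht : t ∈ Ioo (0 : ℝ) 1
    · rw [piecewise_eq_of_mem _ _ _ ht]
    · rw [piecewise_eq_of_notMem _ _ _ ht, hvf t ht]
  obtain ⟨M, hM⟩ := hvb
  have hvL : LineBounded v := hv.measurable.lineBounded ⟨M, hM⟩
  have key : ∀ (a b t₀ : ℝ) (φ : ℝ → ℝ), t₀ ∈ Ioo a b → ContDiff ℝ 2 φ →
      ∃ r, 0 < r ∧ Metric.ball t₀ r ⊆ Ioo a b ∧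
      LineBounded ((Ioo a b).piecewise φ v) ∧
      fracLap s ((Ioo a b).piecewise φ v) t₀
        = opa s r φ ((Ioo a b).piecewise φ v) t₀ 1 (φ t₀) := by
    intro a b t₀ φ ht₀ hφ
    refine ⟨min (t₀ - a) (b - t₀), lt_min (by linarith [ht₀.1]) (by linarith [ht₀.2]), ?_, ?_, ?_⟩
    · rw [Real.ball_eq_Ioo]
      exact Ioo_subset_Ioo (by linarith [min_le_left (t₀ - a) (b - t₀)])
        (by linarith [min_le_right (t₀ - a) (b - t₀)])
    · exact (hφ.continuous.measurable.piecewise measurableSet_Ioo hv.measurable).lineBounded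
        (exists_bound_piecewise_Ioo hφ.continuous hM)
    · refine fracLap_eq_opa (lt_min (by linarith [ht₀.1]) (by linarith [ht₀.2])) fun t ht => ?_
      refine piecewise_eq_of_mem _ _ _ ⟨?_, ?_⟩
      · linarith [ht.1, min_le_left (t₀ - a) (b - t₀)]
      · linarith [ht.2, min_le_right (t₀ - a) (b - t₀)]
  refine ⟨⟨M, fun t _ => hM t⟩, hvf, fun a b t₀ φ hab ht₀ hφ h0 hle => ?_,
    fun a b t₀ φ hab ht₀ hφ h0 hle => ?_⟩
  · rw [hU] at h0 hle ⊢
    rw [hpw]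
    obtain ⟨r, hr, hball, hψL, heq⟩ := key a b t₀ φ ht₀ hφ
    rw [heq]
    refine (hsub t₀ (hab ht₀) φ r hφ h0 (fun t ht => hle t (hball ht)) 1 r hr (by simp)).trans ?_
    refine opa_mono hs₀ hs₁ hr hr hφ hφ hvL hψL fun t _ => ?_
    have hge : ∀ t, v t ≤ (Ioo a b).piecewise φ v t := fun t => by
      by_cases ht : t ∈ Ioo a b
      · rw [piecewise_eq_of_mem _ _ _ ht]; exact hle t ht
      · rw [piecewise_eq_of_notMem _ _ _ ht]
    unfold opaFun
    split_ifs
    · exact le_rfl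
    · linarith [hge (t₀ + t • 1), hge (t₀ - t • 1)]
  · rw [hL] at h0 hle ⊢
    rw [hpw]
    obtain ⟨r, hr, hball, hψL, heq⟩ := key a b t₀ φ ht₀ hφ
    rw [heq]
    have hle' : ∀ t, (Ioo a b).piecewise φ v t ≤ v t := fun t => by
      by_cases ht : t ∈ Ioo a b
      · rw [piecewise_eq_of_mem _ _ _ ht]; exact hle t ht
      · rw [piecewise_eq_of_notMem _ _ _ ht]
    have h1 : opa s r φ ((Ioo a b).piecewise φ v) t₀ 1 (φ t₀) ≤ opa s r φ v t₀ 1 (v t₀) := by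
      refine opa_mono hs₀ hs₁ hr hr hφ hφ hψL hvL fun t _ => ?_
      unfold opaFun
      split_ifs
      · exact le_rfl
      · linarith [hle' (t₀ + t • 1), hle' (t₀ - t • 1)]
    refine h1.trans (le_of_forall_pos_le_add fun c hc => ?_)
    obtain ⟨z, hz, hlt⟩ :=
      hsup t₀ (hab ht₀) φ r hφ h0 (fun t ht => hle t (hball ht)) r hr le_rfl c hc
    rw [zero_add]
    -- On the line the only unit directions are `1` and `-1`, with equal operators, so the test for
    -- the infimum is a test for the operator itself.
    rcases eq_or_eq_neg_of_abs_eq (a := z) (b := 1) (by simpa using hz) with rfl | rfl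
    · exact hlt.le
    · rw [opa_neg_dir] at hlt; exact hlt.le

lemma isStrictDomain_Ioo : IsStrictDomain (Ioo (0 : ℝ) 1) where
  isOpen := isOpen_Ioo
  nonempty := nonempty_Ioo.2 one_pos
  bounded := Metric.isBounded_Ioo 0 1
  convex := convex_Ioo 0 1
  strictConvex := by
    rw [closure_Ioo zero_ne_one]
    exact strictConvex_Icc 0 1

/-- The Dirichlet problem on `(0, 1)` with bounded continuous datum has a continuous solution. -/
lemma exists_dirichlet {s : ℝ} (hs₀ : 0 < s) (hs₁ : s < 1) {f : ℝ → ℝ} (hf : Continuous f)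
    (hfb : ∃ M : ℝ, ∀ t, |f t| ≤ M) :
    ∃ v : ℝ → ℝ, Continuous v ∧ (∃ M : ℝ, ∀ t, |v t| ≤ M) ∧ (∀ t ∉ Ioo (0 : ℝ) 1, v t = f t) ∧
      TestSuper s (Ioo 0 1) v ∧ IsDirichletSol s f v := by
  obtain ⟨v, h1, h2, h3, h4, h5⟩ := exists_solution hs₀ hs₁ isStrictDomain_Ioo hf.continuousOn
    (hfb.imp fun M hM x _ => hM x)
  exact ⟨v, h1, h2, h3, h5, isDirichletSol_of_test hs₀ hs₁ h1 h2 h3 h4 h5⟩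

/-- Shifted tails of functions in the weighted space are integrable for the kernel measure. -/
lemma integrable_tail {s : ℝ} (hs₀ : 0 < s) {f : ℝ → ℝ}
    (hf : Integrable fun r : ℝ => f r / (1 + |r|) ^ (1 + 2 * s)) (c : ℝ) {r : ℝ} (hr : 0 < r) :
    Integrable ((Ici r).indicator fun t => f (c + t)) (kap s) ∧
      Integrable ((Ici r).indicator fun t => f (c - t)) (kap s) := by
  set H : ℝ → ℝ := fun r => f r / (1 + |r|) ^ (1 + 2 * s) with hH
  have hfH : ∀ t, f t = H t * (1 + |t|) ^ (1 + 2 * s) := fun t => by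
    have : 0 < (1 + |t|) ^ (1 + 2 * s) := by positivity
    simp only [hH]; field_simp
  -- Chosen so that `1 + |c| + t ≤ K * t` for `t ≥ r`, which compares the weight of the space with
  -- the kernel.
  set K := (1 + |c|) / r + 1 with hK
  have hK0 : 0 < K := by positivity
  have main : ∀ σ : ℝ → ℝ, (∀ t, 0 < t → |σ t| ≤ |c| + t) → Integrable (fun t => H (σ t)) →
      Continuous σ → Integrable ((Ici r).indicator fun t => f (σ t)) (kap s) := by
    intro σ hσ hint hσc
    rw [integrable_kap_iff]
    have hcont : Continuous fun t => (1 + |σ t|) ^ (1 + 2 * s) :=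
      Continuous.rpow_const (by fun_prop) fun t => Or.inr (by linarith)
    refine Integrable.mono' (g := fun t => K ^ (1 + 2 * s) * |H (σ t)|)
      ((hint.norm.const_mul _).integrableOn) ?_ ?_
    · have h1 : AEStronglyMeasurable (fun t => f (σ t)) volume := by
        simp only [hfH]
        exact hint.aestronglyMeasurable.mul hcont.aestronglyMeasurable
      have h2 : Measurable fun t : ℝ => t ^ (1 + 2 * s) := by fun_prop
      exact ((h1.indicator measurableSet_Ici).restrict.aemeasurable.div
        h2.aemeasurable).aestronglyMeasurable
    · filter_upwards [ae_restrict_mem measurableSet_Ioi] with t (ht : 0 < t)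
      by_cases h : t ∈ Ici r
      · have htr : r ≤ t := h
        rw [indicator_of_mem h, hfH, Real.norm_eq_abs, abs_div, abs_mul,
          abs_of_pos (show 0 < t ^ (1 + 2 * s) by positivity),
          abs_of_pos (show 0 < (1 + |σ t|) ^ (1 + 2 * s) by positivity)]
        have h3 : 1 + |σ t| ≤ K * t := by
          have h4 : 1 + |c| ≤ (1 + |c|) / r * t := by
            rw [div_mul_eq_mul_div, le_div_iff₀ hr]; gcongr
          have := hσ t ht
          rw [hK, add_mul, one_mul]; linarith
        have h5 : (1 + |σ t|) ^ (1 + 2 * s) ≤ K ^ (1 + 2 * s) * t ^ (1 + 2 * s) := by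
          rw [← Real.mul_rpow hK0.le ht.le]
          exact Real.rpow_le_rpow (by positivity) h3 (by linarith)
        rw [div_le_iff₀ (by positivity)]
        calc _ ≤ |H (σ t)| * (K ^ (1 + 2 * s) * t ^ (1 + 2 * s)) := by gcongr
          _ = _ := by ring
      · rw [indicator_of_notMem h, zero_div, norm_zero]; positivity
  refine ⟨main (fun t => c + t) (fun t ht => ?_) (hf.comp_add_left c) (by fun_prop),
    main (fun t => c - t) (fun t ht => ?_) (hf.comp_sub_left c) (by fun_prop)⟩
  · exact (abs_add_le _ _).trans (by rw [abs_of_pos ht])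
  · exact (abs_sub _ _).trans (by rw [abs_of_pos ht])

/-- A nonpositive correction profile at scale `d`, with a small positive part and a fixed negative
part. -/
lemma exists_correction {s : ℝ} (hs₀ : 0 < s) (hs₁ : s < 1) {η b : ℝ} (hη : 0 < η) (hb : 0 < b) :
    ∃ σ : ℝ, 0 < σ ∧ σ ≤ b ∧ ∀ d : ℝ, 0 < d → ∃ K : ℝ → ℝ, Integrable K (kap s) ∧
      ∫ t, K t ∂kap s ≤ 0 ∧ (∀ t, t < d / 4 → K t = 2 * σ / d ^ 2 * t ^ 2) ∧
      (∀ t, d / 4 ≤ t → t < 5 * d / 4 → K t = σ) ∧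
      (∀ t, 5 * d / 4 ≤ t → t < 5 * d / 2 → K t = σ - η / 2) ∧ ∀ t, 5 * d / 2 ≤ t → K t = σ := by
  have h1s : 0 < 2 - 2 * s := by linarith
  -- For `d = 1`, `C₁` is the integral of the positive part per unit of `σ`, and `C₂` is the kernel
  -- mass of the window `[5/4, 5/2)`. Both scale as `d ^ (-(2 * s))`, so `σ` can be fixed before
  -- `d`.
  set C₁ := 2 * ((1 / 4 : ℝ) ^ (2 - 2 * s) / (2 - 2 * s)) + (1 / 4 : ℝ) ^ (-(2 * s)) / (2 * s)
    with hC₁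
  have hC₁0 : 0 < C₁ := by positivity
  set C₂ := (5 / 4 : ℝ) ^ (-(2 * s)) / (2 * s) - (5 / 2 : ℝ) ^ (-(2 * s)) / (2 * s) with hC₂
  have hC₂0 : 0 < C₂ := by
    have : (5 / 2 : ℝ) ^ (-(2 * s)) < (5 / 4 : ℝ) ^ (-(2 * s)) :=
      Real.rpow_lt_rpow_of_neg (by norm_num) (by norm_num) (by linarith)
    rw [hC₂, ← sub_div]
    exact div_pos (by linarith) (by linarith)
  set σ := min b (η * C₂ / (2 * C₁)) with hσ
  have hσ0 : 0 < σ := lt_min hb (by positivity)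
  have hσC : σ * C₁ ≤ η / 2 * C₂ := by
    have : σ ≤ η * C₂ / (2 * C₁) := min_le_right _ _
    rw [le_div_iff₀ (by positivity)] at this
    linarith
  refine ⟨σ, hσ0, min_le_left _ _, fun d hd0 => ?_⟩
  have hd4 : 0 < d / 4 := by linarith
  have hd54 : 0 < 5 * d / 4 := by linarith
  have hd52 : 0 < 5 * d / 2 := by linarith
  obtain ⟨j1, e1⟩ := integrableOn_kap_Iio hs₁ hd4
  obtain ⟨j2, e2⟩ := integrableOn_kap_Ici hs₀ hd4
  obtain ⟨j3, e3⟩ := integrableOn_kap_Ici hs₀ hd54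
  obtain ⟨j4, e4⟩ := integrableOn_kap_Ici hs₀ hd52
  have k12 := (j1.const_mul (2 * σ / d ^ 2)).add (j2.const_mul σ)
  have k34 := (j4.sub j3).const_mul (η / 2)
  refine ⟨fun t => (2 * σ / d ^ 2) * (Iio (d / 4)).indicator (fun t => t ^ 2) t
      + σ * (Ici (d / 4)).indicator (fun _ => (1 : ℝ)) t
      + η / 2 * ((Ici (5 * d / 2)).indicator (fun _ => (1 : ℝ)) t
        - (Ici (5 * d / 4)).indicator (fun _ => (1 : ℝ)) t), ?_, ?_, ?_, ?_, ?_, ?_⟩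
  · exact k12.add k34
  · have a1 := integral_add k12 k34
    simp only [Pi.add_apply, Pi.sub_apply] at a1
    rw [a1, integral_add (j1.const_mul _) (j2.const_mul _), integral_const_mul,
      integral_const_mul, integral_const_mul, integral_sub j4 j3, e1, e2, e3, e4]
    have r1 : (d / 4) ^ (2 - 2 * s) = d ^ 2 * (d ^ (-(2 * s)) * (1 / 4) ^ (2 - 2 * s)) := by
      rw [div_eq_mul_one_div, Real.mul_rpow hd0.le (by norm_num), sub_eq_add_neg,
        Real.rpow_add hd0, Real.rpow_ofNat]
      ring
    have r2 : (d / 4) ^ (-(2 * s)) = d ^ (-(2 * s)) * (1 / 4) ^ (-(2 * s)) := by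
      rw [div_eq_mul_one_div, Real.mul_rpow hd0.le (by norm_num)]
    have r3 : (5 * d / 4) ^ (-(2 * s)) = d ^ (-(2 * s)) * (5 / 4) ^ (-(2 * s)) := by
      rw [show 5 * d / 4 = d * (5 / 4) by ring, Real.mul_rpow hd0.le (by norm_num)]
    have r4 : (5 * d / 2) ^ (-(2 * s)) = d ^ (-(2 * s)) * (5 / 2) ^ (-(2 * s)) := by
      rw [show 5 * d / 2 = d * (5 / 2) by ring, Real.mul_rpow hd0.le (by norm_num)]
    rw [r1, r2, r3, r4]
    have r5 : 2 * σ / d ^ 2 * (d ^ 2 * (d ^ (-(2 * s)) * (1 / 4) ^ (2 - 2 * s)) / (2 - 2 * s))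
        = d ^ (-(2 * s)) * (σ * (2 * ((1 / 4) ^ (2 - 2 * s) / (2 - 2 * s)))) := by
      field_simp
    rw [r5]
    have r6 : 0 ≤ d ^ (-(2 * s)) * (η / 2 * C₂ - σ * C₁) :=
      mul_nonneg (by positivity) (by linarith)
    have r7 : d ^ (-(2 * s)) * (η / 2 * C₂ - σ * C₁)
        = -(d ^ (-(2 * s)) * (σ * (2 * ((1 / 4) ^ (2 - 2 * s) / (2 - 2 * s))))
          + σ * (d ^ (-(2 * s)) * (1 / 4) ^ (-(2 * s)) / (2 * s))
          + η / 2 * (d ^ (-(2 * s)) * (5 / 2) ^ (-(2 * s)) / (2 * s)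
            - d ^ (-(2 * s)) * (5 / 4) ^ (-(2 * s)) / (2 * s))) := by
      rw [hC₁, hC₂]
      generalize (1 / 4 : ℝ) ^ (2 - 2 * s) / (2 - 2 * s) = x₁
      generalize (1 / 4 : ℝ) ^ (-(2 * s)) = x₂
      generalize (5 / 4 : ℝ) ^ (-(2 * s)) = x₃
      generalize (5 / 2 : ℝ) ^ (-(2 * s)) = x₄
      ring
    rw [r7] at r6
    exact neg_nonneg.1 r6
  · intro t ht
    simp only [indicator, mem_Iio, mem_Ici]
    rw [if_pos ht, if_neg (by linarith), if_neg (by linarith), if_neg (by linarith)]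
    ring
  · intro t ht ht'
    simp only [indicator, mem_Iio, mem_Ici]
    rw [if_neg (by linarith), if_pos ht, if_neg (by linarith), if_neg (by linarith)]
    ring
  · intro t ht ht'
    simp only [indicator, mem_Iio, mem_Ici]
    rw [if_neg (by linarith), if_pos (by linarith), if_neg (by linarith), if_pos ht]
    ring
  · intro t ht
    simp only [indicator, mem_Iio, mem_Ici]
    rw [if_neg (by linarith), if_pos (by linarith), if_pos ht, if_pos (by linarith)]
    ring

set_option maxHeartbeats 2000000 in
/-- A Dirichlet solution that comes close to a `C²` function from below, or exceeds it, while the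
datum stays below that function near `(0, 1)`, forces the operator to be nonnegative at some
point. -/
lemma IsDirichletSol.exists_nonneg {s : ℝ} (hs₀ : 0 < s) (hs₁ : s < 1) {f v : ℝ → ℝ}
    (hsol : IsDirichletSol s f v)
    (hf : Integrable fun r : ℝ => f r / (1 + |r|) ^ (1 + 2 * s)) {φ : ℝ → ℝ}
    (hφ : ContDiff ℝ 2 φ) {η e δ : ℝ} (he : 0 < e) (heη : 8 * e ≤ η) (hδ : 5 ≤ δ)
    (hfφ : ∀ t ∉ Ioo (0 : ℝ) 1, -δ < t → t < 1 + δ → f t ≤ φ t - η) {t₁ : ℝ}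
    (ht₁ : t₁ ∈ Ioo (0 : ℝ) 1) (hv : φ t₁ - e ≤ v t₁) :
    ∃ t₀ ∈ Ioo (0 : ℝ) 1, ∀ G : ℝ → ℝ, Integrable G (kap s) →
      (∀ t, 0 < t → opaFun δ φ f t₀ 1 (φ t₀ - 2 * e) t ≤ G t) → 0 ≤ ∫ t, G t ∂kap s := by
  classical
  obtain ⟨M, hM⟩ := hsol.bounded
  have hM0 : 0 ≤ M := (abs_nonneg _).trans (hM t₁ ht₁)
  have hη0 : 0 < η := by linarith
  -- a globally bounded version of `v`
  set v' : ℝ → ℝ := (Ioo (0 : ℝ) 1).indicator v with hv'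
  have hv'b : ∀ t, |v' t| ≤ M := fun t => by
    by_cases ht : t ∈ Ioo (0 : ℝ) 1
    · rw [hv', indicator_of_mem ht]; exact hM t ht
    · rw [hv', indicator_of_notMem ht]; simpa using hM0
  set V := upperEnv v' with hV
  have hVusc : UpperSemicontinuous V := upperEnv_upperSemicontinuous hv'b
  have hVb : ∀ t, |V t| ≤ M := fun t => abs_upperEnv_le (Eventually.of_forall hv'b)
  have hVv : ∀ t ∈ Ioo (0 : ℝ) 1, upperEnv v t = V t := fun t ht => by
    refine limsup_congr ?_
    filter_upwards [isOpen_Ioo.mem_nhds ht] with y hy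
    rw [hv', indicator_of_mem hy]
  have hvV : ∀ t ∈ Ioo (0 : ℝ) 1, v t ≤ V t := fun t ht => by
    have := le_upperEnv (x := t) (Eventually.of_forall hv'b)
    rwa [hv', indicator_of_mem ht] at this
  -- the supremum of `V - φ`
  set A : Set ℝ := (fun t => V t - φ t) '' Ioo (0 : ℝ) 1 with hA
  have hAb : BddAbove A := by
    obtain ⟨C, hC⟩ := (isCompact_Icc (a := (0 : ℝ)) (b := 1)).exists_bound_of_continuousOn
      hφ.continuous.continuousOn
    refine ⟨M + C, ?_⟩
    rintro _ ⟨t, ht, rfl⟩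
    have h1 := (abs_le.1 (hVb t)).2
    have h2 := hC t (Ioo_subset_Icc_self ht)
    rw [Real.norm_eq_abs] at h2
    have h3 := (abs_le.1 h2).1
    simp only; linarith
  set m := sSup A with hm
  have hVm : ∀ t ∈ Ioo (0 : ℝ) 1, V t ≤ φ t + m := fun t ht => by
    have := le_csSup hAb ⟨t, ht, rfl⟩
    linarith
  have hme : -e ≤ m := by have := hVm t₁ ht₁; have := hvV t₁ ht₁; linarith
  -- the small parameter
  obtain ⟨σ, hσ0, hσe, hcorr⟩ := exists_correction hs₀ hs₁ hη0 (b := 16 * e) (by linarith)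
  -- a nearly maximal point and the touching point
  obtain ⟨_, ⟨τ, hτ, rfl⟩, hτm⟩ := exists_lt_of_lt_csSup (⟨_, t₁, ht₁, rfl⟩ : A.Nonempty)
    (show m - σ / 16 < m by linarith)
  simp only at hτm
  -- The supremum over the open interval need not be attained and may be approached only at an
  -- endpoint. A penalty at the scale of the distance from `τ` to the endpoints produces a maximum
  -- near `τ`; its second differences grow as `d` shrinks, and the drop outside `(0, 1)`, at the
  -- same scale, pays for them.
  set d := min τ (1 - τ) with hd
  have hd0 : 0 < d := lt_min hτ.1 (by linarith [hτ.2])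
  obtain ⟨K, hKint, hK0, hK1, hK2, hK3, hK4⟩ := hcorr d hd0
  have hdτ : d ≤ τ := min_le_left _ _
  have hdτ' : d ≤ 1 - τ := min_le_right _ _
  have hquad : Continuous fun t => σ * ((t - τ) / d) ^ 2 := by fun_prop
  obtain ⟨t₀, ht₀, hmax⟩ := UpperSemicontinuousOn.exists_isMaxOn
    (f := fun t => V t + -(φ t + σ * ((t - τ) / d) ^ 2)) (s := Icc (τ - d / 2) (τ + d / 2))
    ⟨τ, by constructor <;> linarith⟩ isCompact_Icc
    ((hVusc.add (hφ.continuous.add hquad).neg.upperSemicontinuous).upperSemicontinuousOn _)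
  have ht₀01 : t₀ ∈ Ioo (0 : ℝ) 1 := ⟨by linarith [ht₀.1], by linarith [ht₀.2]⟩
  set m' := V t₀ - (φ t₀ + σ * ((t₀ - τ) / d) ^ 2) with hm'
  have hq0 : 0 ≤ σ * ((t₀ - τ) / d) ^ 2 := by positivity
  have hm'1 : m - σ / 16 < m' := by
    have := hmax (show τ ∈ Icc (τ - d / 2) (τ + d / 2) by constructor <;> linarith)
    simp only [mem_ofPred_eq, sub_self, zero_div] at this
    have e0 : σ * (0 : ℝ) ^ 2 = 0 := by ring
    rw [e0] at this
    linarith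
  have hVt₀ := hVm t₀ ht₀01
  have hm'2 : m' ≤ m := by linarith
  have hnear : |t₀ - τ| < d / 4 := by
    have h1 : ((t₀ - τ) / d) ^ 2 < (1 / 4) ^ 2 := by
      have : σ * ((t₀ - τ) / d) ^ 2 < σ * (1 / 4) ^ 2 := by linarith
      exact lt_of_mul_lt_mul_left this hσ0.le
    have h2 := abs_lt_of_sq_lt_sq h1 (by norm_num)
    rw [abs_div, abs_of_pos hd0, div_lt_iff₀ hd0] at h2
    linarith
  obtain ⟨hn1, hn2⟩ := abs_lt.1 hnear
  set a := τ - d / 2 with ha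
  set b := τ + d / 2 with hb
  have hab : Ioo a b ⊆ Ioo 0 1 := Ioo_subset_Ioo (by linarith) (by linarith)
  have ht₀ab : t₀ ∈ Ioo a b := ⟨by linarith, by linarith⟩
  set φ' : ℝ → ℝ := fun t => φ t + σ * ((t - τ) / d) ^ 2 + m' with hφ'
  have hφ'C : ContDiff ℝ 2 φ' := by
    have : ContDiff ℝ 2 fun t : ℝ => σ * ((t - τ) / d) ^ 2 := by fun_prop
    exact (hφ.add this).add contDiff_const
  have hφ't₀ : φ' t₀ = V t₀ := by simp only [hφ', hm']; ring
  have htest := hsol.sub a b t₀ φ' hab ht₀ab hφ'C (by rw [hVv t₀ ht₀01, hφ't₀]) fun t ht => by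
    rw [hVv t (hab ht)]
    have := hmax (Ioo_subset_Icc_self ht)
    simp only [mem_ofPred_eq] at this
    simp only [hφ', hm']; linarith
  refine ⟨t₀, ht₀01, fun G hG hGle => ?_⟩
  -- The datum is only in the weighted space, not bounded. Splitting `ψ` into a bounded part and a
  -- part carried by the complement of `(0, 1)` gives integrability, without which the integral in
  -- `htest` would be a default value.
  set B : ℝ → ℝ := (Ioo (0 : ℝ) 1).indicator ((Ioo a b).piecewise φ' V) with hB
  set F : ℝ → ℝ := (Ioo (0 : ℝ) 1)ᶜ.indicator f with hF
  set ψ := (Ioo a b).piecewise φ' ((Ioo (0 : ℝ) 1).piecewise (upperEnv v) f) with hψ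
  have hψBF : ∀ t, ψ t = B t + F t := fun t => by
    by_cases h01 : t ∈ Ioo (0 : ℝ) 1
    · rw [hB, hF, indicator_of_mem h01, indicator_of_notMem (by simpa using h01), add_zero]
      by_cases hab' : t ∈ Ioo a b
      · rw [hψ, piecewise_eq_of_mem _ _ _ hab', piecewise_eq_of_mem _ _ _ hab']
      · rw [hψ, piecewise_eq_of_notMem _ _ _ hab', piecewise_eq_of_notMem _ _ _ hab',
          piecewise_eq_of_mem _ _ _ h01, hVv t h01]
    · rw [hB, hF, indicator_of_notMem h01, indicator_of_mem (by simpa using h01), zero_add, hψ,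
        piecewise_eq_of_notMem _ _ _ fun h => h01 (hab h), piecewise_eq_of_notMem _ _ _ h01]
  have hψab : ∀ t ∈ Ioo a b, ψ t = φ' t := fun t ht => piecewise_eq_of_mem _ _ _ ht
  have hψ01 : ∀ t ∈ Ioo (0 : ℝ) 1, ψ t ≤ φ t + m + σ / 4 := fun t ht => by
    by_cases hab' : t ∈ Ioo a b
    · rw [hψab t hab']
      have h1 : ((t - τ) / d) ^ 2 ≤ (1 / 2) ^ 2 := by
        refine sq_le_sq' ?_ ?_
        · rw [le_div_iff₀ hd0]; linarith [hab'.1]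
        · rw [div_le_iff₀ hd0]; linarith [hab'.2]
      have h2 := mul_le_mul_of_nonneg_left h1 hσ0.le
      simp only [hφ']; linarith
    · rw [hψ, piecewise_eq_of_notMem _ _ _ hab', piecewise_eq_of_mem _ _ _ ht, hVv t ht]
      linarith [hVm t ht]
  have hψout : ∀ t ∉ Ioo (0 : ℝ) 1, ψ t = f t := fun t ht => by
    rw [hψ, piecewise_eq_of_notMem _ _ _ fun h => ht (hab h), piecewise_eq_of_notMem _ _ _ ht]
  -- Here `m ≥ -e` and `8 * e ≤ η` leave `7 * η / 8` of the gap.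
  have hψout' : ∀ t ∉ Ioo (0 : ℝ) 1, -δ < t → t < 1 + δ → ψ t ≤ φ t + m - 7 * η / 8 :=
    fun t ht h1 h2 => by
      rw [hψout t ht]
      linarith [hfφ t ht h1 h2]
  have hψall : ∀ t, -δ < t → t < 1 + δ → ψ t ≤ φ t + m + σ / 4 := fun t h1 h2 => by
    by_cases ht : t ∈ Ioo (0 : ℝ) 1
    · exact hψ01 t ht
    · linarith [hψout' t ht h1 h2]
  have hψt₀ : ψ t₀ = V t₀ := by rw [hψab t₀ ht₀ab, hφ't₀]
  have hVlow : φ t₀ + m - σ / 16 ≤ V t₀ := by linarith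
  -- integrability
  have hd4 : 0 < d / 4 := by linarith
  have hBL : LineBounded B := by
    have hmeas : Measurable B :=
      (hφ'C.continuous.measurable.piecewise measurableSet_Ioo hVusc.measurable).indicator
        measurableSet_Ioo
    obtain ⟨M', hM'⟩ := exists_bound_piecewise_Ioo (a := a) (b := b) hφ'C.continuous hVb
    refine hmeas.lineBounded ⟨M', fun t => ?_⟩
    by_cases ht : t ∈ Ioo (0 : ℝ) 1
    · rw [hB, indicator_of_mem ht]; exact hM' t
    · rw [hB, indicator_of_notMem ht, abs_zero]; exact (abs_nonneg _).trans (hM' t)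
  have hFint : Integrable fun r : ℝ => F r / (1 + |r|) ^ (1 + 2 * s) := by
    refine (hf.indicator (measurableSet_Ioo (a := (0 : ℝ)) (b := 1)).compl).congr ?_
    refine Eventually.of_forall fun t => ?_
    by_cases ht : t ∈ (Ioo (0 : ℝ) 1)ᶜ
    · rw [hF]; simp only [indicator_of_mem ht]
    · rw [hF]; simp only [indicator_of_notMem ht, zero_div]
  obtain ⟨i1, i2⟩ := integrable_tail hs₀ hFint t₀ hd4
  have hDint : Integrable (fun t => sd ψ t₀ 1 t) (kap s) := by
    refine (((integrable_opaFun hs₀ hs₁ hd4 hφ'C hBL t₀ 1 (φ' t₀)).add i1).add i2).congr ?_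
    filter_upwards [ae_kap_pos s] with t ht
    simp only [Pi.add_apply]
    unfold opaFun sd
    simp only [smul_eq_mul, mul_one]
    split_ifs with h
    · rw [indicator_of_notMem (by simpa using h), indicator_of_notMem (by simpa using h),
        hψab _ ⟨by linarith, by linarith⟩, hψab (t₀ - t) ⟨by linarith, by linarith⟩,
        hψab t₀ ht₀ab]
      ring
    · rw [indicator_of_mem (by simpa using h), indicator_of_mem (by simpa using h), hψBF (t₀ + t),
        hψBF (t₀ - t), hψab t₀ ht₀ab]
      ring
  rw [fracLap_eq_integral] at htest
  have hfinal : ∫ t, sd ψ t₀ 1 t ∂kap s ≤ ∫ t, (G t + K t) ∂kap s := by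
    refine integral_kap_mono hDint (hG.add hKint) fun t ht => ?_
    have hGt := hGle t ht
    unfold opaFun at hGt
    unfold sd at hGt ⊢
    simp only [smul_eq_mul, mul_one] at hGt ⊢
    rw [hψt₀]
    rcases lt_or_ge t (d / 4) with c1 | c1
    · rw [hK1 t c1]
      rw [if_pos (by linarith)] at hGt
      rw [← hφ't₀, hψab _ ⟨by linarith, by linarith⟩, hψab (t₀ - t) ⟨by linarith, by linarith⟩]
      have : φ' (t₀ + t) + φ' (t₀ - t) - 2 * φ' t₀
          = φ (t₀ + t) + φ (t₀ - t) - 2 * φ t₀ + 2 * σ / d ^ 2 * t ^ 2 := by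
        simp only [hφ']; field_simp; ring
      linarith
    · rcases lt_or_ge t δ with c2 | c2
      · rw [if_pos c2] at hGt
        have p1 := hψall (t₀ + t) (by linarith [ht₀01.1]) (by linarith [ht₀01.2])
        have p2 := hψall (t₀ - t) (by linarith [ht₀01.1]) (by linarith [ht₀01.2])
        rcases lt_or_ge t (5 * d / 4) with c3 | c3
        · rw [hK2 t c1 c3]; linarith
        · rcases lt_or_ge t (5 * d / 2) with c4 | c4
          · rw [hK3 t c3 c4]
            -- The endpoint nearest to `τ` is less than `5 * d / 4` from `t₀`, so for these `t` one
            -- of `t₀ ± t` is outside `(0, 1)`, where `ψ` is far below `φ + m`. This is the negative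
            -- part of `K`.
            rcases min_choice τ (1 - τ) with hmin | hmin
            · have : t₀ - t ∉ Ioo (0 : ℝ) 1 := fun h => by
                have := h.1; rw [← hd] at hmin; linarith
              have p3 := hψout' _ this (by linarith [ht₀01.1]) (by linarith [ht₀01.2])
              linarith
            · have : t₀ + t ∉ Ioo (0 : ℝ) 1 := fun h => by
                have := h.2; rw [← hd] at hmin; linarith
              have p3 := hψout' _ this (by linarith [ht₀01.1]) (by linarith [ht₀01.2])
              linarith
          · rw [hK4 t c4]; linarith
      · rw [if_neg (not_lt.2 c2)] at hGt
        have q1 : t₀ + t ∉ Ioo (0 : ℝ) 1 := fun h => by linarith [h.2, ht₀01.1]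
        have q2 : t₀ - t ∉ Ioo (0 : ℝ) 1 := fun h => by linarith [h.1, ht₀01.2]
        rw [hψout _ q1, hψout _ q2, hK4 t (by linarith)]
        linarith
  rw [integral_add hG hKint] at hfinal
  linarith

end OneDim

/-! ### From convexity along chords to the subsolution test -/

section Segments

lemma exists_eq_Ioo {S : Set ℝ} (hS : IsOpen S) (hc : Convex ℝ S) (hb : Bornology.IsBounded S)
    (hn : S.Nonempty) : ∃ a b : ℝ, a < b ∧ S = Ioo a b := by
  have h1 : Ioo (sInf S) (sSup S) ⊆ S :=
    IsConnected.Ioo_csInf_csSup_subset ⟨hn, hc.isPreconnected⟩ hb.bddBelow hb.bddAbove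
  have h2 : S ⊆ Icc (sInf S) (sSup S) := fun t ht =>
    ⟨csInf_le hb.bddBelow ht, le_csSup hb.bddAbove ht⟩
  have h3 : S = Ioo (sInf S) (sSup S) := by
    refine Subset.antisymm ?_ h1
    have := interior_mono h2
    rwa [hS.interior_eq, interior_Icc] at this
  refine ⟨_, _, ?_, h3⟩
  rw [h3] at hn
  exact nonempty_Ioo.1 hn

/-- The weighted space is invariant under affine changes of variable. -/
lemma integrable_comp_affine {s : ℝ} (hs₀ : 0 < s) {F : ℝ → ℝ}
    (hF : Integrable fun r : ℝ => F r / (1 + |r|) ^ (1 + 2 * s)) (a : ℝ) {c : ℝ} (hc : 0 < c) :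
    Integrable fun r : ℝ => F (a + c * r) / (1 + |r|) ^ (1 + 2 * s) := by
  set p := 1 + 2 * s with hp
  have hcomp : Integrable fun r => F (a + c * r) / (1 + |a + c * r|) ^ p :=
    (hF.comp_add_left a).comp_mul_left' hc.ne'
  set K := 1 + |a| + c with hK
  have hratio : ∀ r : ℝ, (1 + |a + c * r|) ^ p / (1 + |r|) ^ p ≤ K ^ p := fun r => by
    rw [div_le_iff₀ (by positivity), ← Real.mul_rpow (by positivity) (by positivity)]
    refine Real.rpow_le_rpow (by positivity) ?_ (by linarith)
    have h1 : |a + c * r| ≤ |a| + c * |r| := by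
      refine (abs_add_le _ _).trans ?_
      rw [abs_mul, abs_of_pos hc]
    have h2 : 0 ≤ |a| * |r| := by positivity
    have h3 := abs_nonneg r
    rw [hK]; nlinarith
  have hcont : Continuous fun r : ℝ => (1 + |a + c * r|) ^ p / (1 + |r|) ^ p := by
    refine Continuous.div ?_ ?_ fun r => by positivity
    · exact Continuous.rpow_const (by fun_prop) fun t => Or.inr (by linarith)
    · exact Continuous.rpow_const (by fun_prop) fun t => Or.inr (by linarith)
  refine (hcomp.mul_bdd (c := K ^ p) hcont.aestronglyMeasurable
    (Eventually.of_forall fun r => ?_)).congr (Eventually.of_forall fun r => ?_)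
  · rw [Real.norm_eq_abs, abs_of_nonneg (by positivity)]; exact hratio r
  · have : 0 < (1 + |a + c * r|) ^ p := by positivity
    simp only; field_simp

lemma MemLs.integrable {s : ℝ} (hs₀ : 0 < s) {F : ℝ → ℝ} (hF : MemLs s F) :
    Integrable fun r : ℝ => F r / (1 + |r|) ^ (1 + 2 * s) := by
  have hcont : Continuous fun r : ℝ => (1 + |r|) ^ (1 + 2 * s) :=
    Continuous.rpow_const (by fun_prop) fun t => Or.inr (by linarith)
  refine hF.2.mono' (hF.1.aestronglyMeasurable.div₀ hcont.aestronglyMeasurable) ?_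
  refine Eventually.of_forall fun r => ?_
  rw [norm_div, Real.norm_eq_abs, Real.norm_eq_abs,
    abs_of_pos (show 0 < (1 + |r|) ^ (1 + 2 * s) by positivity)]

variable {N : ℕ}

lemma MemLineLs.exists_bound {s : ℝ} {Ω : Set (EuclideanSpace ℝ (Fin N))}
    {w : EuclideanSpace ℝ (Fin N) → ℝ} (hw : MemLineLs s Ω w)
    (hΩ : Bornology.IsBounded Ω) : ∃ M, ∀ x ∈ Ω, |w x| ≤ M := by
  obtain ⟨R, hR⟩ := hΩ.exists_norm_le
  obtain ⟨M, hM⟩ := hw.locallyBounded R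
  exact ⟨M, fun x hx => hM x (hR x hx)⟩

/-- Chords of the intersection of an open convex set with a ball. -/
lemma exists_chord {E : Type*} [NormedAddCommGroup E] [NormedSpace ℝ E] {Ω : Set E}
    (hΩo : IsOpen Ω) (hΩc : Convex ℝ Ω) {x₀ x₁ z : E} {ρ : ℝ} (hz : ‖z‖ = 1) (hx₁ : x₁ ∈ Ω)
    (hx₁b : x₁ ∈ Metric.ball x₀ ρ) :
    ∃ a b : ℝ, (a < 0 ∧ 0 < b) ∧
      (∀ t, t ∈ Ioo a b ↔ x₁ + t • z ∈ Ω ∧ x₁ + t • z ∈ Metric.ball x₀ ρ) ∧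
      x₁ + a • z ∈ closure Ω ∧ x₁ + b • z ∈ closure Ω ∧ -(2 * ρ) ≤ a ∧ b ≤ 2 * ρ := by
  have hline : Continuous fun t : ℝ => x₁ + t • z := by fun_prop
  set S : Set ℝ := (fun t : ℝ => x₁ + t • z) ⁻¹' (Ω ∩ Metric.ball x₀ ρ) with hS
  have hSb : ∀ t ∈ S, |t| ≤ 2 * ρ := fun t ht => by
    have h1 : ‖x₁ + t • z - x₀‖ < ρ := by simpa [dist_eq_norm] using ht.2
    have h2 : ‖x₁ - x₀‖ < ρ := by simpa [dist_eq_norm] using hx₁b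
    have h3 : ‖t • z‖ ≤ ‖x₁ + t • z - x₀‖ + ‖x₁ - x₀‖ := by
      calc ‖t • z‖ = ‖(x₁ + t • z - x₀) - (x₁ - x₀)‖ := by congr 1; abel
        _ ≤ _ := norm_sub_le _ _
    rw [norm_smul, hz, mul_one, Real.norm_eq_abs] at h3
    linarith
  have hSc : Convex ℝ S := by
    have h1 := (hΩc.inter (convex_ball x₀ ρ)).translate_preimage_right x₁
    exact h1.is_linear_preimage (f := fun t : ℝ => t • z)
      ⟨fun _ _ => add_smul _ _ _, fun c x => by simp [mul_smul]⟩
  have h0S : (0 : ℝ) ∈ S := by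
    simp only [hS, mem_preimage, zero_smul, add_zero]
    exact ⟨hx₁, hx₁b⟩
  obtain ⟨a, b, hab, hSab⟩ := exists_eq_Ioo (S := S)
    ((hΩo.inter Metric.isOpen_ball).preimage hline) hSc
    ((Metric.isBounded_closedBall (x := (0 : ℝ)) (r := 2 * ρ)).subset fun t ht => by
      simpa using hSb t ht) ⟨0, h0S⟩
  have hcl : ∀ t ∈ Icc a b, x₁ + t • z ∈ closure Ω ∧ |t| ≤ 2 * ρ := fun t ht => by
    rw [← closure_Ioo hab.ne, ← hSab] at ht
    have hc : IsClosed {t : ℝ | |t| ≤ 2 * ρ} := isClosed_le (by fun_prop) (by fun_prop)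
    exact ⟨map_mem_closure (f := fun t : ℝ => x₁ + t • z) hline ht fun t ht => ht.1,
      closure_minimal (s := S) hSb hc ht⟩
  obtain ⟨ha1, ha2⟩ := hcl a (left_mem_Icc.2 hab.le)
  obtain ⟨hb1, hb2⟩ := hcl b (right_mem_Icc.2 hab.le)
  rw [hSab] at h0S
  exact ⟨a, b, h0S, fun t => by rw [← hSab]; rfl, ha1, hb1, (abs_le.1 ha2).1, (abs_le.1 hb2).2⟩

set_option maxHeartbeats 1000000 in
open Classical in
/-- The upper envelope of an `s`-convex function, modified to agree with a datum above it outside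
the domain, is a subsolution in the generalised sense. -/
lemma testSub_upperEnv_of_sConvexOn {s : ℝ} (hs₀ : 0 < s) (hs₁ : s < 1)
    {Ω : Set (EuclideanSpace ℝ (Fin N))}
    (hΩ : IsStrictDomain Ω) {g : EuclideanSpace ℝ (Fin N) → ℝ} (hg : ContinuousOn g Ωᶜ)
    {w : EuclideanSpace ℝ (Fin N) → ℝ}
    (hw : w ∈ belowDatum s Ω g) {M : ℝ} (hM : ∀ x, |if x ∈ Ω then w x else g x| ≤ M) :
    TestSub s {x | x ∈ Ω ∨ x ∈ frontier Ω ∧ g x < upperEnv (fun x => if x ∈ Ω then w x else g x) x}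
      (upperEnv fun x => if x ∈ Ω then w x else g x) := by
  obtain ⟨hwL, hwC, hwg⟩ := hw
  set w' : EuclideanSpace ℝ (Fin N) → ℝ := fun x => if x ∈ Ω then w x else g x with hw'
  set U := upperEnv w' with hU
  have hUusc : UpperSemicontinuous U := upperEnv_upperSemicontinuous hM
  have hUb : ∃ M, ∀ x, |U x| ≤ M := ⟨M, fun x => abs_upperEnv_le (Eventually.of_forall hM)⟩
  have hUL := hUusc.lineBounded hUb
  have hwU : ∀ x, w x ≤ U x := fun x => by
    refine le_trans ?_ (le_upperEnv (Eventually.of_forall hM))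
    simp only [hw']
    split_ifs with h
    · exact le_rfl
    · exact hwg x h
  refine testSub_of_strict hs₀ hs₁ hUusc hUb ?_
  intro x₀ hx₀ φ z r γ δ ρ hφ h0 hγ hle hδ hz hr hρ hneg
  obtain ⟨η₀, hη₀, hgap⟩ := exists_gap hΩ.isOpen hg hx₀
  set κ := min (ρ / 4) (η₀ / 2) with hκ
  have hκ0 : 0 < κ := lt_min (by linarith) (by linarith)
  have hκ1 : κ ≤ ρ / 4 := min_le_left _ _
  have hκ2 : κ ≤ η₀ / 2 := min_le_right _ _
  have hφx : ∀ᶠ x in 𝓝 x₀, φ x₀ - κ < φ x :=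
    hφ.continuous.continuousAt.eventually (lt_mem_nhds (by linarith))
  obtain ⟨ρ', hρ', hball⟩ := Metric.eventually_nhds_iff_ball.1 (hgap.and hφx)
  -- A chord inside this ball has length `l ≤ 4 * ρ₁ ≤ δ / 5`, which is the requirement `5 ≤ δ / l`
  -- after rescaling the chord to `(0, 1)`.
  set ρ₁ := min (min ρ ρ') (δ / 20) with hρ₁
  have hρ₁0 : 0 < ρ₁ := lt_min (lt_min hρ hρ') (by linarith)
  have hρ₁1 : ρ₁ ≤ ρ := (min_le_left _ _).trans (min_le_left _ _)
  have hρ₁2 : ρ₁ ≤ ρ' := (min_le_left _ _).trans (min_le_right _ _)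
  have hρ₁3 : ρ₁ ≤ δ / 20 := min_le_right _ _
  -- A point of the line off the chord but near it lies either in the ball and off `Ω`, where `w ≤
  -- g` and the gap `η₀` helps, or off the ball, where strict touching gains `γ * ρ₁ ^ 2`. `η` is
  -- the smaller deficit.
  set η := min (η₀ / 2) (γ * ρ₁ ^ 2) with hη
  have hη0 : 0 < η := lt_min (by linarith) (by positivity)
  have hη1 : η ≤ η₀ / 2 := min_le_left _ _
  have hη2 : η ≤ γ * ρ₁ ^ 2 := min_le_right _ _
  set e := min (η / 8) (ρ / 8) with he
  have he0 : 0 < e := lt_min (by linarith) (by linarith)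
  have he1 : e ≤ η / 8 := min_le_left _ _
  have he2 : e ≤ ρ / 8 := min_le_right _ _
  -- a nearby point of `Ω` at which `w` is almost `U x₀`
  have hφ2 : ∀ᶠ x in 𝓝 x₀, φ x < φ x₀ + e / 2 :=
    hφ.continuous.continuousAt.eventually (gt_mem_nhds (by linarith))
  obtain ⟨x₁, hx₁w, hx₁φ, hx₁b⟩ := ((frequently_lt_of_lt_upperEnv (x := x₀) (c := U x₀ - e / 2)
    (Eventually.of_forall hM) (by linarith)).and_eventually
      (hφ2.and (Metric.ball_mem_nhds x₀ hρ₁0))).exists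
  have hx₁Ω : x₁ ∈ Ω := by
    by_contra hn
    have h1 := (hball x₁ (Metric.ball_subset_ball hρ₁2 hx₁b)).1 hn
    simp only [if_neg hn] at hx₁w
    linarith
  simp only [if_pos hx₁Ω] at hx₁w
  -- the chord of `Ω ∩ B(x₀, ρ₁)` through `x₁` in direction `z`
  obtain ⟨a, b, ⟨ha0, hb0⟩, hSIoo, ha1, hb1, ha3, hb3⟩ :=
    exists_chord hΩ.isOpen hΩ.convex hz hx₁Ω hx₁b
  have h0ab : (0 : ℝ) ∈ Ioo a b := ⟨ha0, hb0⟩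
  have hab : a < b := ha0.trans hb0
  set l := b - a with hl
  have hl0 : 0 < l := sub_pos.2 hab
  have hz0 : z ≠ 0 := fun h => by simp [h] at hz
  have hpt : ∀ t : ℝ, t • (x₁ + b • z) + (1 - t) • (x₁ + a • z) = x₁ + (a + l * t) • z := by
    intro t
    rw [hl]; module
  obtain ⟨v, hv, hwv⟩ := hwC (x₁ + b • z) hb1 (x₁ + a • z) ha1
    (fun h => hab.ne' (smul_left_injective ℝ hz0 (add_left_cancel h)))
    (hΩ.convex.closure.openSegment_subset hb1 ha1)
  simp only [hpt] at hv hwv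
  have hmap : ∀ t, t ∈ Ioo (0 : ℝ) 1 ↔ a + l * t ∈ Ioo a b := fun t => by
    have : b = a + l * 1 := by rw [hl]; ring
    constructor
    · rintro ⟨h1, h2⟩
      exact ⟨by nlinarith, by rw [this]; nlinarith⟩
    · rintro ⟨h1, h2⟩
      rw [this] at h2
      exact ⟨by by_contra! h; nlinarith, by by_contra! h; nlinarith⟩
  have hint : Integrable fun r : ℝ => w (x₁ + (a + l * r) • z) / (1 + |r|) ^ (1 + 2 * s) :=
    integrable_comp_affine hs₀ ((hwL.lines x₁ hx₁Ω z hz).integrable hs₀) a hl0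
  set φ' : ℝ → ℝ := fun t => φ (x₁ + (a + l * t) • z) with hφ'
  have hφ'C : ContDiff ℝ 2 φ' := hφ.comp (by fun_prop)
  have ht₁e : a + l * (-a / l) = 0 := by field_simp; ring
  have ht₁ : -a / l ∈ Ioo (0 : ℝ) 1 := by rw [hmap, ht₁e]; exact h0ab
  obtain ⟨t₀, ht₀, hconcl⟩ := hv.exists_nonneg hs₀ hs₁ hint hφ'C (η := η) (e := e) (δ := δ / l) he0
    (by linarith) (by rw [le_div_iff₀ hl0]; linarith)
    (fun t ht h1 h2 => by
      have h1' : -δ < l * t := by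
        rw [neg_lt, div_eq_inv_mul] at h1
        have := mul_lt_mul_of_pos_left h1 hl0
        rw [mul_inv_cancel_left₀ hl0.ne'] at this
        linarith
      have h2' : l * t < l + δ := by
        have := mul_lt_mul_of_pos_left h2 hl0
        rwa [mul_add, mul_one, mul_div_cancel₀ _ hl0.ne'] at this
      set y := x₁ + (a + l * t) • z with hy
      have hyd : ‖y - x₀‖ < 2 * δ := by
        have e1 : ‖x₁ - x₀‖ < ρ₁ := by simpa [dist_eq_norm] using hx₁b
        have e2 : ‖y - x₀‖ ≤ ‖x₁ - x₀‖ + ‖(a + l * t) • z‖ := by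
          rw [show y - x₀ = (x₁ - x₀) + (a + l * t) • z by rw [hy]; abel]; exact norm_add_le _ _
        rw [norm_smul, hz, mul_one, Real.norm_eq_abs] at e2
        have e3 : |a + l * t| ≤ δ + 2 * ρ₁ := by
          rw [abs_le]; constructor <;> linarith
        linarith
      have hyU := hle y (by rw [Metric.mem_ball, dist_eq_norm]; linarith)
      by_cases hyb : y ∈ Metric.ball x₀ ρ₁
      · have hyΩ : y ∉ Ω := fun h => ht ((hmap t).2 ((hSIoo _).2 ⟨h, hyb⟩))
        obtain ⟨k1, k2⟩ := hball y (Metric.ball_subset_ball hρ₁2 hyb)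
        have := k1 hyΩ
        have := hwg y hyΩ
        simp only [hφ']
        linarith
      · rw [Metric.mem_ball, dist_eq_norm, not_lt] at hyb
        have : γ * ρ₁ ^ 2 ≤ γ * ‖y - x₀‖ ^ 2 := by gcongr
        have := hwU y
        simp only [hφ']
        linarith) ht₁
    (by
      have h1 := hwv _ ht₁
      rw [ht₁e, zero_smul, add_zero] at h1
      simp only [hφ', ht₁e, zero_smul, add_zero]
      linarith)
  set x₂ := x₁ + (a + l * t₀) • z with hx₂
  obtain ⟨-, hx₂b⟩ := (hSIoo _).1 ((hmap t₀).1 ht₀)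
  obtain ⟨-, hx₂φ⟩ := hball x₂ (Metric.ball_subset_ball hρ₁2 hx₂b)
  have hδl : 0 < δ / l := by positivity
  -- Along the line `w` is majorised by `U`, whose boundedness and semicontinuity supply an
  -- integrable majorant.
  have hfin := hconcl (opaFun (δ / l) φ U x₂ (l • z) (φ x₂ - 2 * e))
    (integrable_opaFun hs₀ hs₁ hδl hφ hUL _ _ _) fun t ht => by
      have e1 : x₁ + (a + l * (t₀ + t)) • z = x₂ + t • l • z := by rw [hx₂]; module
      have e2 : x₁ + (a + l * (t₀ - t)) • z = x₂ - t • l • z := by rw [hx₂]; module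
      unfold opaFun sd
      simp only [smul_eq_mul, mul_one, hφ', e1, e2]
      split_ifs
      · exact le_rfl
      · linarith [hwU (x₂ + t • l • z), hwU (x₂ - t • l • z)]
  have hop := opa_smul (s := s) hl0 (δ / l) φ U x₂ z (φ x₂ - 2 * e)
  rw [mul_div_cancel₀ _ hl0.ne'] at hop
  have hlt := hneg x₂ (Metric.ball_subset_ball hρ₁1 hx₂b) (φ x₂ - 2 * e) (by linarith)
  rw [← opa, hop] at hfin
  have : 0 < l ^ (2 * s) := by positivity
  nlinarith

end Segments

variable {N : ℕ}

/-! ### The class `H(g)` and the Perron solution -/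

section Class

/-- Members of the class lie below every continuous supersolution attaining the datum. -/
lemma le_of_mem_belowDatum [Nontrivial (EuclideanSpace ℝ (Fin N))] {s : ℝ} (hs₀ : 0 < s)
    (hs₁ : s < 1) {Ω : Set (EuclideanSpace ℝ (Fin N))}
    (hΩ : IsStrictDomain Ω) {g W w : EuclideanSpace ℝ (Fin N) → ℝ} (hg : ContinuousOn g Ωᶜ)
    (hgb : ∃ M : ℝ, ∀ x ∈ Ωᶜ, |g x| ≤ M) (hW : Continuous W) (hWb : ∃ M : ℝ, ∀ x, |W x| ≤ M)
    (hWg : ∀ x ∉ Ω, W x = g x) (hWs : TestSuper s Ω W) (hw : w ∈ belowDatum s Ω g)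
    (x : EuclideanSpace ℝ (Fin N)) :
    w x ≤ W x := by
  classical
  obtain ⟨M₁, hM₁⟩ := hw.1.exists_bound hΩ.bounded
  obtain ⟨M₂, hM₂⟩ := hgb
  -- Off `Ω` the function `w` has no global bound and no continuity. Replacing it there by `g` can
  -- only raise it and controls its envelope.
  set w' : EuclideanSpace ℝ (Fin N) → ℝ := fun x => if x ∈ Ω then w x else g x with hw'
  have hM : ∀ x, |w' x| ≤ max M₁ M₂ := fun x => by
    simp only [hw']
    split_ifs with h
    · exact (hM₁ x h).trans (le_max_left _ _)
    · exact (hM₂ x h).trans (le_max_right _ _)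
  have htest := testSub_upperEnv_of_sConvexOn hs₀ hs₁ hΩ hg hw hM
  have hU : UpperSemicontinuous (upperEnv w') := upperEnv_upperSemicontinuous hM
  have hUb : ∃ M, ∀ x, |upperEnv w' x| ≤ M :=
    ⟨_, fun x => abs_upperEnv_le (Eventually.of_forall hM)⟩
  have hext : ∀ y ∉ closure Ω, upperEnv w' y ≤ g y := fun y hy => by
    have hnhds : (closure Ω)ᶜ ∈ 𝓝 y := isClosed_closure.isOpen_compl.mem_nhds hy
    have hsub : (closure Ω)ᶜ ⊆ Ωᶜ := compl_subset_compl.2 subset_closure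
    have h1 : upperEnv w' y = upperEnv g y := limsup_congr (by
      filter_upwards [hnhds] with t ht
      simp only [hw', if_neg (hsub ht)])
    rw [h1, upperEnv_of_continuousAt (hg.continuousAt (mem_of_superset hnhds hsub))]
  have hbdry := htest.le_datum hs₀ hs₁ hΩ hg hU hUb hext
  have hle : ∀ y ∉ Ω, upperEnv w' y ≤ W y := fun y hy => by
    rw [hWg y hy]
    by_cases hc : y ∈ closure Ω
    · exact hbdry y (by rw [hΩ.isOpen.frontier_eq]; exact ⟨hc, hy⟩)
    · exact hext y hc
  have hcomp := comparison hs₀ hs₁ hΩ.isOpen hΩ.isOpen hΩ.bounded hU hUb hW.lowerSemicontinuous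
    hWb 0 (ContinuousLinearMap.id ℝ (EuclideanSpace ℝ (Fin N))) (fun y hy => by simpa using hy)
    (htest.mono fun y hy => Or.inl hy) hWs (fun y hy => by simpa using hle y hy) x
  simp only [zero_add, ContinuousLinearMap.coe_id', id_eq] at hcomp
  refine le_trans ?_ ((le_upperEnv (Eventually.of_forall hM)).trans hcomp)
  simp only [hw']
  split_ifs with h
  · exact le_rfl
  · exact hw.2.2 x h

lemma memLs_of_continuous {s : ℝ} (hs₀ : 0 < s) {f : ℝ → ℝ} (hf : Continuous f) {M : ℝ}
    (hM : ∀ t, |f t| ≤ M) : MemLs s f := by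
  refine ⟨hf.locallyIntegrable, ?_⟩
  have h1 : Integrable fun r : ℝ => (1 + ‖r‖) ^ (-(1 + 2 * s)) :=
    integrable_one_add_norm (by simp; linarith)
  have hcont : Continuous fun r : ℝ => (1 + |r|) ^ (1 + 2 * s) :=
    Continuous.rpow_const (by fun_prop) fun t => Or.inr (by linarith)
  refine (h1.const_mul M).mono'
    (hf.abs.aestronglyMeasurable.div₀ hcont.aestronglyMeasurable)
    (Eventually.of_forall fun r => ?_)
  rw [norm_div, Real.norm_eq_abs, abs_abs, Real.norm_eq_abs, Real.rpow_neg (by positivity),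
    abs_of_pos (show 0 < (1 + |r|) ^ (1 + 2 * s) by positivity), div_eq_mul_inv, Real.norm_eq_abs]
  gcongr
  exact hM r

/-- Continuous bounded subsolutions below the datum belong to the class. -/
lemma mem_belowDatum {s : ℝ} (hs₀ : 0 < s) (hs₁ : s < 1) {Ω : Set (EuclideanSpace ℝ (Fin N))}
    (hΩ : IsStrictDomain Ω) {g W : EuclideanSpace ℝ (Fin N) → ℝ} (hW : Continuous W)
    (hWb : ∃ M : ℝ, ∀ x, |W x| ≤ M) (hWg : ∀ x ∉ Ω, W x ≤ g x) (hWs : TestSub s Ω W) :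
    W ∈ belowDatum s Ω g := by
  obtain ⟨M, hM⟩ := hWb
  refine ⟨⟨hW.aestronglyMeasurable, fun R => ⟨M, fun x _ => hM x⟩, fun x _ z _ =>
    memLs_of_continuous hs₀ (by fun_prop) fun t => hM _⟩, fun x hx y hy hxy _ => ?_, hWg⟩
  -- Even for endpoints on the frontier, strict convexity puts the open segment in `Ω`, where `W`
  -- passes the test.
  have hseg := strictConvex_openSegment_subset hΩ.isOpen hΩ.convex hΩ.nonempty hΩ.strictConvex
    hx hy hxy
  obtain ⟨v, hv, hvb, hvf, hvs, hsol⟩ := exists_dirichlet hs₀ hs₁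
    (f := fun t : ℝ => W (t • x + (1 - t) • y)) (by fun_prop) ⟨M, fun t => hM _⟩
  refine ⟨v, hsol, fun t _ => ?_⟩
  have hpt : ∀ t : ℝ, y + ContinuousLinearMap.toSpanSingleton ℝ (x - y) t
      = t • x + (1 - t) • y := fun t => by
    rw [ContinuousLinearMap.toSpanSingleton_apply]; module
  have := comparison hs₀ hs₁ hΩ.isOpen isOpen_Ioo (Metric.isBounded_Ioo 0 1)
    hW.upperSemicontinuous ⟨M, hM⟩ hv.lowerSemicontinuous hvb y
    (ContinuousLinearMap.toSpanSingleton ℝ (x - y)) (fun t ht => by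
      rw [hpt]
      exact hseg ⟨t, 1 - t, ht.1, by linarith [ht.2], by ring, rfl⟩) hWs hvs
    (fun t ht => by rw [hpt, hvf t ht]) t
  rwa [hpt] at this

end Class

/-! ### The operator `E_δ` in terms of second differences -/

section Evaluation

lemma LineBounded.integrableOn_tail {s : ℝ} (hs₀ : 0 < s) {w : EuclideanSpace ℝ (Fin N) → ℝ}
    (hw : LineBounded w) {δ : ℝ}
    (hδ : 0 < δ) (x z : EuclideanSpace ℝ (Fin N)) :
    IntegrableOn (fun t : ℝ => (w (x + t • z) - w x) / t ^ (1 + 2 * s)) (Ici δ) := by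
  obtain ⟨M, hM⟩ := hw.bounded
  have h1 : Integrable ((Ici δ).indicator fun t : ℝ => w (x + t • z) - w x) (kap s) := by
    refine ((integrableOn_kap_Ici hs₀ hδ).1.const_mul (2 * M)).mono'
      (((hw.meas x z).sub_const _).indicator measurableSet_Ici).aestronglyMeasurable
      (Eventually.of_forall fun t => ?_)
    by_cases ht : t ∈ Ici δ
    · rw [indicator_of_mem ht, indicator_of_mem ht, mul_one, Real.norm_eq_abs]
      exact (abs_sub _ _).trans (by linarith [hM (x + t • z), hM x])
    · rw [indicator_of_notMem ht, indicator_of_notMem ht, norm_zero, mul_zero]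
  rw [integrable_kap_iff] at h1
  refine (integrableOn_congr_fun (fun t (ht : t ∈ Ici δ) => ?_) measurableSet_Ici).1
    (h1.mono_set fun t ht => hδ.trans_le ht)
  simp only [indicator_of_mem ht]

lemma setIntegral_le_abs {H : ℝ → ℝ} {δ : ℝ} (hδ : 0 < δ) (h₁ : IntegrableOn H (Ici δ))
    (h₂ : IntegrableOn (fun t => H (-t)) (Ici δ)) :
    ∫ t in {t : ℝ | δ ≤ |t|}, H t = ∫ t in Ici δ, (H (-t) + H t) := by
  have hsplit : {t : ℝ | δ ≤ |t|} = Iic (-δ) ∪ Ici δ := by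
    ext t
    simp only [mem_ofPred_eq, le_abs', mem_union, mem_Iic, mem_Ici]
  have h₃ : IntegrableOn H (Iic (-δ)) := by
    rw [← neg_neg δ] at h₂
    simpa only [neg_neg] using IntegrableOn.comp_neg_Iic (c := -δ) h₂
  have hd : Disjoint (Iic (-δ)) (Ici δ) := Set.disjoint_left.2 fun t h h' => by
    rw [mem_Iic] at h
    rw [mem_Ici] at h'
    linarith
  rw [hsplit, setIntegral_union hd measurableSet_Ici h₃ h₁, integral_add h₂ h₁,
    integral_Ici_eq_integral_Ioi (f := fun t => H (-t)), integral_comp_neg_Ioi]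

/-- Folding the negative half of the outer integral onto the positive half turns it into second
differences, to be joined with the inner part. -/
lemma innerPart_add_outerPart {s : ℝ} (hs₀ : 0 < s) (hs₁ : s < 1) {δ : ℝ} (hδ : 0 < δ)
    {φ w : EuclideanSpace ℝ (Fin N) → ℝ} (hφ : ContDiff ℝ 2 φ) (hw : LineBounded w)
    (x z : EuclideanSpace ℝ (Fin N)) :
    innerPart s δ φ x z + outerPart s δ w x z = opa s δ φ w x z (w x) := by
  have hint := integrable_opaFun hs₀ hs₁ hδ hφ hw x z (w x)
  have hin : innerPart s δ φ x z
      = ∫ t, (Ioo 0 δ).indicator (opaFun δ φ w x z (w x)) t ∂kap s := by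
    rw [← setIntegral_div_eq_kap measurableSet_Ioo fun t ht => ht.1, innerPart]
    refine setIntegral_congr_fun measurableSet_Ioo fun t ht => ?_
    simp only [opaFun, if_pos ht.2, sd]
  set H : ℝ → ℝ := fun t => (w (x + t • z) - w x) / |t| ^ (1 + 2 * s) with hH
  have hright : ∀ t ∈ Ici δ, H t = (w (x + t • z) - w x) / t ^ (1 + 2 * s) := fun t ht => by
    simp only [hH, abs_of_pos (hδ.trans_le (mem_Ici.1 ht))]
  have hleft : ∀ t ∈ Ici δ, H (-t) = (w (x + t • -z) - w x) / t ^ (1 + 2 * s) := fun t ht => by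
    simp only [hH, abs_neg, abs_of_pos (hδ.trans_le (mem_Ici.1 ht)), neg_smul, smul_neg]
  have hI : IntegrableOn H (Ici δ) :=
    (integrableOn_congr_fun hright measurableSet_Ici).2 (hw.integrableOn_tail hs₀ hδ x z)
  have hI' : IntegrableOn (fun t => H (-t)) (Ici δ) :=
    (integrableOn_congr_fun hleft measurableSet_Ici).2 (hw.integrableOn_tail hs₀ hδ x (-z))
  have hout : outerPart s δ w x z
      = ∫ t, (Ici δ).indicator (opaFun δ φ w x z (w x)) t ∂kap s := by
    rw [← setIntegral_div_eq_kap measurableSet_Ici fun t ht => hδ.trans_le ht, outerPart,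
      setIntegral_le_abs hδ hI hI']
    refine setIntegral_congr_fun measurableSet_Ici fun t ht => ?_
    simp only [hleft t ht, hright t ht, opaFun, if_neg (not_lt.2 (mem_Ici.1 ht)), smul_neg,
      ← sub_eq_add_neg]
    ring
  rw [hin, hout, ← integral_add (hint.indicator measurableSet_Ioo)
    (hint.indicator measurableSet_Ici), opa]
  refine integral_congr_ae ?_
  filter_upwards [ae_kap_pos s] with t ht
  rcases lt_or_ge t δ with h | h
  · rw [indicator_of_mem (show t ∈ Ioo 0 δ from ⟨ht, h⟩), indicator_of_notMem (by simpa using h), add_zero]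
  · rw [indicator_of_notMem (by simp [h]), indicator_of_mem (by simpa using h), zero_add]

lemma evalE_eq {s : ℝ} (hs₀ : 0 < s) (hs₁ : s < 1) {δ : ℝ} (hδ : 0 < δ)
    {φ w : EuclideanSpace ℝ (Fin N) → ℝ} (hφ : ContDiff ℝ 2 φ) (hw : LineBounded w)
    (x : EuclideanSpace ℝ (Fin N)) :
    evalE s δ w φ x
      = -⨅ z : Metric.sphere (0 : EuclideanSpace ℝ (Fin N)) 1, opa s δ φ w x z (w x) := by
  simp only [evalE, innerPart_add_outerPart hs₀ hs₁ hδ hφ hw]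

lemma bddBelow_opa {s : ℝ} (hs₀ : 0 < s) (hs₁ : s < 1) {δ : ℝ} (hδ : 0 < δ)
    {φ w : EuclideanSpace ℝ (Fin N) → ℝ} (hφ : ContDiff ℝ 2 φ) (hw : LineBounded w)
    (x : EuclideanSpace ℝ (Fin N)) :
    BddBelow (range fun z : Metric.sphere (0 : EuclideanSpace ℝ (Fin N)) 1 =>
      opa s δ φ w x z (w x)) := by
  set R := max (max ‖x‖ 1) |w x| with hR
  obtain ⟨C, hC⟩ := exists_bound_opaFun hφ hw R δ
  refine ⟨∫ t, -(C * dom δ t) ∂kap s, ?_⟩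
  rintro _ ⟨z, rfl⟩
  refine integral_kap_mono ((integrable_dom hs₀ hs₁ hδ).const_mul C).neg
    (integrable_opaFun hs₀ hs₁ hδ hφ hw x z (w x)) fun t ht => ?_
  exact (abs_le.1 (hC x z (w x) t (by simp [hR]) (by simp [hR]) (by simp [hR]) ht)).1

/-- A real infimum over an empty or unbounded family is a default value; nontriviality of the space
gives unit directions, and domination of the integrand gives a lower bound. -/
lemma evalE_nonpos_iff [Nontrivial (EuclideanSpace ℝ (Fin N))] {s : ℝ} (hs₀ : 0 < s) (hs₁ : s < 1)
    {δ : ℝ} (hδ : 0 < δ)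
    {φ w : EuclideanSpace ℝ (Fin N) → ℝ} (hφ : ContDiff ℝ 2 φ) (hw : LineBounded w)
    (x : EuclideanSpace ℝ (Fin N)) :
    evalE s δ w φ x ≤ 0 ↔ ∀ z : EuclideanSpace ℝ (Fin N), ‖z‖ = 1 → 0 ≤ opa s δ φ w x z (w x) := by
  rw [evalE_eq hs₀ hs₁ hδ hφ hw, neg_nonpos]
  have : Nonempty (Metric.sphere (0 : EuclideanSpace ℝ (Fin N)) 1) :=
    (NormedSpace.sphere_nonempty.2 zero_le_one).to_subtype
  constructor
  · exact fun h z hz => h.trans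
      (ciInf_le (bddBelow_opa hs₀ hs₁ hδ hφ hw x) ⟨z, by simpa using hz⟩)
  · exact fun h => le_ciInf fun z => h z (by simp)

/-- Values below every `c > 0` express the sign of the infimum without its being attained. -/
lemma evalE_nonneg_iff [Nontrivial (EuclideanSpace ℝ (Fin N))] {s : ℝ} (hs₀ : 0 < s) (hs₁ : s < 1)
    {δ : ℝ} (hδ : 0 < δ)
    {φ w : EuclideanSpace ℝ (Fin N) → ℝ} (hφ : ContDiff ℝ 2 φ) (hw : LineBounded w)
    (x : EuclideanSpace ℝ (Fin N)) :
    0 ≤ evalE s δ w φ x ↔ ∀ c : ℝ, 0 < c →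
      ∃ z : EuclideanSpace ℝ (Fin N), ‖z‖ = 1 ∧ opa s δ φ w x z (w x) < c := by
  rw [evalE_eq hs₀ hs₁ hδ hφ hw, neg_nonneg]
  have : Nonempty (Metric.sphere (0 : EuclideanSpace ℝ (Fin N)) 1) :=
    (NormedSpace.sphere_nonempty.2 zero_le_one).to_subtype
  constructor
  · intro h c hc
    obtain ⟨z, hz⟩ := exists_lt_of_ciInf_lt (h.trans_lt hc)
    exact ⟨z, by simp, hz⟩
  · intro h
    refine le_of_forall_pos_le_add fun c hc => ?_
    obtain ⟨z, hz, hlt⟩ := h c hc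
    rw [zero_add]
    exact (ciInf_le (bddBelow_opa hs₀ hs₁ hδ hφ hw x) ⟨z, by simpa using hz⟩).trans hlt.le

end Evaluation

/-! ### Viscosity solutions and uniqueness -/

section Viscosity

lemma upperExt_eq {Ω : Set (EuclideanSpace ℝ (Fin N))} (hΩ : IsOpen Ω)
    {g u : EuclideanSpace ℝ (Fin N) → ℝ} (h : ∀ x ∉ closure Ω, u x ≤ g x)
    {x : EuclideanSpace ℝ (Fin N)} (hx : x ∉ Ω) : upperExt Ω g u x = max (u x) (g x) := by
  rw [upperExt, if_neg hx]
  split_ifs with hf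
  · rfl
  · rw [hΩ.frontier_eq] at hf
    exact (max_eq_right (h x fun hc => hf ⟨hc, hx⟩)).symm

lemma upperExt_of_mem {Ω : Set (EuclideanSpace ℝ (Fin N))} {g u : EuclideanSpace ℝ (Fin N) → ℝ}
    {x : EuclideanSpace ℝ (Fin N)} (hx : x ∈ Ω) :
    upperExt Ω g u x = u x := if_pos hx

lemma lowerExt_eq_neg (Ω : Set (EuclideanSpace ℝ (Fin N))) (g u : EuclideanSpace ℝ (Fin N) → ℝ) :
    lowerExt Ω g u = -upperExt Ω (-g) (-u) := by
  ext x
  simp only [lowerExt, upperExt, Pi.neg_apply]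
  split_ifs
  · simp
  · rw [max_neg_neg, neg_neg]
  · simp

lemma upperExt_eq_self {Ω : Set (EuclideanSpace ℝ (Fin N))} {g W : EuclideanSpace ℝ (Fin N) → ℝ}
    (h : ∀ x ∉ Ω, W x = g x) :
    upperExt Ω g W = W := by
  ext x
  by_cases hx : x ∈ Ω
  · exact upperExt_of_mem hx
  · rw [upperExt, if_neg hx, h x hx]; simp

lemma lowerExt_eq_self {Ω : Set (EuclideanSpace ℝ (Fin N))} {g W : EuclideanSpace ℝ (Fin N) → ℝ}
    (h : ∀ x ∉ Ω, W x = g x) :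
    lowerExt Ω g W = W := by
  rw [lowerExt_eq_neg, upperExt_eq_self fun x hx => by simp [h x hx], neg_neg]

lemma le_upperExt {Ω : Set (EuclideanSpace ℝ (Fin N))} (hΩ : IsOpen Ω)
    {g u : EuclideanSpace ℝ (Fin N) → ℝ}
    (h : ∀ x ∉ closure Ω, u x ≤ g x) (x : EuclideanSpace ℝ (Fin N)) : u x ≤ upperExt Ω g u x := by
  by_cases hx : x ∈ Ω
  · rw [upperExt_of_mem hx]
  · rw [upperExt_eq hΩ h hx]; exact le_max_left _ _

lemma upperExt_upperSemicontinuous {Ω : Set (EuclideanSpace ℝ (Fin N))} (hΩ : IsOpen Ω)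
    {g u : EuclideanSpace ℝ (Fin N) → ℝ}
    (hg : ContinuousOn g Ωᶜ) (hu : UpperSemicontinuous u) (h : ∀ x ∉ closure Ω, u x ≤ g x) :
    UpperSemicontinuous (upperExt Ω g u) := by
  intro x c hc
  by_cases hx : x ∈ Ω
  · rw [upperExt_of_mem hx] at hc
    filter_upwards [hΩ.mem_nhds hx, hu x c hc] with y hy hyc
    rwa [upperExt_of_mem hy]
  · rw [upperExt_eq hΩ h hx] at hc
    have h1 := eventually_nhdsWithin_iff.1
      ((hg x hx).eventually (gt_mem_nhds ((le_max_right _ _).trans_lt hc)))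
    filter_upwards [h1, hu x c ((le_max_left _ _).trans_lt hc)] with y hy hyc
    by_cases hyΩ : y ∈ Ω
    · rwa [upperExt_of_mem hyΩ]
    · rw [upperExt_eq hΩ h hyΩ]; exact max_lt hyc (hy hyΩ)

lemma exists_bound_upperExt {Ω : Set (EuclideanSpace ℝ (Fin N))}
    {g u : EuclideanSpace ℝ (Fin N) → ℝ} (hg : ∃ M : ℝ, ∀ x ∈ Ωᶜ, |g x| ≤ M)
    (hu : ∃ M : ℝ, ∀ x, |u x| ≤ M) : ∃ M : ℝ, ∀ x, |upperExt Ω g u x| ≤ M := by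
  obtain ⟨M₁, h1⟩ := hg
  obtain ⟨M₂, h2⟩ := hu
  refine ⟨max M₁ M₂, fun x => ?_⟩
  rw [upperExt]
  split_ifs with hx hf
  · exact (h2 x).trans (le_max_right _ _)
  · exact abs_max_le_max_abs_abs.trans
      (max_le ((h2 x).trans (le_max_right _ _)) ((h1 x hx).trans (le_max_left _ _)))
  · exact (h1 x hx).trans (le_max_left _ _)

variable [Nontrivial (EuclideanSpace ℝ (Fin N))] {s : ℝ} (hs₀ : 0 < s) (hs₁ : s < 1)
    {Ω : Set (EuclideanSpace ℝ (Fin N))} {g : EuclideanSpace ℝ (Fin N) → ℝ}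

include hs₀ hs₁

/-- On the frontier, `g < max u g` forces the extension to equal `u` there and rules out the
alternative `u ≤ g` of the boundary condition, leaving the operator inequality. -/
lemma IsViscositySub.testSub_upperExt (hΩ : IsOpen Ω) {u : EuclideanSpace ℝ (Fin N) → ℝ}
    (hu : IsViscositySub s Ω g u)
    (hL : LineBounded (upperExt Ω g u)) :
    TestSub s {x | x ∈ Ω ∨ x ∈ frontier Ω ∧ g x < upperExt Ω g u x} (upperExt Ω g u) := by
  refine testSub_of_unit fun x₀ hx₀ φ r hφ h0 hle z δ hδ hz hr => ?_
  have heq : upperExt Ω g u x₀ = u x₀ := by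
    rcases hx₀ with h | ⟨h, hlt⟩
    · exact upperExt_of_mem h
    · rw [hΩ.frontier_eq] at h
      rw [upperExt_eq hΩ hu.exterior h.2] at hlt ⊢
      exact max_eq_left ((lt_max_iff.1 hlt).resolve_right (lt_irrefl _)).le
  have hmax : IsMaxOn (fun x => u x - φ x) (Metric.ball x₀ δ) x₀ := fun x hx => by
    have h1 := le_upperExt hΩ hu.exterior x
    have h2 := hle x (Metric.ball_subset_ball hr hx)
    rw [heq] at h0
    simp only [mem_ofPred_eq]
    linarith
  have hE : evalE s δ (upperExt Ω g u) φ x₀ ≤ 0 := by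
    rcases hx₀ with h | ⟨h, hlt⟩
    · exact hu.interior_test δ φ hδ hφ x₀ h hmax
    · rw [heq] at hlt
      exact (min_le_iff.1 (hu.boundary_test δ φ hδ hφ x₀ h hmax)).resolve_right (by linarith)
  exact (evalE_nonpos_iff hs₀ hs₁ hδ hφ hL x₀).1 hE z hz

lemma IsViscositySuper.testSuper_lowerExt (hΩ : IsOpen Ω) {u : EuclideanSpace ℝ (Fin N) → ℝ}
    (hu : IsViscositySuper s Ω g u) (hL : LineBounded (lowerExt Ω g u)) :
    TestSuper s {x | x ∈ Ω ∨ x ∈ frontier Ω ∧ lowerExt Ω g u x < g x} (lowerExt Ω g u) := by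
  intro x₀ hx₀ φ r hφ h0 hle δ hδ hr
  have hext : ∀ x ∉ closure Ω, (-u) x ≤ (-g) x := fun x hx => neg_le_neg (hu.exterior x hx)
  have heq : lowerExt Ω g u x₀ = u x₀ := by
    rw [lowerExt_eq_neg] at hx₀ ⊢
    rcases hx₀ with h | ⟨h, hlt⟩
    · simp [upperExt_of_mem h]
    · rw [hΩ.frontier_eq] at h
      rw [Pi.neg_apply, upperExt_eq hΩ hext h.2] at hlt ⊢
      have h1 : (-g) x₀ < max ((-u) x₀) ((-g) x₀) := by
        simp only [Pi.neg_apply] at hlt ⊢; linarith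
      rw [max_eq_left ((lt_max_iff.1 h1).resolve_right (lt_irrefl _)).le, Pi.neg_apply, neg_neg]
  have hmin : IsMinOn (fun x => u x - φ x) (Metric.ball x₀ δ) x₀ := fun x hx => by
    have h1 := le_upperExt hΩ hext x
    have h2 := hle x (Metric.ball_subset_ball hr hx)
    rw [heq] at h0
    rw [lowerExt_eq_neg] at h2
    simp only [mem_ofPred_eq, Pi.neg_apply] at h1 h2 ⊢
    linarith
  have hE : 0 ≤ evalE s δ (lowerExt Ω g u) φ x₀ := by
    rcases hx₀ with h | ⟨h, hlt⟩
    · exact hu.interior_test δ φ hδ hφ x₀ h hmin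
    · rw [heq] at hlt
      exact (le_max_iff.1 (hu.boundary_test δ φ hδ hφ x₀ h hmin)).resolve_right (by linarith)
  exact (evalE_nonneg_iff hs₀ hs₁ hδ hφ hL x₀).1 hE

/-- Continuous bounded functions attaining the datum and passing both tests are viscosity
solutions. -/
lemma isViscositySol_of_test {W : EuclideanSpace ℝ (Fin N) → ℝ} (hW : Continuous W)
    (hWb : ∃ M : ℝ, ∀ x, |W x| ≤ M)
    (hWg : ∀ x ∉ Ω, W x = g x) (hsub : TestSub s Ω W) (hsup : TestSuper s Ω W)
    (hΩ : IsOpen Ω) : IsViscositySol s Ω g W := by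
  have hU : upperEnv W = W := funext fun x => upperEnv_of_continuousAt hW.continuousAt
  have hL : lowerEnv W = W := funext fun x => lowerEnv_of_continuousAt hW.continuousAt
  have hB := hW.upperSemicontinuous.lineBounded hWb
  have hout : ∀ x ∉ closure Ω, W x = g x := fun x hx => hWg x fun h => hx (subset_closure h)
  have hfr : ∀ x ∈ frontier Ω, W x - g x = 0 := fun x hx => by
    rw [hΩ.frontier_eq] at hx
    rw [hWg x hx.2, sub_self]
  refine ⟨hWb, ?_, ?_⟩
  · rw [hU]
    refine ⟨hWb, hW.upperSemicontinuous, fun x hx => (hout x hx).le, ?_, ?_⟩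
    · intro δ φ hδ hφ x₀ hx₀ hmax
      rw [upperExt_eq_self hWg, evalE_nonpos_iff hs₀ hs₁ hδ hφ hB]
      intro z hz
      have := hsub x₀ hx₀ (fun y => φ y + (W x₀ - φ x₀)) δ (hφ.add contDiff_const) (by ring)
        (fun x hx => by
          have := hmax hx
          simp only [mem_ofPred_eq] at this
          linarith) z δ hδ (by rw [hz, mul_one])
      rwa [opa_add_const] at this
    · intro δ φ _ _ x₀ hx₀ _
      exact (min_le_right _ _).trans (hfr x₀ hx₀).le
  · rw [hL]
    refine ⟨hWb, hW.lowerSemicontinuous, fun x hx => (hout x hx).ge, ?_, ?_⟩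
    · intro δ φ hδ hφ x₀ hx₀ hmin
      rw [lowerExt_eq_self hWg, evalE_nonneg_iff hs₀ hs₁ hδ hφ hB]
      intro c hc
      have := hsup x₀ hx₀ (fun y => φ y + (W x₀ - φ x₀)) δ (hφ.add contDiff_const) (by ring)
        (fun x hx => by
          have := hmin hx
          simp only [mem_ofPred_eq] at this
          linarith) δ hδ le_rfl c hc
      simpa only [opa_add_const] using this
    · intro δ φ _ _ x₀ hx₀ _
      exact (hfr x₀ hx₀).ge.trans (le_max_right _ _)

/-- Viscosity solutions coincide with a continuous function attaining the datum and passing both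
tests. -/
lemma IsViscositySol.eq (hΩ : IsStrictDomain Ω) (hg : ContinuousOn g Ωᶜ)
    (hgb : ∃ M : ℝ, ∀ x ∈ Ωᶜ, |g x| ≤ M) {u W : EuclideanSpace ℝ (Fin N) → ℝ}
    (hu : IsViscositySol s Ω g u)
    (hW : Continuous W) (hWb : ∃ M : ℝ, ∀ x, |W x| ≤ M)
    (hWg : ∀ x ∉ Ω, W x = g x) (hsub : TestSub s Ω W) (hsup : TestSuper s Ω W) : u = W := by
  obtain ⟨M, hM⟩ := hu.bounded
  ext x
  apply le_antisymm
  · set v := upperEnv u with hv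
    have hvs := hu.sub
    have hU := upperExt_upperSemicontinuous hΩ.isOpen hg hvs.usc hvs.exterior
    have hUb := exists_bound_upperExt hgb hvs.bounded
    have htest := hvs.testSub_upperExt hs₀ hs₁ hΩ.isOpen (hU.lineBounded hUb)
    have hext : ∀ y ∉ closure Ω, upperExt Ω g v y ≤ g y := fun y hy => by
      rw [upperExt_eq hΩ.isOpen hvs.exterior fun h => hy (subset_closure h)]
      exact max_le (hvs.exterior y hy) le_rfl
    have hbdry := htest.le_datum hs₀ hs₁ hΩ hg hU hUb hext
    have hcomp := comparison hs₀ hs₁ hΩ.isOpen hΩ.isOpen hΩ.bounded hU hUb hW.lowerSemicontinuous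
      hWb 0 (ContinuousLinearMap.id ℝ (EuclideanSpace ℝ (Fin N))) (fun y hy => by simpa using hy)
      (htest.mono fun y hy => Or.inl hy) hsup (fun y hy => by
        simp only [zero_add, ContinuousLinearMap.coe_id', id_eq]
        rw [hWg y hy]
        by_cases hc : y ∈ closure Ω
        · exact hbdry y (by rw [hΩ.isOpen.frontier_eq]; exact ⟨hc, hy⟩)
        · exact hext y hc) x
    simp only [zero_add, ContinuousLinearMap.coe_id', id_eq] at hcomp
    -- Both passing to the envelope and extending by `g` raise the function, so the comparison
    -- bounds `u` itself.
    exact (le_upperEnv (Eventually.of_forall hM)).trans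
      ((le_upperExt hΩ.isOpen hvs.exterior x).trans hcomp)
  · set v := lowerEnv u with hv
    have hvs := hu.super
    have hext' : ∀ x ∉ closure Ω, (-v) x ≤ (-g) x := fun x hx => neg_le_neg (hvs.exterior x hx)
    have hV : LowerSemicontinuous (lowerExt Ω g v) := by
      rw [lowerExt_eq_neg]
      exact (upperExt_upperSemicontinuous hΩ.isOpen hg.neg hvs.lsc.neg_upper hext').neg_lower
    have hVb : ∃ M, ∀ x, |lowerExt Ω g v x| ≤ M := by
      rw [lowerExt_eq_neg]
      simpa using exists_bound_upperExt (Ω := Ω) (g := -g) (u := -v) (by simpa using hgb)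
        (by simpa using hvs.bounded)
    have htest := hvs.testSuper_lowerExt hs₀ hs₁ hΩ.isOpen (hV.lineBounded hVb)
    have hext : ∀ y ∉ closure Ω, g y ≤ lowerExt Ω g v y := fun y hy => by
      have h1 := hext' y hy
      rw [lowerExt_eq_neg, Pi.neg_apply,
        upperExt_eq hΩ.isOpen hext' fun h => hy (subset_closure h), max_eq_right h1, Pi.neg_apply,
        neg_neg]
    have hbdry := htest.datum_le hs₀ hs₁ hΩ hg hV hVb hext
    have hcomp := comparison hs₀ hs₁ hΩ.isOpen hΩ.isOpen hΩ.bounded hW.upperSemicontinuous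
      hWb hV hVb 0 (ContinuousLinearMap.id ℝ (EuclideanSpace ℝ (Fin N)))
      (fun y hy => by simpa using hy)
      hsub (fun y hy => htest y (Or.inl hy)) (fun y hy => by
        simp only [zero_add, ContinuousLinearMap.coe_id', id_eq]
        rw [hWg y hy]
        by_cases hc : y ∈ closure Ω
        · exact hbdry y (by rw [hΩ.isOpen.frontier_eq]; exact ⟨hc, hy⟩)
        · exact hext y hc) x
    simp only [zero_add, ContinuousLinearMap.coe_id', id_eq] at hcomp
    have h1 := le_upperExt hΩ.isOpen hext' x
    rw [lowerExt_eq_neg, Pi.neg_apply] at hcomp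
    rw [Pi.neg_apply] at h1
    have h2 := lowerEnv_le hM x
    linarith

end Viscosity

lemma IsStrictlyConvexC2Domain.isStrictDomain {Ω : Set (EuclideanSpace ℝ (Fin N))}
    (hΩ : IsStrictlyConvexC2Domain Ω) :
    IsStrictDomain Ω :=
  ⟨hΩ.isOpen, hΩ.nonempty, hΩ.bounded, hΩ.convex, hΩ.strictConvex⟩

end FracConvex

end

/-! ### The envelope as the Perron solution -/

theorem theorem1p1 {N : ℕ} (hN : 1 ≤ N) {s : ℝ} (hs₀ : 0 < s) (hs₁ : s < 1)
    {Ω : Set (EuclideanSpace ℝ (Fin N))} (hΩ : IsStrictlyConvexC2Domain Ω)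
    {g : EuclideanSpace ℝ (Fin N) → ℝ} (hg : ContinuousOn g Ωᶜ)
    (hgb : ∃ M : ℝ, ∀ x ∈ Ωᶜ, |g x| ≤ M) :
    -- the envelope is well defined: a finite supremum, attained by a member of the class
    ((∀ x, BddAbove ((fun w : EuclideanSpace ℝ (Fin N) → ℝ => w x) '' belowDatum s Ω g)) ∧
      sConvexEnvelope s Ω g ∈ belowDatum s Ω g) ∧
    ContinuousOn (sConvexEnvelope s Ω g) (closure Ω) ∧
    (∀ x ∈ frontier Ω, sConvexEnvelope s Ω g x = g x) ∧
    -- the envelope is the unique viscosity solution with exterior datum `g`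
    (∀ x ∈ Ωᶜ, sConvexEnvelope s Ω g x = g x) ∧
    IsViscositySol s Ω g (sConvexEnvelope s Ω g) ∧
    ∀ u : EuclideanSpace ℝ (Fin N) → ℝ, IsViscositySol s Ω g u → u = sConvexEnvelope s Ω g := by
  -- This makes the space nontrivial, so unit directions exist.
  have : Nonempty (Fin N) := ⟨⟨0, hN⟩⟩
  have hΩ' := hΩ.isStrictDomain
  obtain ⟨W, hW, hWb, hWg, hsub, hsup⟩ := exists_solution hs₀ hs₁ hΩ' hg hgb
  have hmem : W ∈ belowDatum s Ω g :=
    mem_belowDatum hs₀ hs₁ hΩ' hW hWb (fun x hx => (hWg x hx).le) hsub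
  have hgreatest : ∀ x, IsGreatest
      ((fun w : EuclideanSpace ℝ (Fin N) → ℝ => w x) '' belowDatum s Ω g) (W x) := fun x => by
    refine ⟨⟨W, hmem, rfl⟩, ?_⟩
    rintro _ ⟨w, hw, rfl⟩
    exact le_of_mem_belowDatum hs₀ hs₁ hΩ' hg hgb hW hWb hWg hsup hw x
  have hEnv : sConvexEnvelope s Ω g = W := funext fun x => (hgreatest x).csSup_eq
  rw [hEnv]
  refine ⟨⟨fun x => (hgreatest x).bddAbove, hmem⟩, hW.continuousOn, fun x hx => ?_, hWg,
    isViscositySol_of_test hs₀ hs₁ hW hWb hWg hsub hsup hΩ'.isOpen,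
    fun u hu => hu.eq hs₀ hs₁ hΩ' hg hgb hW hWb hWg hsub hsup⟩
  rw [hΩ'.isOpen.frontier_eq] at hx
  exact hWg x hx.2
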